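/- Let $p_1,p_2,p_3\in\mathbb{R}^3$ be points whose pairwise distances all equal $1$, and let $K=\bigcap_{i=1}^3\{x\in\mathbb{R}^3:|x-p_i|\le 1\}$ be the intersection of the three closed unit balls centred at them (the spherical trihedron). Write $VL$ for the volume of $K$, $AR$ for its surface area (the two-dimensional measure of $\partial K$), and $$MW=\frac1{4\pi}\int_{S^2}\Bigl(\max_{x\in K}\langle x,u\rangle-\min_{x\in K}\langle x,u\rangle\Bigr)\,d\sigma(u)$$ for its mean width (the average over all unit directions $u$ of the width of $K$ in direction $u$), and $\operatorname{arcsec}(3)=\arccos(1/3)$. Then: 1. $VL=\frac1{12}\bigl[2\sqrt2+24\pi-57\operatorname{arcsec}(3)\bigr]$. 2. $AR=6\,[\pi-2\operatorname{arcsec}(3)]$. 3. For $i\ne j$, the edge of $K$ on which the faces lying on the unit spheres about $p_i$ and $p_j$ meet, i.e. $\{x\in K:|x-p_i|=|x-p_j|=1\}$, is an arc of the circle with radius $\sqrt3/2$ centred at the midpoint of $p_i$ and $p_j$; it subtends the angle $2\operatorname{arcsec}(3)$ at that centre. At every point $x$ of this edge the dihedral angle, measured between the outward normals $x-p_i$ and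 $x-p_j$ of the two spheres, equals $\pi/3$. 4. The mean width is $$MW=\frac1{2\pi}AR+\frac3{4\pi}\cdot\frac\pi3\cdot\bigl(2\operatorname{arcsec}(3)\bigr)\cdot\frac{\sqrt3}2=\frac{12\pi-(24-\sqrt3\,\pi)\operatorname{arcsec}(3)}{4\pi},$$ with decimal expansion $MW=1.182061751038757\ldots$, that is, $1.182061751038757\le MW<1.182061751038758$. -/

import Mathlib

open MeasureTheory

namespace Trihedron

/-- Euclidean three-space. -/
abbrev E3 : Type := EuclideanSpace ℝ (Fin 3)

/-- The principal branch of the arcsecant, `arcsec x = arccos (1 / x)` for `|x| ≥ 1`. -/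
noncomputable def arcsec (x : ℝ) : ℝ := Real.arccos (1 / x)

/-- The intersection of the three closed unit balls with centres `p 0`, `p 1`, `p 2`. -/
def trihedron (p : Fin 3 → E3) : Set E3 := ⋂ i, Metric.closedBall (p i) 1

/-- The `i`-th face: the part of the solid that lies on the `i`-th unit sphere. -/
def face (p : Fin 3 → E3) (i : Fin 3) : Set E3 := trihedron p ∩ Metric.sphere (p i) 1

/-- The edge along which the `i`-th and the `j`-th face meet (meant for `i ≠ j`). -/
def edge (p : Fin 3 → E3) (i j : Fin 3) : Set E3 := face p i ∩ face p j

/-- Volume: three-dimensional Lebesgue measure. -/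
noncomputable def vol (K : Set E3) : ℝ := (volume K).toReal

/-- Surface area: two-dimensional Hausdorff measure of the boundary, normalized so as to agree with
Lebesgue measure on planes. -/
noncomputable def surfaceArea (K : Set E3) : ℝ :=
  ((Measure.euclideanHausdorffMeasure 2 : Measure E3) (frontier K)).toReal

/-- The width of `K` in the direction `u`: for a unit vector `u` and a compact nonempty `K`, the
distance between the two supporting planes of `K` orthogonal to `u`. -/
noncomputable def width (K : Set E3) (u : E3) : ℝ :=
  sSup ((fun x => inner ℝ u x) '' K) - sInf ((fun x => inner ℝ u x) '' K)

/-- Mean width: the average of the width over all unit directions, with respect to the surface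
measure of the unit sphere. -/
noncomputable def meanWidth (K : Set E3) : ℝ :=
  ⨍ u : Metric.sphere (0 : E3) 1, width K (u : E3) ∂((volume : Measure E3).toSphere)

/-- `S` is an arc, subtending the angle `θ` at its centre, of a circle with centre `c` and
radius `r`. -/
def IsCircularArc (S : Set E3) (c : E3) (r θ : ℝ) : Prop :=
  0 < r ∧ 0 < θ ∧ θ < 2 * Real.pi ∧
    ∃ e f : E3, ‖e‖ = 1 ∧ ‖f‖ = 1 ∧ inner ℝ e f = 0 ∧
      S = (fun t : ℝ => c + (r * Real.cos t) • e + (r * Real.sin t) • f) ''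
        Set.Icc (-(θ / 2)) (θ / 2)

/-- The angle at a common point `x` of the spheres with centres `a` and `b` between their outward
normals `x - a` and `x - b`. -/
noncomputable def dihedralAngle (a b x : E3) : ℝ := InnerProductGeometry.angle (x - a) (x - b)

end Trihedron

open scoped Pointwise NNReal ENNReal Topology

namespace Trihedron

/-! Write α = arccos(1/3), and B for the unit ball.

Volume. Off three bisector planes the distances from a point of K to the centres are distinct, and
sorting them cuts K into six congruent pieces. With the farthest centre as origin and d, e the unit
vectors towards the other two, a piece is {|y| ≤ 1, 1/2 ≤ ⟨y,d⟩ ≤ ⟨y,e⟩}. Its sections orthogonal to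
d are circular segments, and their areas have an elementary antiderivative (`volume_cut_ball`).

Area. The Hausdorff area of a measurable subset of the unit sphere is three times the volume of its
solid cone (`euclideanHausdorffMeasure_eq_solidCone`), because central projection of a small cap to
a tangent plane is nearly isometric. Each face is a lens on a unit sphere. The cone over half a lens
is one of the six pieces above together with a flat cone over a circular segment
(`volume_lensCone`). Distinct faces overlap in arcs, which have area zero.

Edges. Two of the spheres meet in a circle of radius √3/2, and the third ball keeps exactly the
points with cos t ≥ 1/3. A point of an edge forms an equilateral triangle with the two centres,
which gives the angle π/3.

Mean width. For small t the body B + tK agrees to first order with the star body of radial function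
1 + t·h, where h is the support function of K. Hence the r² coefficient M of vol(K + rB) equals the
integral of h over the sphere, and the mean width is M/(2π) (`integral_supportFn`,
`meanWidth_eq_of_volume_parallelBody`). To find M, the set (K + rB) \ K is split according to which
spheres contain the nearest point of K. Normal cones are generated by the active normals x - p i
(`isNormalAt_iff`). The zones over faces are parts of spherical shells. Those over edges are sectors
of angle π/3 swept through the angle 2α, so a Pappus argument gives their volume. Those over
vertices are homogeneous of degree 3 in r and do not affect M. This gives M = 6(π - 2α) + √3πα/2. -/

/-! ### Numerical bounds for arccos(1/3) and for the closed form of the mean width -/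

theorem sin_sub_taylor_abs_le {x : ℝ} (hx : |x| ≤ 1) :
    |Real.sin x - (x - x ^ 3 / 6 + x ^ 5 / 120 - x ^ 7 / 5040 + x ^ 9 / 362880
      - x ^ 11 / 39916800 + x ^ 13 / 6227020800 - x ^ 15 / 1307674368000)| ≤
      |x| ^ 16 * (17 / 334764638208000) := by
  -- Sixteen terms of the series of exp(ix); the imaginary part is the sine polynomial, and the
  -- error constant is 17 / (16! · 16).
  have h := Complex.exp_bound (x := (x : ℂ) * Complex.I) (by simpa using hx) (n := 16) (by norm_num)
  have h2 := (Complex.abs_im_le_norm _).trans h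
  have key : (Complex.exp ((x : ℂ) * Complex.I) -
      ∑ m ∈ Finset.range 16, ((x : ℂ) * Complex.I) ^ m / (m.factorial : ℂ)).im =
      Real.sin x - (x - x ^ 3 / 6 + x ^ 5 / 120 - x ^ 7 / 5040 + x ^ 9 / 362880
      - x ^ 11 / 39916800 + x ^ 13 / 6227020800 - x ^ 15 / 1307674368000) := by
    rw [Complex.sub_im, Complex.exp_ofReal_mul_I_im]
    congr 1
    have I3 : Complex.I ^ 3 = -Complex.I := by rw [pow_succ, Complex.I_sq]; ring
    have I4 : Complex.I ^ 4 = 1 := Complex.I_pow_four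
    have : ∑ m ∈ Finset.range 16, ((x : ℂ) * Complex.I) ^ m / (m.factorial : ℂ) =
        ((1 - x ^ 2 / 2 + x ^ 4 / 24 - x ^ 6 / 720 + x ^ 8 / 40320 - x ^ 10 / 3628800 +
          x ^ 12 / 479001600 - x ^ 14 / 87178291200 : ℝ) : ℂ) +
        ((x - x ^ 3 / 6 + x ^ 5 / 120 - x ^ 7 / 5040 + x ^ 9 / 362880
      - x ^ 11 / 39916800 + x ^ 13 / 6227020800 - x ^ 15 / 1307674368000 : ℝ) : ℂ) *
          Complex.I := by
      simp only [Finset.sum_range_succ, Finset.sum_range_zero, Nat.factorial, mul_pow]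
      rw [show Complex.I ^ 5 = Complex.I ^ 4 * Complex.I by ring,
        show Complex.I ^ 6 = Complex.I ^ 4 * Complex.I ^ 2 by ring,
        show Complex.I ^ 7 = Complex.I ^ 4 * Complex.I ^ 3 by ring,
        show Complex.I ^ 8 = (Complex.I ^ 4) ^ 2 by ring,
        show Complex.I ^ 9 = (Complex.I ^ 4) ^ 2 * Complex.I by ring,
        show Complex.I ^ 10 = (Complex.I ^ 4) ^ 2 * Complex.I ^ 2 by ring,
        show Complex.I ^ 11 = (Complex.I ^ 4) ^ 2 * Complex.I ^ 3 by ring,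
        show Complex.I ^ 12 = (Complex.I ^ 4) ^ 3 by ring,
        show Complex.I ^ 13 = (Complex.I ^ 4) ^ 3 * Complex.I by ring,
        show Complex.I ^ 14 = (Complex.I ^ 4) ^ 3 * Complex.I ^ 2 by ring,
        show Complex.I ^ 15 = (Complex.I ^ 4) ^ 3 * Complex.I ^ 3 by ring, I3, I4, Complex.I_sq]
      push_cast
      ring
    rw [this]
    simp only [Complex.add_im, Complex.ofReal_im, Complex.mul_I_im, Complex.ofReal_re, zero_add]
  rw [key] at h2
  refine h2.trans (le_of_eq ?_)
  simp [Nat.factorial]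
  norm_num

/-- The complement arcsin(1/3) of arccos(1/3) is about 0.34, so the factor |x|^16 puts the Taylor
error near 10⁻²¹. It then suffices to compare sines at two rational points. -/
theorem arcsin_third_bounds :
    0.339836909454121937 ≤ Real.arcsin (1 / 3) ∧ Real.arcsin (1 / 3) ≤ 0.339836909454121938 := by
  have hpi := Real.pi_gt_three
  constructor
  · rw [Real.le_arcsin_iff_sin_le ⟨by linarith, by linarith⟩ ⟨by norm_num, by norm_num⟩]
    have h := (abs_le.1 (sin_sub_taylor_abs_le (x := 0.339836909454121937) (by norm_num))).2
    rw [sub_le_iff_le_add] at h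
    refine h.trans ?_
    norm_num
  · rw [Real.arcsin_le_iff_le_sin ⟨by norm_num, by norm_num⟩ ⟨by linarith, by linarith⟩]
    have h := (abs_le.1 (sin_sub_taylor_abs_le (x := 0.339836909454121938) (by norm_num))).1
    rw [le_sub_iff_add_le] at h
    refine le_trans ?_ h
    norm_num

theorem arcsec_three_bounds :
    1.230959417340774681 ≤ arcsec 3 ∧ arcsec 3 ≤ 1.230959417340774683 := by
  obtain ⟨h1, h2⟩ := arcsin_third_bounds
  have h3 := Real.pi_gt_d20
  have h4 := Real.pi_lt_d20
  have hα : arcsec 3 = Real.pi / 2 - Real.arcsin (1 / 3) := rfl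
  rw [hα]
  constructor <;> norm_num at * <;> linarith

theorem meanWidth_formula_bounds :
    1.182061751038757 ≤ (12 * Real.pi - (24 - Real.sqrt 3 * Real.pi) * arcsec 3) / (4 * Real.pi) ∧
    (12 * Real.pi - (24 - Real.sqrt 3 * Real.pi) * arcsec 3) / (4 * Real.pi) <
      1.182061751038758 := by
  obtain ⟨h7, h8⟩ := arcsec_three_bounds
  have h3 := Real.pi_gt_d20
  have h4 := Real.pi_lt_d20
  have h5 : 1.732050807568877293 ≤ Real.sqrt 3 := Real.le_sqrt_of_sq_le (by norm_num)
  have h6 : Real.sqrt 3 ≤ 1.732050807568877294 := Real.sqrt_le_iff.2 ⟨by norm_num, by norm_num⟩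
  have hpi := Real.pi_pos
  have e1 : 1.732050807568877293 * 1.230959417340774681 ≤ Real.sqrt 3 * arcsec 3 :=
    mul_le_mul h5 h7 (by norm_num) (by positivity)
  have e2 : Real.sqrt 3 * arcsec 3 ≤ 1.732050807568877294 * 1.230959417340774683 :=
    mul_le_mul h6 h8 (by linarith) (by norm_num)
  have key : 12 * Real.pi - (24 - Real.sqrt 3 * Real.pi) * arcsec 3 =
      Real.pi * (12 + Real.sqrt 3 * arcsec 3) - 24 * arcsec 3 := by ring
  rw [key, le_div_iff₀ (by positivity), div_lt_iff₀ (by positivity)]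
  constructor
  · have : 3.14159265358979323846 * (12 + 1.732050807568877293 * 1.230959417340774681 -
        4 * 1.182061751038757) ≤ Real.pi * (12 + Real.sqrt 3 * arcsec 3 - 4 * 1.182061751038757) :=
      mul_le_mul h3.le (by linarith) (by norm_num) hpi.le
    norm_num at *
    linarith
  · have : Real.pi * (12 + Real.sqrt 3 * arcsec 3 - 4 * 1.182061751038758) ≤
        3.14159265358979323847 * (12 + 1.732050807568877294 * 1.230959417340774683 -
        4 * 1.182061751038758) :=
      mul_le_mul h4.le (by linarith) (by norm_num at *; linarith) (by norm_num)
    norm_num at *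
    linarith

/-! ### Orthonormal coordinates and slicing -/

/-- The point with coordinates `(s, a, b)` in an orthonormal basis of three-space. -/
noncomputable def ofCoords (B : OrthonormalBasis (Fin 3) ℝ E3) (q : ℝ × ℝ × ℝ) : E3 :=
  q.1 • B 0 + q.2.1 • B 1 + q.2.2 • B 2

theorem measurePreserving_ofCoords (B : OrthonormalBasis (Fin 3) ℝ E3) :
    MeasurePreserving (ofCoords B) volume volume := by
  have h1 := (measurePreserving_finTwoArrow (volume : Measure ℝ)).symm
  have h2 := (MeasurePreserving.id (volume : Measure ℝ)).prod h1
  have h3 := (volume_preserving_piFinSuccAbove (fun _ : Fin 3 => ℝ) 0).symm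
  have h4 := EuclideanSpace.volume_preserving_symm_measurableEquiv_toLp (Fin 3)
  have h5 := B.measurePreserving_repr_symm
  have := h5.comp (h4.symm.comp (h3.comp h2))
  have hf : ofCoords B = B.repr.symm ∘ (MeasurableEquiv.toLp 2 (Fin 3 → ℝ)).symm.symm ∘
      (MeasurableEquiv.piFinSuccAbove (fun _ : Fin 3 => ℝ) 0).symm ∘
        Prod.map id MeasurableEquiv.finTwoArrow.symm := by
    ext1 q
    rw [Function.comp_apply, ← B.sum_repr_symm, Fin.sum_univ_three]
    rfl
  rw [hf]
  exact this

theorem inner_ofCoords_zero (B : OrthonormalBasis (Fin 3) ℝ E3) (q : ℝ × ℝ × ℝ) :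
    inner ℝ (ofCoords B q) (B 0) = q.1 := by
  simp [ofCoords, inner_add_left, inner_smul_left, B.inner_eq_ite]

theorem inner_ofCoords_one (B : OrthonormalBasis (Fin 3) ℝ E3) (q : ℝ × ℝ × ℝ) :
    inner ℝ (ofCoords B q) (B 1) = q.2.1 := by
  simp [ofCoords, inner_add_left, inner_smul_left, B.inner_eq_ite]

theorem inner_ofCoords_two (B : OrthonormalBasis (Fin 3) ℝ E3) (q : ℝ × ℝ × ℝ) :
    inner ℝ (ofCoords B q) (B 2) = q.2.2 := by
  simp [ofCoords, inner_add_left, inner_smul_left, B.inner_eq_ite]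

theorem norm_sq_ofCoords (B : OrthonormalBasis (Fin 3) ℝ E3) (q : ℝ × ℝ × ℝ) :
    ‖ofCoords B q‖ ^ 2 = q.1 ^ 2 + q.2.1 ^ 2 + q.2.2 ^ 2 := by
  rw [← real_inner_self_eq_norm_sq]
  nth_rw 2 [ofCoords]
  rw [inner_add_right, inner_add_right, inner_smul_right, inner_smul_right, inner_smul_right,
    inner_ofCoords_zero, inner_ofCoords_one, inner_ofCoords_two]
  ring

theorem ofCoords_inner (B : OrthonormalBasis (Fin 3) ℝ E3) (y : E3) :
    ofCoords B (inner ℝ y (B 0), inner ℝ y (B 1), inner ℝ y (B 2)) = y := by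
  have := B.sum_repr' y
  rw [Fin.sum_univ_three] at this
  simpa [ofCoords, real_inner_comm] using this

theorem volume_eq_coords (B : OrthonormalBasis (Fin 3) ℝ E3) {S : Set E3} (hS : MeasurableSet S) :
    volume S = ∫⁻ s : ℝ, volume {w : ℝ × ℝ | ofCoords B (s, w) ∈ S} := by
  rw [← (measurePreserving_ofCoords B).measure_preimage hS.nullMeasurableSet,
    Measure.volume_eq_prod,
    Measure.prod_apply ((measurePreserving_ofCoords B).measurable hS)]
  rfl

/-- Two unit vectors enclosing the angle `π / 3` span an adapted orthonormal basis. -/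
theorem exists_adapted_basis {d e : E3} (hd : ‖d‖ = 1) (he : ‖e‖ = 1) (h : inner ℝ d e = 1 / 2) :
    ∃ B : OrthonormalBasis (Fin 3) ℝ E3,
      B 0 = d ∧ e = (1 / 2 : ℝ) • d + (Real.sqrt 3 / 2) • B 1 := by
  -- Gram–Schmidt: the component of `e` orthogonal to `d` has length √3/2.
  set g : E3 := (2 / Real.sqrt 3) • (e - (1 / 2 : ℝ) • d) with hg
  have h3 : Real.sqrt 3 ^ 2 = 3 := Real.sq_sqrt (by norm_num)
  have h3' : Real.sqrt 3 ≠ 0 := by positivity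
  have hdd : inner ℝ d d = (1 : ℝ) := by rw [real_inner_self_eq_norm_sq, hd]; norm_num
  have hee : inner ℝ e e = (1 : ℝ) := by rw [real_inner_self_eq_norm_sq, he]; norm_num
  have h' : inner ℝ e d = (1 / 2 : ℝ) := by rw [real_inner_comm, h]
  have hgg : inner ℝ g g = (1 : ℝ) := by
    simp only [hg, inner_smul_left, inner_smul_right, inner_sub_left, inner_sub_right, hdd, hee, h,
      h']
    simp
    field_simp
    rw [h3]; norm_num
  have hdg : inner ℝ d g = (0 : ℝ) := by
    simp only [hg, inner_smul_right, inner_sub_right, hdd, h]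
    norm_num
  have hg1 : ‖g‖ = 1 := by
    rw [real_inner_self_eq_norm_sq] at hgg
    exact (pow_eq_one_iff_of_nonneg (norm_nonneg g) two_ne_zero).1 hgg
  have horth : Orthonormal ℝ (({0, 1} : Set (Fin 3)).domRestrict ![d, g, 0]) := by
    constructor
    · rintro ⟨i, hi⟩
      rcases hi with rfl | rfl
      exacts [hd, hg1]
    · rintro ⟨i, hi⟩ ⟨j, hj⟩ hij
      rcases hi with rfl | rfl <;> rcases hj with rfl | rfl
      exacts [absurd rfl hij, hdg, (real_inner_comm _ _).trans hdg, absurd rfl hij]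
  obtain ⟨B, hB⟩ := horth.exists_orthonormalBasis_extension_of_card_eq (by simp)
  have h0 : B 0 = d := hB 0 (by simp)
  have h1 : B 1 = g := hB 1 (by simp)
  refine ⟨B, h0, ?_⟩
  rw [h1, hg, smul_smul]
  have : Real.sqrt 3 / 2 * (2 / Real.sqrt 3) = 1 := by field_simp
  rw [this]; module

/-! ### Elementary volumes: segments, the sixth of the trihedron, cones over lenses -/

/-- Differentiability is asked only in the open interval because the antiderivatives below contain
square roots and arccosines that are singular at an endpoint. -/
theorem lintegral_Icc_ofReal_eq_sub {a b : ℝ} {f F : ℝ → ℝ} (hab : a ≤ b)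
    (hf : ContinuousOn f (Set.Icc a b)) (hpos : ∀ x ∈ Set.Icc a b, 0 ≤ f x)
    (hF : ContinuousOn F (Set.Icc a b)) (hderiv : ∀ x ∈ Set.Ioo a b, HasDerivAt F (f x) x) :
    ∫⁻ x in Set.Icc a b, ENNReal.ofReal (f x) = ENNReal.ofReal (F b - F a) := by
  have hint : IntegrableOn f (Set.Icc a b) := hf.integrableOn_Icc
  rw [← ofReal_integral_eq_lintegral_ofReal hint
    ((ae_restrict_iff' measurableSet_Icc).2 (.of_forall hpos)), integral_Icc_eq_integral_Ioc,
    ← intervalIntegral.integral_of_le hab,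
    intervalIntegral.integral_eq_sub_of_hasDerivAt_of_le hab hF hderiv
      ((intervalIntegrable_iff_integrableOn_Icc_of_le hab).2 hint)]

/-- The area of the segment cut off from a disc of radius `R` by a line at distance `t` from its
centre. -/
noncomputable def segmentArea (R t : ℝ) : ℝ :=
  R ^ 2 * Real.arccos (t / R) - t * Real.sqrt (R ^ 2 - t ^ 2)

theorem volume_setOf_sq_le {c : ℝ} (hc : 0 ≤ c) :
    volume {b : ℝ | b ^ 2 ≤ c} = ENNReal.ofReal (2 * Real.sqrt c) := by
  have : {b : ℝ | b ^ 2 ≤ c} = Set.Icc (-Real.sqrt c) (Real.sqrt c) := by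
    ext b
    rw [Set.mem_ofPred_eq, Set.mem_Icc, ← abs_le, ← Real.sqrt_sq_eq_abs, Real.sqrt_le_sqrt_iff hc]
  rw [this, Real.volume_Icc]
  ring_nf

theorem volume_segment {R t : ℝ} (hR : 0 < R) (ht0 : 0 ≤ t) (ht : t ≤ R) :
    volume {w : ℝ × ℝ | t ≤ w.1 ∧ w.1 ^ 2 + w.2 ^ 2 ≤ R ^ 2} =
      ENNReal.ofReal (segmentArea R t) := by
  have hS : MeasurableSet {w : ℝ × ℝ | t ≤ w.1 ∧ w.1 ^ 2 + w.2 ^ 2 ≤ R ^ 2} := by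
    measurability
  rw [Measure.volume_eq_prod, Measure.prod_apply hS]
  have h1 : ∀ a : ℝ, volume (Prod.mk a ⁻¹' {w : ℝ × ℝ | t ≤ w.1 ∧ w.1 ^ 2 + w.2 ^ 2 ≤ R ^ 2}) =
      (Set.Icc t R).indicator (fun a => ENNReal.ofReal (2 * Real.sqrt (R ^ 2 - a ^ 2))) a := by
    intro a
    by_cases ha : a ∈ Set.Icc t R
    · rw [Set.indicator_of_mem ha, ← volume_setOf_sq_le (by nlinarith [ha.1, ha.2])]
      congr 1
      ext b
      simp only [Set.mem_preimage, Set.mem_ofPred_eq, ha.1, true_and]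
      constructor <;> intro h <;> linarith
    · rw [Set.indicator_of_notMem ha]
      convert measure_empty (μ := (volume : Measure ℝ))
      ext b
      simp only [Set.mem_preimage, Set.mem_ofPred_eq, Set.mem_empty_iff_false, iff_false]
      rintro ⟨h1, h2⟩
      exact ha ⟨h1, abs_le_of_sq_le_sq' (by nlinarith [sq_nonneg b]) hR.le |>.2⟩
  simp_rw [h1]
  rw [lintegral_indicator measurableSet_Icc,
    lintegral_Icc_ofReal_eq_sub (F := fun a => a * Real.sqrt (R ^ 2 - a ^ 2) -
      R ^ 2 * Real.arccos (a / R)) ht (by fun_prop) (fun _ _ => by positivity)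
      (Continuous.continuousOn (by
        have := Real.continuous_arccos
        fun_prop))]
  · rw [segmentArea, div_self hR.ne', Real.arccos_one]
    congr 1
    simp
  · intro x hx
    have hx0 : 0 < x := ht0.trans_lt hx.1
    have hpos : 0 < R ^ 2 - x ^ 2 := by nlinarith [hx.2]
    have hxR : x / R < 1 := (div_lt_one hR).2 hx.2
    have hxR' : 0 < x / R := by positivity
    have hs : Real.sqrt (1 - (x / R) ^ 2) = Real.sqrt (R ^ 2 - x ^ 2) / R := by
      rw [show 1 - (x / R) ^ 2 = (R ^ 2 - x ^ 2) / R ^ 2 by field_simp,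
        Real.sqrt_div hpos.le, Real.sqrt_sq hR.le]
    have d1 := (((hasDerivAt_id x).pow 2).const_sub (R ^ 2)).sqrt hpos.ne'
    have d2 := (Real.hasDerivAt_arccos (by linarith) hxR.ne).comp x
      ((hasDerivAt_id x).div_const R)
    have := ((hasDerivAt_id x).mul d1).sub (d2.const_mul (R ^ 2))
    have hsq : Real.sqrt (R ^ 2 - x ^ 2) ^ 2 = R ^ 2 - x ^ 2 := Real.sq_sqrt hpos.le
    have hsp := Real.sqrt_pos.2 hpos
    refine HasDerivAt.congr_deriv this ?_
    rw [hs]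
    simp only [id, Pi.pow_apply, Nat.cast_ofNat, Nat.add_one_sub_one, pow_one]
    field_simp
    rw [hsq]; ring

theorem segmentArea_nonneg {R t : ℝ} (hR : 0 < R) (ht0 : 0 ≤ t) (ht : t ≤ R) :
    0 ≤ segmentArea R t := by
  have hsin : Real.sin (Real.arccos (t / R)) = Real.sqrt (R ^ 2 - t ^ 2) / R := by
    rw [Real.sin_arccos, show 1 - (t / R) ^ 2 = (R ^ 2 - t ^ 2) / R ^ 2 by field_simp,
      Real.sqrt_div (by nlinarith), Real.sqrt_sq hR.le]
  have h1 := Real.sin_le (Real.arccos_nonneg (t / R))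
  rw [hsin] at h1
  have h2 : Real.sqrt (R ^ 2 - t ^ 2) ≤ Real.arccos (t / R) * R := (div_le_iff₀ hR).1 h1
  have h3 : t * Real.sqrt (R ^ 2 - t ^ 2) ≤ R * (Real.arccos (t / R) * R) :=
    mul_le_mul ht h2 (Real.sqrt_nonneg _) hR.le
  rw [segmentArea]; linarith

theorem inner_ofCoords_of_eq {B : OrthonormalBasis (Fin 3) ℝ E3} {e : E3}
    (he : e = (1 / 2 : ℝ) • B 0 + (Real.sqrt 3 / 2) • B 1) (q : ℝ × ℝ × ℝ) :
    inner ℝ (ofCoords B q) e = q.1 / 2 + Real.sqrt 3 / 2 * q.2.1 := by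
  rw [he, inner_add_right, inner_smul_right, inner_smul_right, inner_ofCoords_zero,
    inner_ofCoords_one]
  ring

/-- In the adapted basis this turns ⟨y,d⟩ ≤ ⟨y,e⟩ into the chord condition for the slice at height
s: the chord lies at distance s/√3 from the axis. -/
theorem le_half_add_iff {s a : ℝ} :
    s ≤ s / 2 + Real.sqrt 3 / 2 * a ↔ s / Real.sqrt 3 ≤ a := by
  rw [div_le_iff₀ (by positivity)]
  constructor <;> intro h <;> linarith

/-- Rewrites the arctangent left by the antiderivative in `volume_cut_ball` at its lower endpoint;
it rests on cos(2 arctan √2) = -1/3. -/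
theorem two_arctan_sqrt_two : 2 * Real.arctan (Real.sqrt 2) = Real.pi - arcsec 3 := by
  have h1 : Real.cos (2 * Real.arctan (Real.sqrt 2)) = -(1 / 3) := by
    rw [Real.cos_two_mul, Real.cos_sq_arctan, Real.sq_sqrt (by norm_num)]; norm_num
  rw [arcsec, ← Real.arccos_neg, ← h1, Real.arccos_cos]
  · have := Real.arctan_pos.2 (show 0 < Real.sqrt 2 by positivity)
    linarith
  · have := Real.arctan_lt_pi_div_two (Real.sqrt 2)
    linarith

/-- The volume of the part of the unit ball given by `1 / 2 ≤ ⟪y, d⟫ ≤ ⟪y, e⟫`. -/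
theorem volume_cut_ball {d e : E3} (hd : ‖d‖ = 1) (he : ‖e‖ = 1) (h : inner ℝ d e = 1 / 2) :
    volume {y : E3 | ‖y‖ ≤ 1 ∧ 1 / 2 ≤ inner ℝ y d ∧ inner ℝ y d ≤ inner ℝ y e} =
      ENNReal.ofReal ((2 * Real.sqrt 2 + 24 * Real.pi - 57 * arcsec 3) / 72) := by
  obtain ⟨B, rfl, hB⟩ := exists_adapted_basis hd he h
  have h3 : Real.sqrt 3 ^ 2 = 3 := Real.sq_sqrt (by norm_num)
  have h3p : 0 < Real.sqrt 3 := by positivity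
  rw [volume_eq_coords B (by measurability)]
  have h1 : ∀ s : ℝ, volume {w : ℝ × ℝ | ofCoords B (s, w) ∈
        {y : E3 | ‖y‖ ≤ 1 ∧ 1 / 2 ≤ inner ℝ y (B 0) ∧ inner ℝ y (B 0) ≤ inner ℝ y e}} =
      (Set.Icc (1 / 2) (Real.sqrt 3 / 2)).indicator
        (fun s => ENNReal.ofReal (segmentArea (Real.sqrt (1 - s ^ 2)) (s / Real.sqrt 3))) s := by
    intro s
    have hset : {w : ℝ × ℝ | ofCoords B (s, w) ∈
        {y : E3 | ‖y‖ ≤ 1 ∧ 1 / 2 ≤ inner ℝ y (B 0) ∧ inner ℝ y (B 0) ≤ inner ℝ y e}} =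
        {w : ℝ × ℝ | s ^ 2 + w.1 ^ 2 + w.2 ^ 2 ≤ 1 ∧ 1 / 2 ≤ s ∧ s / Real.sqrt 3 ≤ w.1} := by
      ext w
      simp only [Set.mem_ofPred_eq, inner_ofCoords_zero, inner_ofCoords_of_eq hB, le_half_add_iff]
      rw [← sq_le_one_iff₀ (norm_nonneg _), norm_sq_ofCoords]
    rw [hset]
    by_cases hs : s ∈ Set.Icc (1 / 2) (Real.sqrt 3 / 2)
    · have hs1 : 1 / 2 ≤ s := hs.1
      have hs2 : s ≤ Real.sqrt 3 / 2 := hs.2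
      have hs3 : s ^ 2 ≤ 3 / 4 := by nlinarith
      rw [Set.indicator_of_mem hs, ← volume_segment]
      · congr 1
        ext w
        simp only [Set.mem_ofPred_eq]
        rw [Real.sq_sqrt (by linarith)]
        constructor
        · rintro ⟨h1, -, h2⟩; exact ⟨h2, by linarith⟩
        · rintro ⟨h1, h2⟩; exact ⟨by linarith, hs1, h1⟩
      · apply Real.sqrt_pos.2; linarith
      · positivity
      · apply Real.le_sqrt_of_sq_le
        rw [div_pow, h3]; linarith
    · rw [Set.indicator_of_notMem hs]
      convert measure_empty (μ := (volume : Measure (ℝ × ℝ)))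
      ext w
      simp only [Set.mem_ofPred_eq, Set.mem_empty_iff_false, iff_false]
      rintro ⟨h1, h2, h4⟩
      refine hs ⟨h2, ?_⟩
      have h5 : (s / Real.sqrt 3) ^ 2 ≤ w.1 ^ 2 := pow_le_pow_left₀ (by positivity) h4 2
      rw [div_pow, h3] at h5
      nlinarith [sq_nonneg w.2]
  simp_rw [h1]
  have hle : (1 / 2 : ℝ) ≤ Real.sqrt 3 / 2 := by nlinarith
  have hR : ∀ s ∈ Set.Icc (1 / 2) (Real.sqrt 3 / 2), Real.sqrt (1 - s ^ 2) ≠ 0 := by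
    intro s hs
    have hs1 : 1 / 2 ≤ s := hs.1
    have hs2 : s ≤ Real.sqrt 3 / 2 := hs.2
    refine (Real.sqrt_pos.2 ?_).ne'
    nlinarith
  have hcont : ContinuousOn (fun s : ℝ => Real.arccos (s / Real.sqrt 3 / Real.sqrt (1 - s ^ 2)))
      (Set.Icc (1 / 2) (Real.sqrt 3 / 2)) := by
    refine Real.continuous_arccos.comp_continuousOn (ContinuousOn.div (by fun_prop) (by fun_prop) hR)
  -- With R² = 1 - s² and w = √(3 - 4s²), the segment area is R² g - s w/3, where g is the
  -- arccosine. Since g' = -1/(R² w), integration by parts gives (s - s³/3) g and leaves s(2 +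
  -- R²)/(3R² w). As w' = -4s/w and 1 + w² = 4R², this remainder integrates to -(w + 8 arctan w)/12;
  -- the term w³/36 integrates -s w/3.
  rw [lintegral_indicator measurableSet_Icc, lintegral_Icc_ofReal_eq_sub
    (F := fun s => (s - s ^ 3 / 3) * Real.arccos (s / Real.sqrt 3 / Real.sqrt (1 - s ^ 2)) -
      (Real.sqrt (3 - 4 * s ^ 2) + 8 * Real.arctan (Real.sqrt (3 - 4 * s ^ 2))) / 12 +
      Real.sqrt (3 - 4 * s ^ 2) ^ 3 / 36) hle]
  · congr 1
    have e1 : Real.sqrt 3 / 2 / Real.sqrt 3 / Real.sqrt (1 - (Real.sqrt 3 / 2) ^ 2) = 1 := by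
      rw [div_pow, h3, show (1 - 3 / 2 ^ 2 : ℝ) = (1 / 2) ^ 2 by norm_num,
        Real.sqrt_sq (by norm_num)]
      field_simp
    have e2 : Real.sqrt (3 - 4 * (Real.sqrt 3 / 2) ^ 2) = 0 := by
      rw [div_pow, h3]; norm_num
    have e3 : (1 / 2 : ℝ) / Real.sqrt 3 / Real.sqrt (1 - (1 / 2) ^ 2) = 1 / 3 := by
      rw [show (1 - (1 / 2) ^ 2 : ℝ) = 3 / 2 ^ 2 by norm_num, Real.sqrt_div (by norm_num),
        Real.sqrt_sq (by norm_num)]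
      field_simp
      linarith
    have e4 : Real.sqrt (3 - 4 * (1 / 2 : ℝ) ^ 2) = Real.sqrt 2 := by norm_num
    have e5 : Real.sqrt 2 ^ 3 = 2 * Real.sqrt 2 := by
      rw [pow_succ, Real.sq_sqrt (by norm_num)]
    simp only [e1, e2, e3, e4, e5, Real.arccos_one, Real.arctan_zero]
    have e6 := two_arctan_sqrt_two
    rw [arcsec] at *
    linarith
  · unfold segmentArea
    fun_prop
  · intro s hs
    have hs1 : 1 / 2 ≤ s := hs.1
    have hs2 : s ≤ Real.sqrt 3 / 2 := hs.2
    apply segmentArea_nonneg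
    · exact (Real.sqrt_nonneg _).lt_of_ne' (hR s hs)
    · positivity
    · apply Real.le_sqrt_of_sq_le
      rw [div_pow, h3]; nlinarith
  · have := Real.continuous_arctan
    fun_prop
  · intro s hs
    have hs1 : 1 / 2 < s := hs.1
    have hs2 : s < Real.sqrt 3 / 2 := hs.2
    have hs3 : s ^ 2 < 3 / 4 := by nlinarith
    have hR2 : 0 < 1 - s ^ 2 := by linarith
    have hw2 : 0 < 3 - 4 * s ^ 2 := by linarith
    set R := Real.sqrt (1 - s ^ 2) with hRdef
    set w := Real.sqrt (3 - 4 * s ^ 2) with hwdef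
    have hRp : 0 < R := Real.sqrt_pos.2 hR2
    have hwp : 0 < w := Real.sqrt_pos.2 hw2
    have hRR : R ^ 2 = 1 - s ^ 2 := Real.sq_sqrt hR2.le
    have hww : w ^ 2 = 3 - 4 * s ^ 2 := Real.sq_sqrt hw2.le
    have hu : (s / Real.sqrt 3 / R) ^ 2 = s ^ 2 / (3 * R ^ 2) := by
      rw [div_pow, div_pow, h3, div_div]
    have hu0 : 0 < s / Real.sqrt 3 / R := by positivity
    have hu1 : s / Real.sqrt 3 / R < 1 := by
      rw [← sq_lt_one_iff₀ hu0.le, hu, div_lt_one (by positivity), hRR]; linarith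
    have hsqrt1 : Real.sqrt (1 - (s / Real.sqrt 3 / R) ^ 2) = w / (Real.sqrt 3 * R) := by
      rw [hu, show 1 - s ^ 2 / (3 * R ^ 2) = (3 - 4 * s ^ 2) / (Real.sqrt 3 * R) ^ 2 by
        rw [mul_pow, h3]; field_simp; rw [hRR]; ring, Real.sqrt_div hw2.le,
        Real.sqrt_sq (by positivity)]
    have hsqrt2 : Real.sqrt (R ^ 2 - (s / Real.sqrt 3) ^ 2) = w / Real.sqrt 3 := by
      rw [hRR, div_pow, h3, show 1 - s ^ 2 - s ^ 2 / 3 = (3 - 4 * s ^ 2) / 3 by ring,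
        Real.sqrt_div hw2.le]
    have dR : HasDerivAt (fun s : ℝ => Real.sqrt (1 - s ^ 2)) (-(s / R)) s := by
      refine (((hasDerivAt_pow 2 s).const_sub 1).sqrt hR2.ne').congr_deriv ?_
      rw [← hRdef]
      field_simp
      norm_num
    have dw : HasDerivAt (fun s : ℝ => Real.sqrt (3 - 4 * s ^ 2)) (-(4 * s / w)) s := by
      refine ((((hasDerivAt_pow 2 s).const_mul 4).const_sub 3).sqrt hw2.ne').congr_deriv ?_
      rw [← hwdef]
      field_simp
      norm_num
    have dg : HasDerivAt (fun s : ℝ => Real.arccos (s / Real.sqrt 3 / Real.sqrt (1 - s ^ 2)))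
        (-(1 / (R ^ 2 * w))) s := by
      have dg0 := (Real.hasDerivAt_arccos (by linarith) hu1.ne).comp s
        (((hasDerivAt_id s).div_const (Real.sqrt 3)).div dR hRp.ne')
      refine HasDerivAt.congr_deriv dg0 ?_
      rw [hsqrt1, ← hRdef]
      simp only [id]
      field_simp
      linarith
    have d1 : HasDerivAt (fun s : ℝ => (s - s ^ 3 / 3)) (1 - s ^ 2) s := by
      refine HasDerivAt.congr_deriv ((hasDerivAt_id s).sub ((hasDerivAt_pow 3 s).div_const 3)) ?_
      norm_num
    have d2 : HasDerivAt (fun s : ℝ => Real.arctan (Real.sqrt (3 - 4 * s ^ 2)))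
        (1 / (4 * R ^ 2) * (-(4 * s / w))) s := by
      refine dw.arctan.congr_deriv ?_
      rw [← hwdef, show 1 + w ^ 2 = 4 * R ^ 2 by rw [hww, hRR]; ring]
    refine HasDerivAt.congr_deriv (((d1.mul dg).sub
      ((dw.add (d2.const_mul 8)).div_const 12)).add ((dw.pow 3).div_const 36)) ?_
    rw [segmentArea, hsqrt2, ← hwdef, ← hRdef, ← hRR]
    have e3 : s ^ 3 = s * (1 - R ^ 2) := by rw [hRR]; ring
    simp only [Nat.cast_ofNat, Nat.add_one_sub_one, e3]
    field_simp
    rw [h3]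
    ring

/-- The volume of the cone with apex `0` over the circular segment in the plane `⟪y, d⟫ = 1 / 2`
given by `‖y‖ ≤ 1` and `⟪y, d⟫ ≤ ⟪y, e⟫`. -/
theorem volume_segment_cone {d e : E3} (hd : ‖d‖ = 1) (he : ‖e‖ = 1) (h : inner ℝ d e = 1 / 2) :
    volume {y : E3 | (0 < inner ℝ y d ∧ inner ℝ y d < 1 / 2) ∧ ‖y‖ ≤ 2 * inner ℝ y d ∧
        inner ℝ y d ≤ inner ℝ y e} =
      ENNReal.ofReal ((3 * arcsec 3 - 2 * Real.sqrt 2 / 3) / 24) := by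
  obtain ⟨B, rfl, hB⟩ := exists_adapted_basis hd he h
  have h3 : Real.sqrt 3 ^ 2 = 3 := Real.sq_sqrt (by norm_num)
  have h3p : 0 < Real.sqrt 3 := by positivity
  rw [volume_eq_coords B (by measurability)]
  -- All slices of the cone are similar, so the area is quadratic in s; the ratio of chord distance
  -- to radius is always 1/3.
  have hseg : ∀ s : ℝ, 0 < s → segmentArea (Real.sqrt 3 * s) (s / Real.sqrt 3) =
      (3 * arcsec 3 - 2 * Real.sqrt 2 / 3) * s ^ 2 := by
    intro s hs
    have e1 : s / Real.sqrt 3 / (Real.sqrt 3 * s) = 1 / 3 := by field_simp; linarith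
    have e2 : (Real.sqrt 3 * s) ^ 2 - (s / Real.sqrt 3) ^ 2 =
        (2 * Real.sqrt 2 * s / Real.sqrt 3) ^ 2 := by
      rw [mul_pow, div_pow, div_pow, mul_pow, mul_pow, h3, Real.sq_sqrt (by norm_num)]; ring
    rw [segmentArea, e1, e2, Real.sqrt_sq (by positivity), mul_pow, h3, arcsec]
    field_simp
    rw [h3]; ring
  have h1 : ∀ s : ℝ, volume {w : ℝ × ℝ | ofCoords B (s, w) ∈
        {y : E3 | (0 < inner ℝ y (B 0) ∧ inner ℝ y (B 0) < 1 / 2) ∧ ‖y‖ ≤ 2 * inner ℝ y (B 0) ∧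
          inner ℝ y (B 0) ≤ inner ℝ y e}} =
      (Set.Ioo 0 (1 / 2)).indicator
        (fun s => ENNReal.ofReal ((3 * arcsec 3 - 2 * Real.sqrt 2 / 3) * s ^ 2)) s := by
    intro s
    by_cases hs : s ∈ Set.Ioo (0 : ℝ) (1 / 2)
    · have hs1 : 0 < s := hs.1
      rw [Set.indicator_of_mem hs, ← hseg s hs1, ← volume_segment (by positivity) (by positivity)]
      · congr 1
        ext w
        simp only [Set.mem_ofPred_eq, inner_ofCoords_zero, inner_ofCoords_of_eq hB,
          le_half_add_iff]
        rw [← sq_le_sq₀ (norm_nonneg _) (by positivity), norm_sq_ofCoords, mul_pow (Real.sqrt 3),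
          h3]
        constructor
        · rintro ⟨-, h1, h2⟩; exact ⟨h2, by linarith⟩
        · rintro ⟨h1, h2⟩; exact ⟨hs, by linarith, h1⟩
      · rw [div_le_iff₀ h3p]; nlinarith
    · rw [Set.indicator_of_notMem hs]
      convert measure_empty (μ := (volume : Measure (ℝ × ℝ)))
      ext w
      simp only [Set.mem_ofPred_eq, Set.mem_empty_iff_false, iff_false, inner_ofCoords_zero]
      exact fun h => hs h.1
  simp_rw [h1]
  have hnn : 0 ≤ 3 * arcsec 3 - 2 * Real.sqrt 2 / 3 := by
    have h1 := arcsec_three_bounds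
    have h3 := Real.sqrt_two_lt_three_halves
    norm_num at h1
    linarith
  rw [lintegral_indicator measurableSet_Ioo, Measure.restrict_congr_set Ioo_ae_eq_Icc,
    lintegral_Icc_ofReal_eq_sub (F := fun s => (3 * arcsec 3 - 2 * Real.sqrt 2 / 3) * (s ^ 3 / 3))
      (by norm_num) (by fun_prop) (fun _ _ => by positivity) (by fun_prop)]
  · congr 1; ring
  · intro s _
    refine (((hasDerivAt_pow 3 s).div_const 3).const_mul _).congr_deriv ?_
    norm_num

theorem volume_setOf_inner_eq_zero {n : E3} (hn : n ≠ 0) (c : ℝ) :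
    volume {y : E3 | inner ℝ y n = c} = 0 := by
  have hne : (innerSL ℝ n : E3 →L[ℝ] ℝ).toLinearMap.ker ≠ ⊤ := by
    intro h
    have : n ∈ (innerSL ℝ n : E3 →L[ℝ] ℝ).toLinearMap.ker := h ▸ Submodule.mem_top
    rw [LinearMap.mem_ker] at this
    exact hn (inner_self_eq_zero.1 this)
  have h0 := Measure.addHaar_submodule (volume : Measure E3) _ hne
  set x₀ : E3 := (c / ‖n‖ ^ 2) • n with hx
  have hx0 : inner ℝ x₀ n = c := by
    rw [hx, inner_smul_left, real_inner_self_eq_norm_sq]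
    have : ‖n‖ ≠ 0 := norm_ne_zero_iff.2 hn
    simp; field_simp
  have : {y : E3 | inner ℝ y n = c} = (fun y => y + -x₀) ⁻¹'
      ((innerSL ℝ n : E3 →L[ℝ] ℝ).toLinearMap.ker : Set E3) := by
    ext y
    simp only [Set.mem_ofPred_eq, Set.mem_preimage, SetLike.mem_coe, LinearMap.mem_ker]
    change _ ↔ inner ℝ n (y + -x₀) = 0
    rw [inner_add_right, inner_neg_right, real_inner_comm, real_inner_comm x₀, hx0]
    constructor <;> intro h <;> linarith
  rw [this, measure_preimage_add_right, h0]

/-- The part of the half-cone where the first constraint is the binding one. -/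
theorem volume_half_lensCone {d e : E3} (hd : ‖d‖ = 1) (he : ‖e‖ = 1) (h : inner ℝ d e = 1 / 2) :
    volume {y : E3 | (0 < ‖y‖ ∧ ‖y‖ ≤ 1) ∧ ‖y‖ / 2 ≤ inner ℝ y d ∧ inner ℝ y d ≤ inner ℝ y e} =
      ENNReal.ofReal ((Real.pi - 2 * arcsec 3) / 3) := by
  -- The plane ⟨y,d⟩ = 1/2 splits the cone: beyond it the bound ‖y‖ ≤ 1 implies the cap condition,
  -- and before it the cap condition implies ‖y‖ ≤ 1.
  have hset : {y : E3 | (0 < ‖y‖ ∧ ‖y‖ ≤ 1) ∧ ‖y‖ / 2 ≤ inner ℝ y d ∧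
      inner ℝ y d ≤ inner ℝ y e} =
      {y : E3 | ‖y‖ ≤ 1 ∧ 1 / 2 ≤ inner ℝ y d ∧ inner ℝ y d ≤ inner ℝ y e} ∪
      {y : E3 | (0 < inner ℝ y d ∧ inner ℝ y d < 1 / 2) ∧ ‖y‖ ≤ 2 * inner ℝ y d ∧
        inner ℝ y d ≤ inner ℝ y e} := by
    ext y
    simp only [Set.mem_union, Set.mem_ofPred_eq]
    constructor
    · rintro ⟨⟨h1, h2⟩, h3, h4⟩
      by_cases h5 : 1 / 2 ≤ inner ℝ y d
      · exact .inl ⟨h2, h5, h4⟩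
      · exact .inr ⟨⟨by linarith, by linarith⟩, by linarith, h4⟩
    · have h0 := real_inner_le_norm y d
      rw [hd, mul_one] at h0
      rintro (⟨h1, h2, h3⟩ | ⟨⟨h1, h2⟩, h3, h4⟩)
      · exact ⟨⟨by linarith, h1⟩, by linarith, h3⟩
      · exact ⟨⟨by linarith, by linarith⟩, by linarith, h4⟩
  have hm : MeasurableSet {y : E3 | (0 < inner ℝ y d ∧ inner ℝ y d < 1 / 2) ∧
      ‖y‖ ≤ 2 * inner ℝ y d ∧ inner ℝ y d ≤ inner ℝ y e} := by measurability
  rw [hset, measure_union _ hm, volume_cut_ball hd he h, volume_segment_cone hd he h,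
    ← ENNReal.ofReal_add]
  · congr 1; ring
  · have h1 := arcsec_three_bounds
    have h2 := Real.pi_gt_d2
    have h3 := Real.sqrt_nonneg 2
    norm_num at h1 h2
    linarith
  · have h1 := arcsec_three_bounds
    have h2 := Real.pi_gt_d2
    have h3 := Real.sqrt_two_lt_three_halves
    norm_num at h1 h2
    linarith
  · rw [Set.disjoint_left]
    rintro y ⟨-, h1, -⟩ ⟨⟨-, h2⟩, -⟩
    linarith

/-- The volume of the solid cone over the lens cut out of the unit sphere by two caps of angular
radius `π / 3` whose centres have angular distance `π / 3`. -/
theorem volume_lensCone {d e : E3} (hd : ‖d‖ = 1) (he : ‖e‖ = 1) (h : inner ℝ d e = 1 / 2) :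
    volume {y : E3 | (0 < ‖y‖ ∧ ‖y‖ ≤ 1) ∧ ‖y‖ / 2 ≤ inner ℝ y d ∧ ‖y‖ / 2 ≤ inner ℝ y e} =
      ENNReal.ofReal (2 * (Real.pi - 2 * arcsec 3) / 3) := by
  have hset : {y : E3 | (0 < ‖y‖ ∧ ‖y‖ ≤ 1) ∧ ‖y‖ / 2 ≤ inner ℝ y d ∧ ‖y‖ / 2 ≤ inner ℝ y e} =
      {y : E3 | (0 < ‖y‖ ∧ ‖y‖ ≤ 1) ∧ ‖y‖ / 2 ≤ inner ℝ y d ∧ inner ℝ y d ≤ inner ℝ y e} ∪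
      {y : E3 | (0 < ‖y‖ ∧ ‖y‖ ≤ 1) ∧ ‖y‖ / 2 ≤ inner ℝ y e ∧ inner ℝ y e ≤ inner ℝ y d} := by
    ext y
    simp only [Set.mem_union, Set.mem_ofPred_eq]
    constructor
    · rintro ⟨h1, h2, h3⟩
      rcases le_total (inner ℝ y d) (inner ℝ y e) with h4 | h4
      exacts [.inl ⟨h1, h2, h4⟩, .inr ⟨h1, h3, h4⟩]
    · rintro (⟨h1, h2, h3⟩ | ⟨h1, h2, h3⟩)
      exacts [⟨h1, h2, h2.trans h3⟩, ⟨h1, h2.trans h3, h2⟩]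
  have hm : MeasurableSet {y : E3 | (0 < ‖y‖ ∧ ‖y‖ ≤ 1) ∧ ‖y‖ / 2 ≤ inner ℝ y e ∧
      inner ℝ y e ≤ inner ℝ y d} := by measurability
  have hne : d - e ≠ 0 := by
    intro h0
    rw [sub_eq_zero] at h0
    rw [h0, real_inner_self_eq_norm_sq, he] at h
    norm_num at h
  rw [hset, measure_union₀ hm.nullMeasurableSet, volume_half_lensCone hd he h,
    volume_half_lensCone he hd (by rw [real_inner_comm, h]), ← ENNReal.ofReal_add]
  · congr 1; ring
  · have h1 := arcsec_three_bounds
    have h2 := Real.pi_gt_d2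
    have h3 := Real.sqrt_nonneg 2
    norm_num at h1 h2
    linarith
  · have h1 := arcsec_three_bounds
    have h2 := Real.pi_gt_d2
    have h3 := Real.sqrt_nonneg 2
    norm_num at h1 h2
    linarith
  · refine measure_mono_null ?_ (volume_setOf_inner_eq_zero hne 0)
    rintro y ⟨⟨-, -, h1⟩, ⟨-, -, h2⟩⟩
    simp only [Set.mem_ofPred_eq, inner_sub_right]
    linarith

/-! ### Volume of the trihedron -/

theorem mem_trihedron {p : Fin 3 → E3} {x : E3} : x ∈ trihedron p ↔ ∀ i, ‖x - p i‖ ≤ 1 := by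
  simp [trihedron, dist_eq_norm]

theorem norm_sub_of_dist {p : Fin 3 → E3} (hp : ∀ i j : Fin 3, i ≠ j → dist (p i) (p j) = 1)
    {i j : Fin 3} (hij : i ≠ j) : ‖p j - p i‖ = 1 := by
  rw [← dist_eq_norm, hp j i hij.symm]

theorem inner_eq_half {a b : E3} (ha : ‖a‖ = 1) (hb : ‖b‖ = 1) (hab : ‖a - b‖ = 1) :
    inner ℝ a b = 1 / 2 := by
  have := norm_sub_sq_real a b
  rw [ha, hb, hab] at this
  linarith

theorem inner_sub_of_dist {p : Fin 3 → E3} (hp : ∀ i j : Fin 3, i ≠ j → dist (p i) (p j) = 1)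
    {i j k : Fin 3} (hij : i ≠ j) (hik : i ≠ k) (hjk : j ≠ k) :
    inner ℝ (p j - p i) (p k - p i) = 1 / 2 := by
  apply inner_eq_half (norm_sub_of_dist hp hij) (norm_sub_of_dist hp hik)
  rw [sub_sub_sub_cancel_right, norm_sub_of_dist hp hjk.symm]

theorem norm_sub_le_norm_sub_iff {a b x : E3} {c : E3} (ha : ‖a - c‖ = ‖b - c‖) :
    ‖x - b‖ ≤ ‖x - a‖ ↔ inner ℝ (x - c) (a - c) ≤ inner ℝ (x - c) (b - c) := by
  rw [← sq_le_sq₀ (norm_nonneg _) (norm_nonneg _), ← sub_sub_sub_cancel_right x b c,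
    ← sub_sub_sub_cancel_right x a c, norm_sub_sq_real, norm_sub_sq_real (x - c) (a - c), ha]
  constructor <;> intro h <;> linarith

theorem norm_sub_le_iff_inner_ge {a b x : E3} (hab : ‖b - a‖ = 1) {t : ℝ} (ht : 0 ≤ t) :
    ‖x - b‖ ≤ t ↔ ‖x - a‖ ^ 2 + 1 - t ^ 2 ≤ 2 * inner ℝ (x - a) (b - a) := by
  rw [← sq_le_sq₀ (norm_nonneg _) ht, ← sub_sub_sub_cancel_right x b a, norm_sub_sq_real, hab]
  constructor <;> intro h <;> linarith

theorem measurableSet_trihedron (p : Fin 3 → E3) : MeasurableSet (trihedron p) :=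
  MeasurableSet.iInter fun _ => measurableSet_closedBall

theorem volume_bisector {a b : E3} (hab : a ≠ b) : volume {x : E3 | ‖x - a‖ = ‖x - b‖} = 0 := by
  refine measure_mono_null ?_ (volume_setOf_inner_eq_zero (sub_ne_zero.2 hab)
    ((‖a‖ ^ 2 - ‖b‖ ^ 2) / 2))
  intro x hx
  have h : ‖x - a‖ ^ 2 = ‖x - b‖ ^ 2 := by rw [Set.mem_ofPred_eq.mp hx]
  rw [norm_sub_sq_real, norm_sub_sq_real] at h
  rw [Set.mem_ofPred_eq, inner_sub_right]
  linarith

theorem volume_trihedron {p : Fin 3 → E3} (hp : ∀ i j : Fin 3, i ≠ j → dist (p i) (p j) = 1) :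
    volume (trihedron p) =
      ENNReal.ofReal ((2 * Real.sqrt 2 + 24 * Real.pi - 57 * arcsec 3) / 12) := by
  -- `T σ` collects the points whose farthest centre is `p (σ 2)` and nearest is `p (σ 0)`. Relative
  -- to `p (σ 2)`, comparing the two largest distances gives 1/2 ≤ ⟨y,d⟩, and comparing the two
  -- smallest gives ⟨y,d⟩ ≤ ⟨y,e⟩.
  set T : Equiv.Perm (Fin 3) → Set E3 := fun σ =>
    {x | ‖x - p (σ 2)‖ ≤ 1 ∧ ‖x - p (σ 1)‖ ≤ ‖x - p (σ 2)‖ ∧ ‖x - p (σ 0)‖ ≤ ‖x - p (σ 1)‖}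
    with hT
  have hmono : ∀ σ x, x ∈ T σ → Monotone ((fun i => ‖x - p i‖) ∘ σ) := by
    intro σ x hx
    rw [Fin.monotone_iff_le_succ]
    intro i
    fin_cases i
    exacts [hx.2.2, hx.2.1]
  have hm : ∀ σ, MeasurableSet (T σ) := fun σ => by
    simp only [hT]
    measurability
  have hU : trihedron p = ⋃ σ, T σ := by
    ext x
    rw [mem_trihedron, Set.mem_iUnion]
    constructor
    · intro h
      have hs := Tuple.monotone_sort (fun i => ‖x - p i‖)
      exact ⟨Tuple.sort (fun i => ‖x - p i‖), h _, hs (show (1 : Fin 3) ≤ 2 by decide),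
        hs (show (0 : Fin 3) ≤ 1 by decide)⟩
    · rintro ⟨σ, hx⟩ i
      have := hmono σ x hx (show σ.symm i ≤ 2 from Fin.le_last _)
      simp only [Function.comp_apply, Equiv.apply_symm_apply] at this
      exact this.trans hx.1
  have hv : ∀ σ, volume (T σ) =
      ENNReal.ofReal ((2 * Real.sqrt 2 + 24 * Real.pi - 57 * arcsec 3) / 72) := by
    intro σ
    have h21 : σ 2 ≠ σ 1 := σ.injective.ne (by decide)
    have h20 : σ 2 ≠ σ 0 := σ.injective.ne (by decide)
    have h10 : σ 1 ≠ σ 0 := σ.injective.ne (by decide)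
    rw [← volume_cut_ball (norm_sub_of_dist hp h21) (norm_sub_of_dist hp h20)
      (inner_sub_of_dist hp h21 h20 h10)]
    conv_rhs => rw [← measure_preimage_add_right volume (-p (σ 2))]
    congr 1
    ext x
    simp only [hT, Set.mem_preimage, Set.mem_ofPred_eq, ← sub_eq_add_neg]
    refine and_congr_right fun _ => and_congr ?_ ?_
    · rw [norm_sub_le_iff_inner_ge (norm_sub_of_dist hp h21) (norm_nonneg _)]
      constructor <;> intro h <;> linarith
    · rw [norm_sub_le_norm_sub_iff]
      rw [norm_sub_of_dist hp h21, norm_sub_of_dist hp h20]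
  have hd : Pairwise (Function.onFun (AEDisjoint volume) T) := by
    intro σ τ hστ
    -- Two different permutations can sort the same distances only if there is a tie, that is, on a
    -- bisector plane.
    have hnull : volume (⋃ i : Fin 3, ⋃ j : Fin 3, ⋃ _ : i ≠ j,
        {x : E3 | ‖x - p i‖ = ‖x - p j‖}) = 0 := by
      refine measure_iUnion_null fun i => measure_iUnion_null fun j =>
        measure_iUnion_null fun hij => volume_bisector fun h => ?_
      have := hp i j hij
      rw [h, dist_self] at this
      exact zero_ne_one this
    refine measure_mono_null ?_ hnull
    rintro x ⟨h1, h2⟩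
    by_contra hx
    simp only [Set.mem_iUnion, not_exists] at hx
    refine hστ (Equiv.ext fun i => ?_)
    have := congrFun (Tuple.unique_monotone (hmono σ x h1) (hmono τ x h2)) i
    by_contra hne
    exact hx _ _ hne this
  rw [hU, measure_iUnion₀ hd fun σ => (hm σ).nullMeasurableSet]
  simp_rw [hv]
  rw [tsum_fintype, Finset.sum_const, Finset.card_univ, Fintype.card_perm, Fintype.card_fin,
    ← ENNReal.ofReal_nsmul]
  congr 1
  simp [Nat.factorial]
  ring

theorem vol_trihedron {p : Fin 3 → E3} (hp : ∀ i j : Fin 3, i ≠ j → dist (p i) (p j) = 1) :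
    vol (trihedron p) = (2 * Real.sqrt 2 + 24 * Real.pi - 57 * arcsec 3) / 12 := by
  rw [vol, volume_trihedron hp, ENNReal.toReal_ofReal]
  have h1 := arcsec_three_bounds
  have h2 := Real.pi_gt_d2
  have h3 := Real.sqrt_nonneg 2
  norm_num at h1 h2
  linarith

/-! ### Hausdorff area on the unit sphere as cone volume -/

theorem euclideanHausdorffMeasure_image_le {X Y : Type*} [MetricSpace X] [MeasurableSpace X]
    [BorelSpace X] [MetricSpace Y] [MeasurableSpace Y] [BorelSpace Y] {K : ℝ≥0} {f : X → Y}
    {s : Set X} (h : LipschitzOnWith K f s) (d : ℕ) :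
    (Measure.euclideanHausdorffMeasure d : Measure Y) (f '' s) ≤
      (K : ℝ≥0∞) ^ d * (Measure.euclideanHausdorffMeasure d : Measure X) s := by
  rw [Measure.euclideanHausdorffMeasure_def, Measure.euclideanHausdorffMeasure_def,
    Measure.smul_apply, Measure.smul_apply, ENNReal.smul_def, ENNReal.smul_def, smul_eq_mul,
    smul_eq_mul, mul_left_comm]
  gcongr
  have := h.hausdorffMeasure_image_le (d := d) (Nat.cast_nonneg d)
  rwa [ENNReal.rpow_natCast] at this

theorem norm_normalize_sub_le {x y : E3} (hx : 1 ≤ ‖x‖) (hy : 1 ≤ ‖y‖) :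
    ‖(‖x‖⁻¹ • x) - (‖y‖⁻¹ • y)‖ ≤ ‖x - y‖ := by
  have hx0 : ‖x‖ ≠ 0 := by linarith
  have hy0 : ‖y‖ ≠ 0 := by linarith
  rw [← sq_le_sq₀ (norm_nonneg _) (norm_nonneg _), norm_sub_sq_real, norm_sub_sq_real,
    norm_smul, norm_smul, inner_smul_left, inner_smul_right]
  simp only [norm_inv, norm_norm, inv_mul_cancel₀ hx0, inv_mul_cancel₀ hy0]
  have h1 := real_inner_le_norm x y
  have h2 : ‖x‖⁻¹ * ‖y‖⁻¹ ≤ 1 := mul_le_one₀ (inv_le_one_of_one_le₀ hx) (by positivity)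
    (inv_le_one_of_one_le₀ hy)
  have h3 : inner ℝ x y * (1 - ‖x‖⁻¹ * ‖y‖⁻¹) ≤ ‖x‖ * ‖y‖ * (1 - ‖x‖⁻¹ * ‖y‖⁻¹) :=
    mul_le_mul_of_nonneg_right h1 (by linarith)
  have h4 : ‖x‖ * ‖y‖ * (1 - ‖x‖⁻¹ * ‖y‖⁻¹) = ‖x‖ * ‖y‖ - 1 := by field_simp
  simp only [conj_trivial]
  nlinarith [sq_nonneg (‖x‖ - ‖y‖)]

/-- The Lipschitz constant of the central projection of a spherical cap to a tangent plane. -/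
noncomputable def gnomonicConst (c : ℝ) : ℝ := 1 / c + Real.sqrt (2 - 2 * c) / c ^ 2

theorem gnomonic_lipschitz {e x y : E3} {c : ℝ} (hc : 0 < c) (he : ‖e‖ = 1) (hx : ‖x‖ = 1)
    (hy : ‖y‖ = 1) (hxc : c < inner ℝ x e) (hyc : c < inner ℝ y e) :
    ‖(inner ℝ x e)⁻¹ • x - (inner ℝ y e)⁻¹ • y‖ ≤ gnomonicConst c * ‖x - y‖ := by
  set a : ℝ := inner ℝ x e with ha
  set b : ℝ := inner ℝ y e with hb
  have ha0 : 0 < a := hc.trans hxc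
  have hb0 : 0 < b := hc.trans hyc
  have hdist : ∀ z : E3, ‖z‖ = 1 → c < inner ℝ z e → ‖e - z‖ ≤ Real.sqrt (2 - 2 * c) := by
    intro z hz hzc
    apply Real.le_sqrt_of_sq_le
    rw [norm_sub_sq_real, he, hz, real_inner_comm]
    linarith
  have h1 : |a - b| ≤ ‖x - y‖ * Real.sqrt (2 - 2 * c) := by
    -- For unit vectors x - y is orthogonal to x + y, so the midpoint may be subtracted from `e`;
    -- what remains is short, since both points are close to `e`.
    have e1 : a - b = inner ℝ (x - y) (e - (1 / 2 : ℝ) • (x + y)) := by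
      rw [inner_sub_right, inner_smul_right, inner_add_right, inner_sub_left, inner_sub_left,
        inner_sub_left, real_inner_self_eq_norm_sq, real_inner_self_eq_norm_sq, hx, hy,
        real_inner_comm x y]
      ring
    have e2 : e - (1 / 2 : ℝ) • (x + y) = (1 / 2 : ℝ) • (e - x) + (1 / 2 : ℝ) • (e - y) := by module
    rw [e1]
    refine (abs_real_inner_le_norm _ _).trans (mul_le_mul_of_nonneg_left ?_ (norm_nonneg _))
    rw [e2]
    refine (norm_add_le _ _).trans ?_
    rw [norm_smul, norm_smul]
    have := hdist x hx hxc
    have := hdist y hy hyc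
    norm_num
    linarith
  have e3 : a⁻¹ • x - b⁻¹ • y = a⁻¹ • (x - y) + ((b - a) * (a⁻¹ * b⁻¹)) • y := by
    have : (b - a) * (a⁻¹ * b⁻¹) = a⁻¹ - b⁻¹ := by field_simp
    rw [this]; module
  rw [e3]
  refine (norm_add_le _ _).trans ?_
  have ha1 : |a⁻¹| = a⁻¹ := abs_of_pos (by positivity)
  have hab1 : |a⁻¹ * b⁻¹| = a⁻¹ * b⁻¹ := abs_of_pos (by positivity)
  rw [norm_smul, norm_smul, hy, mul_one, Real.norm_eq_abs, Real.norm_eq_abs, abs_mul, abs_sub_comm b,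
    ha1, hab1, gnomonicConst, add_mul]
  have h2 : a⁻¹ ≤ 1 / c := by rw [inv_eq_one_div]; exact one_div_le_one_div_of_le hc hxc.le
  have h3 : b⁻¹ ≤ 1 / c := by rw [inv_eq_one_div]; exact one_div_le_one_div_of_le hc hyc.le
  refine add_le_add (mul_le_mul_of_nonneg_right h2 (norm_nonneg _)) ?_
  calc |a - b| * (a⁻¹ * b⁻¹) ≤ (‖x - y‖ * Real.sqrt (2 - 2 * c)) * (1 / c * (1 / c)) :=
        mul_le_mul h1 (mul_le_mul h2 h3 (by positivity) (by positivity)) (by positivity)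
          (by positivity)
    _ = _ := by field_simp

/-- The solid cone, of height at most one, over a set of directions. -/
def solidCone (S : Set E3) : Set E3 := {y | (0 < ‖y‖ ∧ ‖y‖ ≤ 1) ∧ ‖y‖⁻¹ • y ∈ S}

theorem measurable_normalize : Measurable fun y : E3 => ‖y‖⁻¹ • y := by fun_prop

theorem measurableSet_solidCone {S : Set E3} (hS : MeasurableSet S) :
    MeasurableSet (solidCone S) := by
  exact ((measurableSet_lt measurable_const measurable_norm).inter
    (measurableSet_le measurable_norm measurable_const)).inter (measurable_normalize hS)

theorem inner_normalize (y z : E3) : inner ℝ (‖y‖⁻¹ • y) z = inner ℝ y z / ‖y‖ := by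
  rw [inner_smul_left, conj_trivial]; ring

theorem normalize_smul {r : ℝ} (hr : 0 < r) (y : E3) : ‖r • y‖⁻¹ • (r • y) = ‖y‖⁻¹ • y := by
  rw [norm_smul, Real.norm_of_nonneg hr.le, smul_smul, mul_inv, mul_right_comm,
    inv_mul_cancel₀ hr.ne', one_mul]

/-- The truncated cone of height one over a planar set has a third of its area as volume. -/
theorem volume_flatCone (B : OrthonormalBasis (Fin 3) ℝ E3) {S : Set E3} (hS : MeasurableSet S) :
    volume {y : E3 | (0 < inner ℝ y (B 0) ∧ inner ℝ y (B 0) ≤ 1) ∧ ‖y‖⁻¹ • y ∈ S} =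
      ENNReal.ofReal (1 / 3) * volume {w : ℝ × ℝ | ‖ofCoords B (1, w)‖⁻¹ • ofCoords B (1, w) ∈ S} := by
  set T := {w : ℝ × ℝ | ‖ofCoords B (1, w)‖⁻¹ • ofCoords B (1, w) ∈ S}
  have h0 : MeasurableSet {y : E3 | 0 < inner ℝ y (B 0) ∧ inner ℝ y (B 0) ≤ 1} := by measurability
  have hm : MeasurableSet
      {y : E3 | (0 < inner ℝ y (B 0) ∧ inner ℝ y (B 0) ≤ 1) ∧ ‖y‖⁻¹ • y ∈ S} :=
    h0.inter (measurable_normalize hS)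
  rw [volume_eq_coords B hm]
  have h1 : ∀ s : ℝ, volume {w : ℝ × ℝ | ofCoords B (s, w) ∈
      {y : E3 | (0 < inner ℝ y (B 0) ∧ inner ℝ y (B 0) ≤ 1) ∧ ‖y‖⁻¹ • y ∈ S}} =
      (Set.Ioc 0 1).indicator (fun s => ENNReal.ofReal (s ^ 2) * volume T) s := by
    intro s
    by_cases hs : s ∈ Set.Ioc (0 : ℝ) 1
    · rw [Set.indicator_of_mem hs]
      have := Measure.addHaar_smul (volume : Measure (ℝ × ℝ)) s T
      rw [Module.finrank_prod, Module.finrank_self, abs_of_pos (by have := hs.1; positivity)] at this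
      rw [← this]
      congr 1
      ext w
      rw [Set.mem_smul_set_iff_inv_smul_mem₀ hs.1.ne']
      simp only [Set.mem_ofPred_eq, inner_ofCoords_zero, T]
      have e : ofCoords B (s, w) = s • ofCoords B (1, s⁻¹ • w) := by
        have := hs.1.ne'
        simp only [ofCoords, smul_add, smul_smul, Prod.smul_fst, Prod.smul_snd, smul_eq_mul,
          mul_inv_cancel_left₀ this, mul_one]
      rw [e, normalize_smul hs.1]
      exact ⟨fun h => h.2, fun h => ⟨hs, h⟩⟩
    · rw [Set.indicator_of_notMem hs]
      convert measure_empty (μ := (volume : Measure (ℝ × ℝ)))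
      ext w
      simp only [Set.mem_ofPred_eq, Set.mem_empty_iff_false, iff_false, inner_ofCoords_zero]
      exact fun h => hs h.1
  simp_rw [h1]
  rw [lintegral_indicator measurableSet_Ioc, lintegral_mul_const _ (by fun_prop),
    Measure.restrict_congr_set Ioc_ae_eq_Icc,
    lintegral_Icc_ofReal_eq_sub (F := fun s => s ^ 3 / 3) zero_le_one (by fun_prop)
      (fun _ _ => by positivity) (by fun_prop)]
  · norm_num
  · intro s _
    refine ((hasDerivAt_pow 3 s).div_const 3).congr_deriv ?_
    norm_num

theorem isometry_tangentPlane (B : OrthonormalBasis (Fin 3) ℝ E3) :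
    Isometry fun w : EuclideanSpace ℝ (Fin 2) => ofCoords B (1, w 0, w 1) := by
  refine Isometry.of_dist_eq fun v w => ?_
  rw [dist_eq_norm, EuclideanSpace.dist_eq, Fin.sum_univ_two]
  have : ofCoords B (1, v 0, v 1) - ofCoords B (1, w 0, w 1) =
      ofCoords B (0, v 0 - w 0, v 1 - w 1) := by
    simp only [ofCoords]; module
  rw [this, ← Real.sqrt_sq (norm_nonneg _), norm_sq_ofCoords]
  simp [Real.dist_eq, sq_abs]

theorem volume_preimage_plane {T : Set (ℝ × ℝ)} (hT : MeasurableSet T) :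
    volume {w : EuclideanSpace ℝ (Fin 2) | (w 0, w 1) ∈ T} = volume T := by
  have h1 := measurePreserving_finTwoArrow (volume : Measure ℝ)
  have h4 := (EuclideanSpace.volume_preserving_symm_measurableEquiv_toLp (Fin 2))
  exact (h1.comp h4).measure_preimage hT.nullMeasurableSet

/-- `S` is compared with its central projection to the tangent plane at `e`. Projecting back to the
sphere is 1-Lipschitz, and projecting out has constant `gnomonicConst c`. The flat cone `C` over the
projection has a third of the planar area as volume and satisfies c • C ⊆ solidCone S ⊆ C. Both
comparison factors tend to 1 as c → 1. -/
theorem cap_estimate {e : E3} (he : ‖e‖ = 1) {c : ℝ} (hc : 0 < c) (hc1 : c < 1) {S : Set E3}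
    (hS : MeasurableSet S) (hS1 : ∀ x ∈ S, ‖x‖ = 1) (hSc : ∀ x ∈ S, c < inner ℝ x e) :
    (Measure.euclideanHausdorffMeasure 2 : Measure E3) S ≤
      ENNReal.ofReal (c ^ 3)⁻¹ * (3 * volume (solidCone S)) ∧
    3 * volume (solidCone S) ≤ ENNReal.ofReal (gnomonicConst c ^ 2) *
      (Measure.euclideanHausdorffMeasure 2 : Measure E3) S := by
  obtain ⟨B, hB⟩ : ∃ B : OrthonormalBasis (Fin 3) ℝ E3, B 0 = e := by
    have : Orthonormal ℝ (({0} : Set (Fin 3)).domRestrict fun _ => e) := by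
      constructor
      · intro i; exact he
      · rintro ⟨i, rfl⟩ ⟨j, rfl⟩ hij
        exact absurd rfl hij
    obtain ⟨B, hB⟩ := this.exists_orthonormalBasis_extension_of_card_eq (by simp)
    exact ⟨B, hB 0 rfl⟩
  subst hB
  set T := {w : ℝ × ℝ | ‖ofCoords B (1, w)‖⁻¹ • ofCoords B (1, w) ∈ S} with hTdef
  have hTm : MeasurableSet T := by
    have : Measurable fun w : ℝ × ℝ => ‖ofCoords B (1, w)‖⁻¹ • ofCoords B (1, w) :=
      measurable_normalize.comp ((measurePreserving_ofCoords B).measurable.comp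
        measurable_prodMk_left)
    exact this hS
  set φ := fun w : EuclideanSpace ℝ (Fin 2) => ofCoords B (1, w 0, w 1)
  set T' := {w : EuclideanSpace ℝ (Fin 2) | (w 0, w 1) ∈ T}
  have hTT' : (Measure.euclideanHausdorffMeasure 2 : Measure (EuclideanSpace ℝ (Fin 2))) T' =
      volume T := by
    rw [EuclideanSpace.euclideanHausdorffMeasure_eq_volume, volume_preimage_plane hTm]
  have hφT : (Measure.euclideanHausdorffMeasure 2 : Measure E3) (φ '' T') = volume T := by
    rw [(isometry_tangentPlane B).euclideanHausdorffMeasure_image, hTT']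
  have hφ0 : ∀ w, inner ℝ (φ w) (B 0) = 1 := fun w => inner_ofCoords_zero B _
  have hφ1 : ∀ w, 1 ≤ ‖φ w‖ := by
    intro w
    have := real_inner_le_norm (φ w) (B 0)
    rwa [hφ0, he, mul_one] at this
  have hφx : ∀ x ∈ S, ∃ w ∈ T', φ w = (inner ℝ x (B 0))⁻¹ • x := by
    intro x hx
    have hx0 : 0 < inner ℝ x (B 0) := hc.trans (hSc x hx)
    set z := (inner ℝ x (B 0))⁻¹ • x with hz
    have hz0 : inner ℝ z (B 0) = 1 := by
      rw [hz, inner_smul_left, conj_trivial, inv_mul_cancel₀ hx0.ne']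
    have e1 : ofCoords B (1, inner ℝ z (B 1), inner ℝ z (B 2)) = z := by
      rw [← hz0]; exact ofCoords_inner B z
    refine ⟨!₂[inner ℝ z (B 1), inner ℝ z (B 2)], ?_, e1⟩
    change ‖ofCoords B (1, inner ℝ z (B 1), inner ℝ z (B 2))‖⁻¹ •
      ofCoords B (1, inner ℝ z (B 1), inner ℝ z (B 2)) ∈ S
    rw [e1, hz, normalize_smul (inv_pos.2 hx0), hS1 x hx, inv_one, one_smul]
    exact hx
  have hST : S = (fun y : E3 => ‖y‖⁻¹ • y) '' (φ '' T') := by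
    ext x
    constructor
    · intro hx
      obtain ⟨w, hw, hwx⟩ := hφx x hx
      refine ⟨φ w, ⟨w, hw, rfl⟩, ?_⟩
      simp only []
      rw [hwx, normalize_smul (inv_pos.2 (hc.trans (hSc x hx))), hS1 x hx, inv_one, one_smul]
    · rintro ⟨_, ⟨w, hw, rfl⟩, rfl⟩
      exact hw
  have hgS : φ '' T' = (fun x : E3 => (inner ℝ x (B 0))⁻¹ • x) '' S := by
    ext z
    constructor
    · rintro ⟨w, hw, rfl⟩
      refine ⟨_, hw, ?_⟩
      change (inner ℝ (‖φ w‖⁻¹ • φ w) (B 0))⁻¹ • (‖φ w‖⁻¹ • φ w) = φ w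
      have := hφ1 w
      rw [inner_normalize, hφ0, smul_smul, one_div, inv_inv, mul_inv_cancel₀ (by linarith),
        one_smul]
    · rintro ⟨x, hx, rfl⟩
      obtain ⟨w, hw, hwx⟩ := hφx x hx
      exact ⟨w, hw, hwx⟩
  have up1 : (Measure.euclideanHausdorffMeasure 2 : Measure E3) S ≤ volume T := by
    rw [hST]
    refine (euclideanHausdorffMeasure_image_le (K := 1) ?_ 2).trans ?_
    · refine LipschitzOnWith.of_dist_le_mul ?_
      rintro _ ⟨v, -, rfl⟩ _ ⟨w, -, rfl⟩
      rw [dist_eq_norm, dist_eq_norm, NNReal.coe_one, one_mul]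
      exact norm_normalize_sub_le (hφ1 v) (hφ1 w)
    · rw [hφT]; simp
  have hK : 0 ≤ gnomonicConst c := by unfold gnomonicConst; positivity
  have up2 : volume T ≤ ENNReal.ofReal (gnomonicConst c ^ 2) *
      (Measure.euclideanHausdorffMeasure 2 : Measure E3) S := by
    rw [← hφT, hgS, ENNReal.ofReal_pow hK]
    refine euclideanHausdorffMeasure_image_le (K := Real.toNNReal (gnomonicConst c)) ?_ 2
    refine LipschitzOnWith.of_dist_le_mul ?_
    intro x hx y hy
    rw [dist_eq_norm, dist_eq_norm, Real.coe_toNNReal _ hK]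
    exact gnomonic_lipschitz hc he (hS1 x hx) (hS1 y hy) (hSc x hx) (hSc y hy)
  set C := {y : E3 | (0 < inner ℝ y (B 0) ∧ inner ℝ y (B 0) ≤ 1) ∧ ‖y‖⁻¹ • y ∈ S} with hC
  have hCv : 3 * volume C = volume T := by
    rw [hC, volume_flatCone B hS, ← mul_assoc]
    have : (3 : ℝ≥0∞) * ENNReal.ofReal (1 / 3) = 1 := by
      rw [show (3 : ℝ≥0∞) = ENNReal.ofReal 3 by simp, ← ENNReal.ofReal_mul (by norm_num)]
      norm_num
    rw [this, one_mul]
  have lo1 : solidCone S ⊆ C := by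
    rintro y ⟨⟨h1, h2⟩, h3⟩
    have h4 := hSc _ h3
    rw [inner_normalize, lt_div_iff₀ h1] at h4
    have h5 := real_inner_le_norm y (B 0)
    rw [he, mul_one] at h5
    exact ⟨⟨lt_trans (by positivity) h4, h5.trans h2⟩, h3⟩
  have lo2 : c • C ⊆ solidCone S := by
    rintro _ ⟨y, ⟨⟨h1, h2⟩, h3⟩, rfl⟩
    have h5 := real_inner_le_norm y (B 0)
    rw [he, mul_one] at h5
    have h0 : 0 < ‖y‖ := h1.trans_le h5
    have h4 := hSc _ h3
    rw [inner_normalize, lt_div_iff₀ h0] at h4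
    refine ⟨?_, ?_⟩
    · simp only [norm_smul, Real.norm_of_nonneg hc.le]
      exact ⟨by positivity, by linarith⟩
    · simp only []
      rw [normalize_smul hc]; exact h3
  constructor
  · refine up1.trans ?_
    rw [← hCv, mul_left_comm]
    gcongr
    have := measure_mono (μ := (volume : Measure E3)) lo2
    rw [Measure.addHaar_smul, finrank_euclideanSpace_fin, abs_of_pos (by positivity)] at this
    rw [ENNReal.ofReal_inv_of_pos (by positivity), mul_comm, ← div_eq_mul_inv,
      ENNReal.le_div_iff_mul_le (.inl (by simp; positivity)) (.inl (by simp)), mul_comm]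
    exact this
  · refine le_trans ?_ up2
    rw [← hCv]
    gcongr

theorem exists_seq_dense_sphere : ∃ u : ℕ → E3, (∀ n, ‖u n‖ = 1) ∧
    ∀ x : E3, ‖x‖ = 1 → ∀ c < 1, ∃ n, c < inner ℝ x (u n) := by
  have : Nonempty (Metric.sphere (0 : E3) 1) := (NormedSpace.sphere_nonempty.2 zero_le_one).to_subtype
  refine ⟨fun n => TopologicalSpace.denseSeq (Metric.sphere (0 : E3) 1) n, fun n => ?_, ?_⟩
  · exact mem_sphere_zero_iff_norm.1 (TopologicalSpace.denseSeq (Metric.sphere (0 : E3) 1) n).2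
  · intro x hx c hc
    have hopen : IsOpen {y : Metric.sphere (0 : E3) 1 | c < inner ℝ x (y : E3)} :=
      isOpen_lt continuous_const (by fun_prop)
    have hne : {y : Metric.sphere (0 : E3) 1 | c < inner ℝ x (y : E3)}.Nonempty :=
      ⟨⟨x, mem_sphere_zero_iff_norm.2 hx⟩, by
        simp only [Set.mem_ofPred_eq]
        rw [real_inner_self_eq_norm_sq, hx]; linarith⟩
    obtain ⟨n, hn⟩ :=
      (TopologicalSpace.denseRange_denseSeq (Metric.sphere (0 : E3) 1)).exists_mem_open hopen hne
    exact ⟨n, hn⟩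

theorem solidCone_iUnion (S : ℕ → Set E3) : solidCone (⋃ n, S n) = ⋃ n, solidCone (S n) := by
  ext y
  simp [solidCone]

theorem disjoint_solidCone {S T : Set E3} (h : Disjoint S T) :
    Disjoint (solidCone S) (solidCone T) := by
  rw [Set.disjoint_left] at *
  exact fun y h1 h2 => h h1.2 h2.2

/-- The Hausdorff area of a subset of the unit sphere is three times the volume of its cone. -/
theorem euclideanHausdorffMeasure_eq_solidCone {S : Set E3} (hS : MeasurableSet S)
    (hS1 : ∀ x ∈ S, ‖x‖ = 1) :
    (Measure.euclideanHausdorffMeasure 2 : Measure E3) S = 3 * volume (solidCone S) := by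
  have key : ∀ c : ℝ, 0 < c → c < 1 →
      (Measure.euclideanHausdorffMeasure 2 : Measure E3) S ≤
        ENNReal.ofReal (c ^ 3)⁻¹ * (3 * volume (solidCone S)) ∧
      3 * volume (solidCone S) ≤ ENNReal.ofReal (gnomonicConst c ^ 2) *
        (Measure.euclideanHausdorffMeasure 2 : Measure E3) S := by
    intro c hc hc1
    obtain ⟨u, hu, hdense⟩ := exists_seq_dense_sphere
    -- Countably many caps around a dense sequence of directions cover the sphere; made disjoint,
    -- they let the cap estimate be summed piece by piece.
    set D : ℕ → Set E3 := disjointed fun n => {x : E3 | c < inner ℝ x (u n)} with hD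
    have hDm : ∀ n, MeasurableSet (S ∩ D n) := fun n =>
      hS.inter (MeasurableSet.disjointed (fun n => by measurability) n)
    have hDd : Pairwise (Function.onFun Disjoint fun n => S ∩ D n) := fun m n hmn =>
      ((disjoint_disjointed _) hmn).mono Set.inter_subset_right Set.inter_subset_right
    have hU : S = ⋃ n, S ∩ D n := by
      rw [← Set.inter_iUnion, hD, iUnion_disjointed]
      refine (Set.inter_eq_left.2 fun x hx => ?_).symm
      obtain ⟨n, hn⟩ := hdense x (hS1 x hx) c hc1
      exact Set.mem_iUnion.2 ⟨n, hn⟩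
    have e1 : (Measure.euclideanHausdorffMeasure 2 : Measure E3) S =
        ∑' n, (Measure.euclideanHausdorffMeasure 2 : Measure E3) (S ∩ D n) := by
      conv_lhs => rw [hU]
      exact measure_iUnion hDd hDm
    have e2 : 3 * volume (solidCone S) = ∑' n, 3 * volume (solidCone (S ∩ D n)) := by
      conv_lhs => rw [hU, solidCone_iUnion]
      rw [measure_iUnion (fun m n hmn => disjoint_solidCone (hDd hmn))
        fun n => measurableSet_solidCone (hDm n), ENNReal.tsum_mul_left]
    have e3 := fun n => cap_estimate (hu n) hc hc1 (hDm n) (fun x hx => hS1 x hx.1)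
      fun x hx => disjointed_subset _ n hx.2
    rw [e1, e2, ← ENNReal.tsum_mul_left, ← ENNReal.tsum_mul_left]
    exact ⟨ENNReal.tsum_le_tsum fun n => (e3 n).1, ENNReal.tsum_le_tsum fun n => (e3 n).2⟩
  -- Letting the caps shrink, c → 1 from below, turns the two estimates into equality.
  have hev : ∀ᶠ c : ℝ in 𝓝[<] 1, 0 < c ∧ c < 1 := by
    filter_upwards [Ioo_mem_nhdsLT (show (0 : ℝ) < 1 by norm_num)] with c hc using hc
  apply le_antisymm
  · have ht : Filter.Tendsto (fun c : ℝ => ENNReal.ofReal (c ^ 3)⁻¹ * (3 * volume (solidCone S)))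
        (𝓝[<] 1) (𝓝 (ENNReal.ofReal ((1 : ℝ) ^ 3)⁻¹ * (3 * volume (solidCone S)))) := by
      refine ENNReal.Tendsto.mul_const (ENNReal.tendsto_ofReal ?_) (.inl (by simp))
      refine tendsto_nhdsWithin_of_tendsto_nhds (ContinuousAt.tendsto ?_)
      fun_prop (disch := norm_num)
    simpa using ge_of_tendsto ht (hev.mono fun c hc => (key c hc.1 hc.2).1)
  · have ht : Filter.Tendsto (fun c : ℝ => ENNReal.ofReal (gnomonicConst c ^ 2) *
        (Measure.euclideanHausdorffMeasure 2 : Measure E3) S) (𝓝[<] 1)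
        (𝓝 (ENNReal.ofReal (gnomonicConst 1 ^ 2) *
        (Measure.euclideanHausdorffMeasure 2 : Measure E3) S)) := by
      refine ENNReal.Tendsto.mul_const (ENNReal.tendsto_ofReal ?_) (.inl (by simp [gnomonicConst]))
      refine tendsto_nhdsWithin_of_tendsto_nhds (ContinuousAt.tendsto ?_)
      unfold gnomonicConst
      fun_prop (disch := norm_num)
    simpa [gnomonicConst] using ge_of_tendsto ht (hev.mono fun c hc => (key c hc.1 hc.2).2)

/-! ### Edges, dihedral angles, faces and surface area -/

theorem ofCoords_sub (B : OrthonormalBasis (Fin 3) ℝ E3) (q q' : ℝ × ℝ × ℝ) :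
    ofCoords B q - ofCoords B q' = ofCoords B (q - q') := by
  simp only [ofCoords, Prod.fst_sub, Prod.snd_sub]; module

/-- The orthonormal frame adapted to the edge on which the spheres about `p i` and `p j` meet. -/
theorem exists_edge_frame {p : Fin 3 → E3} (hp : ∀ i j : Fin 3, i ≠ j → dist (p i) (p j) = 1)
    {i j k : Fin 3} (hij : i ≠ j) (hik : i ≠ k) (hjk : j ≠ k) :
    ∃ B : OrthonormalBasis (Fin 3) ℝ E3,
      p i = midpoint ℝ (p i) (p j) + ofCoords B (-(1 / 2), 0, 0) ∧
      p j = midpoint ℝ (p i) (p j) + ofCoords B (1 / 2, 0, 0) ∧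
      p k = midpoint ℝ (p i) (p j) + ofCoords B (0, Real.sqrt 3 / 2, 0) := by
  obtain ⟨B, hB0, hB1⟩ := exists_adapted_basis (norm_sub_of_dist hp hij) (norm_sub_of_dist hp hik)
    (inner_sub_of_dist hp hij hik hjk)
  have hm : midpoint ℝ (p i) (p j) = (1 / 2 : ℝ) • p i + (1 / 2 : ℝ) • p j := by
    rw [midpoint_eq_smul_add]; simp
  refine ⟨B, ?_, ?_, ?_⟩
  · simp only [ofCoords, hm, hB0]; module
  · simp only [ofCoords, hm, hB0]; module
  · have : p k = p i + (p k - p i) := by abel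
    rw [this, hB1]
    simp only [ofCoords, hm]; module

theorem norm_sq_frame (B : OrthonormalBasis (Fin 3) ℝ E3) (m : E3) (s a b s' a' b' : ℝ) :
    ‖m + ofCoords B (s, a, b) - (m + ofCoords B (s', a', b'))‖ ^ 2 =
      (s - s') ^ 2 + (a - a') ^ 2 + (b - b') ^ 2 := by
  rw [add_sub_add_left_eq_sub, ofCoords_sub, norm_sq_ofCoords]
  rfl

theorem exists_frame_coords (B : OrthonormalBasis (Fin 3) ℝ E3) (m x : E3) :
    ∃ s a b : ℝ, x = m + ofCoords B (s, a, b) :=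
  ⟨_, _, _, by rw [ofCoords_inner B (x - m)]; abel⟩

theorem exists_angle_of_cos_ge {a b r c : ℝ} (hr : 0 < r) (hab : a ^ 2 + b ^ 2 = r ^ 2)
    (ha : c * r ≤ a) :
    ∃ t, |t| ≤ Real.arccos c ∧ a = r * Real.cos t ∧ b = r * Real.sin t := by
  have hle : |a| ≤ r := abs_le_of_sq_le_sq (by nlinarith [sq_nonneg b]) hr.le
  obtain ⟨h1, h2⟩ := abs_le.1 hle
  have h1' : -1 ≤ a / r := by rw [le_div_iff₀ hr]; linarith
  have h2' : a / r ≤ 1 := by rw [div_le_iff₀ hr]; linarith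
  have hcos : a = r * Real.cos (Real.arccos (a / r)) := by
    rw [Real.cos_arccos h1' h2']; field_simp
  have hsin : |b| = r * Real.sin (Real.arccos (a / r)) := by
    rw [Real.sin_arccos, ← Real.sqrt_sq_eq_abs, show 1 - (a / r) ^ 2 = b ^ 2 / r ^ 2 by
      field_simp; linarith, Real.sqrt_div (sq_nonneg b), Real.sqrt_sq hr.le]
    field_simp
  have hle' : Real.arccos (a / r) ≤ Real.arccos c :=
    Real.antitone_arccos (by rw [le_div_iff₀ hr]; exact ha)
  rcases le_total 0 b with hb | hb
  · rw [abs_of_nonneg hb] at hsin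
    exact ⟨_, by rwa [abs_of_nonneg (Real.arccos_nonneg _)], hcos, hsin⟩
  · rw [abs_of_nonpos hb] at hsin
    refine ⟨-Real.arccos (a / r), by rwa [abs_neg, abs_of_nonneg (Real.arccos_nonneg _)], ?_, ?_⟩
    · rw [Real.cos_neg]; exact hcos
    · rw [Real.sin_neg]; linarith

theorem cos_arcsec_three : Real.cos (arcsec 3) = 1 / 3 :=
  Real.cos_arccos (by norm_num) (by norm_num)

theorem third_le_cos_iff {t : ℝ} (ht : |t| ≤ Real.pi) : 1 / 3 ≤ Real.cos t ↔ |t| ≤ arcsec 3 := by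
  rw [← cos_arcsec_three, ← Real.cos_abs t]
  exact Real.strictAntiOn_cos.le_iff_ge ⟨Real.arccos_nonneg _, Real.arccos_le_pi _⟩
    ⟨abs_nonneg _, ht⟩

theorem arcsec_three_pos : 0 < arcsec 3 := lt_of_lt_of_le (by norm_num) arcsec_three_bounds.1

theorem arcsec_three_lt_pi : arcsec 3 < Real.pi :=
  arcsec_three_bounds.2.trans_lt (by linarith [Real.pi_gt_three])

theorem exists_third {i j : Fin 3} (hij : i ≠ j) : ∃ k : Fin 3, i ≠ k ∧ j ≠ k ∧
    ∀ l, l = i ∨ l = j ∨ l = k := by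
  revert i j; decide

theorem mem_edge {p : Fin 3 → E3} {i j : Fin 3} {x : E3} :
    x ∈ edge p i j ↔ (∀ l, ‖x - p l‖ ≤ 1) ∧ ‖x - p i‖ = 1 ∧ ‖x - p j‖ = 1 := by
  simp only [edge, face, Set.mem_inter_iff, mem_trihedron, mem_sphere_iff_norm]
  tauto

theorem isCircularArc_edge {p : Fin 3 → E3} (hp : ∀ i j : Fin 3, i ≠ j → dist (p i) (p j) = 1)
    {i j : Fin 3} (hij : i ≠ j) :
    IsCircularArc (edge p i j) (midpoint ℝ (p i) (p j)) (Real.sqrt 3 / 2) (2 * arcsec 3) := by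
  obtain ⟨k, hik, hjk, hall⟩ := exists_third hij
  obtain ⟨B, hi, hj, hk⟩ := exists_edge_frame hp hij hik hjk
  set m := midpoint ℝ (p i) (p j)
  have h3 : Real.sqrt 3 ^ 2 = 3 := Real.sq_sqrt (by norm_num)
  have h3p : 0 < Real.sqrt 3 := by positivity
  refine ⟨by positivity, by linarith [arcsec_three_pos], by linarith [arcsec_three_lt_pi],
    B 1, B 2, B.orthonormal.1 1, B.orthonormal.1 2, B.orthonormal.2 (by decide), ?_⟩
  rw [mul_div_cancel_left₀ _ (two_ne_zero)]
  have hparam : ∀ t : ℝ, m + (Real.sqrt 3 / 2 * Real.cos t) • B 1 +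
      (Real.sqrt 3 / 2 * Real.sin t) • B 2 =
      m + ofCoords B (0, Real.sqrt 3 / 2 * Real.cos t, Real.sqrt 3 / 2 * Real.sin t) := by
    intro t; simp only [ofCoords]; module
  have hsq : ∀ z : E3, ‖z‖ = 1 ↔ ‖z‖ ^ 2 = 1 := fun z =>
    (pow_eq_one_iff_of_nonneg (norm_nonneg z) two_ne_zero).symm
  ext x
  rw [mem_edge]
  constructor
  · rintro ⟨hle, h1, h2⟩
    obtain ⟨s, a, b, hx⟩ := exists_frame_coords B m x
    have h4 := hle k
    rw [hi, hx, hsq, norm_sq_frame] at h1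
    rw [hj, hx, hsq, norm_sq_frame] at h2
    rw [hk, hx, ← sq_le_one_iff₀ (norm_nonneg _), norm_sq_frame] at h4
    have hs : s = 0 := by linarith
    subst hs
    -- On the circle the squared distance to the third centre is 3/2 - (3/2) cos t, so the third
    -- ball imposes exactly cos t ≥ 1/3.
    obtain ⟨t, ht, hta, htb⟩ := exists_angle_of_cos_ge (a := a) (b := b) (c := 1 / 3)
      (r := Real.sqrt 3 / 2) (by positivity) (by rw [div_pow, h3]; linarith) (by nlinarith)
    refine ⟨t, abs_le.1 ht, ?_⟩
    simp only []
    rw [hx, hparam, ← hta, ← htb]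
  · rintro ⟨t, ht, rfl⟩
    have ht' : |t| ≤ arcsec 3 := abs_le.2 ht
    have hcos := (third_le_cos_iff (ht'.trans arcsec_three_lt_pi.le)).2 ht'
    have hcs := Real.sin_sq_add_cos_sq t
    simp only []
    rw [hparam]
    have h1 : ‖m + ofCoords B (0, Real.sqrt 3 / 2 * Real.cos t, Real.sqrt 3 / 2 * Real.sin t)
        - p i‖ = 1 := by
      rw [hi, hsq, norm_sq_frame]; ring_nf; rw [h3]; linarith
    have h2 : ‖m + ofCoords B (0, Real.sqrt 3 / 2 * Real.cos t, Real.sqrt 3 / 2 * Real.sin t)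
        - p j‖ = 1 := by
      rw [hj, hsq, norm_sq_frame]; ring_nf; rw [h3]; linarith
    refine ⟨fun l => ?_, h1, h2⟩
    rcases hall l with rfl | rfl | rfl
    · exact h1.le
    · exact h2.le
    · rw [hk, ← sq_le_one_iff₀ (norm_nonneg _), norm_sq_frame]
      ring_nf; rw [h3]; linarith

/-- The point and the two centres are the vertices of an equilateral triangle of side 1. -/
theorem dihedralAngle_edge {p : Fin 3 → E3} (hp : ∀ i j : Fin 3, i ≠ j → dist (p i) (p j) = 1)
    {i j : Fin 3} (hij : i ≠ j) {x : E3} (hx : x ∈ edge p i j) :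
    dihedralAngle (p i) (p j) x = Real.pi / 3 := by
  obtain ⟨-, h1, h2⟩ := mem_edge.1 hx
  rw [dihedralAngle, InnerProductGeometry.angle, h1, h2, inner_eq_half h1 h2, ← Real.arccos_cos
    (x := Real.pi / 3) (by positivity) (by linarith [Real.pi_pos]), Real.cos_pi_div_three]
  · norm_num
  · rw [sub_sub_sub_cancel_left]; exact norm_sub_of_dist hp hij

/-- A C¹ curve has Hausdorff dimension at most 1. This makes the overlaps of faces negligible. -/
theorem hausdorff_circularArc {S : Set E3} {c : E3} {r θ : ℝ} (h : IsCircularArc S c r θ) :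
    (Measure.euclideanHausdorffMeasure 2 : Measure E3) S = 0 := by
  obtain ⟨-, -, -, e, f, -, -, -, rfl⟩ := h
  have hd : ContDiff ℝ 1 (fun t : ℝ => c + (r * Real.cos t) • e + (r * Real.sin t) • f) := by
    fun_prop
  have h1 := hd.dimH_range_le
  have h2 : Measure.hausdorffMeasure 2
      (Set.range (fun t : ℝ => c + (r * Real.cos t) • e + (r * Real.sin t) • f)) = 0 := by
    have := hausdorffMeasure_of_dimH_lt (d := 2) (h1.trans_lt (by simp))
    simpa using this
  refine measure_mono_null (Set.image_subset_range _ _) ?_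
  rw [Measure.euclideanHausdorffMeasure_def, Measure.smul_apply]
  simp [h2]

theorem frontier_trihedron (p : Fin 3 → E3) : frontier (trihedron p) = ⋃ i, face p i := by
  have hcl : IsClosed (trihedron p) := isClosed_iInter fun _ => Metric.isClosed_closedBall
  have hint : interior (trihedron p) = ⋂ i, Metric.ball (p i) 1 := by
    rw [trihedron, interior_iInter_of_finite]
    simp_rw [interior_closedBall _ (one_ne_zero)]
  rw [hcl.frontier_eq, hint]
  ext x
  simp only [Set.mem_sdiff, Set.mem_iInter, mem_ball_iff_norm, not_forall, not_lt, Set.mem_iUnion,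
    face, Set.mem_inter_iff, mem_sphere_iff_norm]
  constructor
  · rintro ⟨h1, i, hi⟩
    exact ⟨i, h1, le_antisymm (mem_trihedron.1 h1 i) hi⟩
  · rintro ⟨i, h1, h2⟩
    exact ⟨h1, i, h2.ge⟩

/-- Seen from `p i`, each of the other two balls cuts out a cap ⟨u, p j - p i⟩ ≥ 1/2 of the unit
sphere; the face is the lens common to both caps. -/
theorem hausdorff_face {p : Fin 3 → E3} (hp : ∀ i j : Fin 3, i ≠ j → dist (p i) (p j) = 1)
    (i : Fin 3) : (Measure.euclideanHausdorffMeasure 2 : Measure E3) (face p i) =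
      ENNReal.ofReal (2 * (Real.pi - 2 * arcsec 3)) := by
  obtain ⟨j, k, hij, hik, hjk, hall⟩ : ∃ j k : Fin 3, i ≠ j ∧ i ≠ k ∧ j ≠ k ∧
      ∀ l, l = i ∨ l = j ∨ l = k := by revert i; decide
  set S : Set E3 := {u | ‖u‖ = 1 ∧ 1 / 2 ≤ inner ℝ u (p j - p i) ∧ 1 / 2 ≤ inner ℝ u (p k - p i)}
    with hS
  have hm : MeasurableSet S := by measurability
  have hface : face p i = (fun u => p i + u) '' S := by
    ext x
    simp only [face, Set.mem_inter_iff, mem_sphere_iff_norm, mem_trihedron, Set.mem_image, hS,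
      Set.mem_ofPred_eq]
    constructor
    · rintro ⟨h1, h2⟩
      refine ⟨x - p i, ⟨h2, ?_, ?_⟩, by abel⟩
      · have := (norm_sub_le_iff_inner_ge (norm_sub_of_dist hp hij) zero_le_one).1 (h1 j)
        rw [h2] at this; linarith
      · have := (norm_sub_le_iff_inner_ge (norm_sub_of_dist hp hik) zero_le_one).1 (h1 k)
        rw [h2] at this; linarith
    · rintro ⟨u, ⟨h1, h2, h3⟩, rfl⟩
      rw [add_sub_cancel_left]
      refine ⟨fun l => ?_, h1⟩
      rcases hall l with rfl | rfl | rfl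
      · rw [add_sub_cancel_left, h1]
      · rw [norm_sub_le_iff_inner_ge (norm_sub_of_dist hp hij) zero_le_one, add_sub_cancel_left, h1]
        linarith
      · rw [norm_sub_le_iff_inner_ge (norm_sub_of_dist hp hik) zero_le_one, add_sub_cancel_left, h1]
        linarith
  have hcone : solidCone S = {y : E3 | (0 < ‖y‖ ∧ ‖y‖ ≤ 1) ∧ ‖y‖ / 2 ≤ inner ℝ y (p j - p i) ∧
      ‖y‖ / 2 ≤ inner ℝ y (p k - p i)} := by
    ext y
    simp only [solidCone, hS, Set.mem_ofPred_eq, inner_normalize]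
    refine and_congr_right fun h => ?_
    rw [le_div_iff₀ h.1, le_div_iff₀ h.1, norm_smul, norm_inv, norm_norm, inv_mul_cancel₀ h.1.ne']
    constructor
    · rintro ⟨-, h1, h2⟩; constructor <;> linarith
    · rintro ⟨h1, h2⟩; exact ⟨rfl, by linarith, by linarith⟩
  have hiso : Isometry fun u => p i + u := isometry_add_left (p i)
  rw [hface, hiso.euclideanHausdorffMeasure_image,
    euclideanHausdorffMeasure_eq_solidCone hm fun x hx => hx.1, hcone,
    volume_lensCone (norm_sub_of_dist hp hij) (norm_sub_of_dist hp hik)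
      (inner_sub_of_dist hp hij hik hjk), show (3 : ENNReal) = ENNReal.ofReal 3 by simp,
    ← ENNReal.ofReal_mul (by norm_num)]
  congr 1; ring

theorem surfaceArea_trihedron {p : Fin 3 → E3}
    (hp : ∀ i j : Fin 3, i ≠ j → dist (p i) (p j) = 1) :
    surfaceArea (trihedron p) = 6 * (Real.pi - 2 * arcsec 3) := by
  rw [surfaceArea, frontier_trihedron, measure_iUnion₀]
  · simp_rw [hausdorff_face hp]
    have h1 := arcsec_three_bounds
    have h2 := Real.pi_gt_d2
    norm_num at h1 h2
    rw [tsum_fintype, Fin.sum_univ_three, ← ENNReal.ofReal_add, ← ENNReal.ofReal_add,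
      ENNReal.toReal_ofReal]
    · ring
    all_goals linarith
  · intro i j hij
    exact hausdorff_circularArc (isCircularArc_edge hp hij)
  · intro i
    exact ((measurableSet_trihedron p).inter Metric.isClosed_sphere.measurableSet).nullMeasurableSet

/-! ### Mean width from the volume of parallel bodies -/

/-- The support function of a set. -/
noncomputable def supportFn (K : Set E3) (u : E3) : ℝ := sSup ((fun x => inner ℝ u x) '' K)

/-- The outer parallel body of `K` at distance `r`. -/
def parallelBody (K : Set E3) (r : ℝ) : Set E3 := {x | ∃ k ∈ K, ‖x - k‖ ≤ r}

theorem width_eq_supportFn_add (K : Set E3) (u : E3) :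
    width K u = supportFn K u + supportFn (-K) u := by
  have : -((fun x => inner ℝ u x) '' K) = (fun x => inner ℝ u x) '' (-K) := by
    rw [← Set.image_neg_eq_neg, ← Set.image_neg_eq_neg, Set.image_image, Set.image_image]
    simp
  rw [width, supportFn, supportFn, Real.sInf_def, this]
  ring

theorem continuous_supportFn {K : Set E3} (hK : IsCompact K) : Continuous (supportFn K) :=
  hK.continuous_sSup (f := fun u x => inner ℝ u x) (by fun_prop)

theorem inner_le_supportFn {K : Set E3} (hK : IsCompact K) {k : E3} (hk : k ∈ K) (u : E3) :
    inner ℝ u k ≤ supportFn K u :=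
  le_csSup (hK.image (by fun_prop)).bddAbove (Set.mem_image_of_mem _ hk)

theorem exists_inner_eq_supportFn {K : Set E3} (hK : IsCompact K) (hne : K.Nonempty) (u : E3) :
    ∃ k ∈ K, inner ℝ u k = supportFn K u := by
  obtain ⟨k, hk, h⟩ := (hK.image (f := fun x => inner ℝ u x) (by fun_prop)).sSup_mem
    (hne.image _)
  exact ⟨k, hk, h⟩

theorem abs_supportFn_le {K : Set E3} (hK : IsCompact K) (hne : K.Nonempty) {D : ℝ}
    (hD : ∀ k ∈ K, ‖k‖ ≤ D) {u : E3} (hu : ‖u‖ = 1) : |supportFn K u| ≤ D := by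
  obtain ⟨k, hk, h⟩ := exists_inner_eq_supportFn hK hne u
  rw [← h]
  refine (abs_real_inner_le_norm u k).trans ?_
  rw [hu, one_mul]
  exact hD k hk

theorem integrable_sphere {f : E3 → ℝ} (hf : Continuous f) :
    Integrable (fun u : Metric.sphere (0 : E3) 1 => f u) (volume : Measure E3).toSphere :=
  (hf.comp continuous_subtype_val).integrable_of_hasCompactSupport
    (HasCompactSupport.of_compactSpace _)

/-- Volume of a star body in polar coordinates. -/
theorem volume_starBody {g : E3 → ℝ} (hg : Continuous g) (hpos : ∀ u, ‖u‖ = 1 → 0 < g u) :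
    volume {x : E3 | 0 < ‖x‖ ∧ ‖x‖ < g (‖x‖⁻¹ • x)} =
      ENNReal.ofReal (∫ u : Metric.sphere (0 : E3) 1, g u ^ 3 / 3
        ∂(volume : Measure E3).toSphere) := by
  set σ := (volume : Measure E3).toSphere
  set A : Set (Metric.sphere (0 : E3) 1 × Set.Ioi (0 : ℝ)) := {q | (q.2 : ℝ) < g q.1} with hA
  have hAm : MeasurableSet A := (isOpen_lt (by fun_prop) (by fun_prop)).measurableSet
  have h1 := (volume : Measure E3).measurePreserving_homeomorphUnitSphereProd.measure_preimage
    hAm.nullMeasurableSet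
  rw [(MeasurableEmbedding.subtype_coe (measurableSet_singleton _).compl).comap_apply,
    Measure.prod_apply hAm] at h1
  have h2 : (Subtype.val '' (homeomorphUnitSphereProd E3 ⁻¹' A)) =
      {x : E3 | 0 < ‖x‖ ∧ ‖x‖ < g (‖x‖⁻¹ • x)} := by
    have hmem : ∀ y : ({0}ᶜ : Set E3), y ∈ homeomorphUnitSphereProd E3 ⁻¹' A ↔
        ‖(y : E3)‖ < g (‖(y : E3)‖⁻¹ • y) := fun y => by
      simp [hA]
    ext x
    constructor
    · rintro ⟨y, hyA, rfl⟩
      exact ⟨norm_pos_iff.2 y.2, (hmem y).1 hyA⟩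
    · rintro ⟨h1, h2⟩
      exact ⟨⟨x, norm_pos_iff.1 h1⟩, (hmem _).2 h2, rfl⟩
  rw [h2] at h1
  rw [h1, ofReal_integral_eq_lintegral_ofReal]
  · refine lintegral_congr fun u => ?_
    have hu := hpos u (mem_sphere_zero_iff_norm.1 u.2)
    have := Measure.volumeIoiPow_apply_Iio (Module.finrank ℝ E3 - 1) ⟨g u, hu⟩
    rw [finrank_euclideanSpace_fin] at *
    norm_num at this
    exact this
  · exact integrable_sphere (f := fun u => g u ^ 3 / 3) (by fun_prop)
  · refine .of_forall fun u => ?_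
    have hu := hpos u (mem_sphere_zero_iff_norm.1 u.2)
    simp only [Pi.zero_apply]
    positivity

/-- Comparison of Taylor coefficients up to first order: let t → 0⁺, then divide by t and repeat. -/
theorem eq_zero_of_abs_add_mul_le {a b C t₀ : ℝ} (ht₀ : 0 < t₀)
    (h : ∀ t, 0 < t → t ≤ t₀ → |a + b * t| ≤ C * t ^ 2) : a = 0 ∧ b = 0 := by
  have hev : ∀ᶠ t : ℝ in 𝓝[>] 0, 0 < t ∧ t ≤ t₀ := by
    filter_upwards [Ioc_mem_nhdsGT ht₀] with t ht using ht
  have ha : a = 0 := by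
    have h1 : Filter.Tendsto (fun t : ℝ => |a + b * t|) (𝓝[>] 0) (𝓝 |a + b * 0|) :=
      tendsto_nhdsWithin_of_tendsto_nhds (Continuous.tendsto (by fun_prop) 0)
    have h2 : Filter.Tendsto (fun t : ℝ => C * t ^ 2) (𝓝[>] 0) (𝓝 (C * 0 ^ 2)) :=
      tendsto_nhdsWithin_of_tendsto_nhds (Continuous.tendsto (by fun_prop) 0)
    have := le_of_tendsto_of_tendsto h1 h2 (hev.mono fun t ht => h t ht.1 ht.2)
    simpa using this
  refine ⟨ha, ?_⟩
  have h2 : Filter.Tendsto (fun t : ℝ => C * t) (𝓝[>] 0) (𝓝 (C * 0)) :=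
    tendsto_nhdsWithin_of_tendsto_nhds (Continuous.tendsto (by fun_prop) 0)
  have : |b| ≤ C * 0 := ge_of_tendsto h2 (hev.mono fun t ht => by
    have := h t ht.1 ht.2
    rw [ha, zero_add, abs_mul, abs_of_pos ht.1] at this
    exact le_of_mul_le_mul_right (by linarith [sq t]) ht.1)
  simpa using this

theorem parallelBody_one_smul {K : Set E3} {t : ℝ} (ht : 0 < t) :
    {x : E3 | ∃ k ∈ K, ‖x - t • k‖ ≤ 1} = t • parallelBody K t⁻¹ := by
  ext x
  rw [Set.mem_smul_set_iff_inv_smul_mem₀ ht.ne']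
  simp only [parallelBody, Set.mem_ofPred_eq]
  refine exists_congr fun k => and_congr_right fun _ => ?_
  have : x - t • k = t • (t⁻¹ • x - k) := by rw [smul_sub, smul_inv_smul₀ ht.ne']
  rw [this, norm_smul, Real.norm_of_nonneg ht.le, ← one_div, le_div_iff₀ ht, mul_comm]

/-- If the volume of the parallel bodies of `K` is the cubic polynomial `V + A r + M r² + c r³`,
then the integral of the support function over the unit sphere is `M`. -/
theorem integral_supportFn {K : Set E3} (hK : IsCompact K) (hne : K.Nonempty) {V A M c : ℝ}
    (hvol : ∀ r, 0 < r → (volume (parallelBody K r)).toReal = V + A * r + M * r ^ 2 + c * r ^ 3) :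
    ∫ u : Metric.sphere (0 : E3) 1, supportFn K u ∂(volume : Measure E3).toSphere = M := by
  set σ := (volume : Measure E3).toSphere with hσ
  set I := ∫ u : Metric.sphere (0 : E3) 1, supportFn K u ∂σ with hI
  set s := σ.real Set.univ with hs
  have hs0 : 0 ≤ s := measureReal_nonneg
  obtain ⟨D, hD0, hD⟩ : ∃ D : ℝ, 0 < D ∧ ∀ k ∈ K, ‖k‖ ≤ D := by
    obtain ⟨D, hD⟩ := hK.isBounded.exists_norm_le
    exact ⟨max D 1, by positivity, fun k hk => (hD k hk).trans (le_max_left _ _)⟩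
  have hh := continuous_supportFn hK
  have hint := integrable_sphere hh
  have hint1 : ∀ t : ℝ, Integrable (fun u : Metric.sphere (0 : E3) 1 => 1 / 3 + t * supportFn K u) σ :=
    fun t => (integrable_const _).add (hint.const_mul t)
  have hint2 : ∀ t κ : ℝ,
      Integrable (fun u : Metric.sphere (0 : E3) 1 => 1 / 3 + t * supportFn K u + κ) σ :=
    fun t κ => (hint1 t).add (integrable_const _)
  have haff : ∀ t κ : ℝ, ∫ u : Metric.sphere (0 : E3) 1, (1 / 3 + t * supportFn K u + κ) ∂σ =
      s / 3 + t * I + κ * s := by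
    intro t κ
    rw [integral_add (hint1 t) (integrable_const _),
      integral_add (integrable_const _) (hint.const_mul t), integral_const, integral_const,
      integral_const_mul, ← hI, smul_eq_mul, smul_eq_mul, ← hs]
    ring
  -- Since B + tK = t(K + t⁻¹B), the cubic in r = 1/t is reversed, and the r² coefficient becomes
  -- the linear one.
  have hG : ∀ t : ℝ, 0 < t → (volume {x : E3 | ∃ k ∈ K, ‖x - t • k‖ ≤ 1}).toReal =
      c + M * t + A * t ^ 2 + V * t ^ 3 := by
    intro t ht
    rw [parallelBody_one_smul ht, Measure.addHaar_smul, finrank_euclideanSpace_fin,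
      abs_of_pos (by positivity), ENNReal.toReal_mul, ENNReal.toReal_ofReal (by positivity),
      hvol _ (inv_pos.2 ht)]
    field_simp
    ring
  set E := D + 1 + D ^ 2 with hE
  -- Apart from the origin, B + tK lies in the star body of radial function 1 + t·h + t². The slack
  -- t² makes the inequality strict and costs only second order.
  have hupper : ∀ t : ℝ, 0 < t → t ≤ 1 → t * D ≤ 1 / 2 →
      c + M * t + A * t ^ 2 + V * t ^ 3 ≤ s / 3 + t * I + t ^ 2 * (s * (1 + E ^ 2 + E ^ 3)) := by
    intro t ht ht1 htD
    have hb : ∀ u : E3, ‖u‖ = 1 → |t * supportFn K u| ≤ t * D := fun u hu => by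
      rw [abs_mul, abs_of_pos ht]
      exact mul_le_mul_of_nonneg_left (abs_supportFn_le hK hne hD hu) ht.le
    have hstar := volume_starBody (g := fun u => 1 + t * supportFn K u + t ^ 2) (by fun_prop)
      (fun u hu => by have := abs_le.1 (hb u hu); nlinarith)
    have hsub : {x : E3 | ∃ k ∈ K, ‖x - t • k‖ ≤ 1} ⊆ {0} ∪
        {x : E3 | 0 < ‖x‖ ∧ ‖x‖ < 1 + t * supportFn K (‖x‖⁻¹ • x) + t ^ 2} := by
      rintro x ⟨k, hk, hx⟩
      by_cases hx0 : x = 0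
      · exact .inl hx0
      · have hpos : 0 < ‖x‖ := norm_pos_iff.2 hx0
        refine .inr ⟨hpos, ?_⟩
        have h1 : inner ℝ (‖x‖⁻¹ • x) x = ‖x‖ := by
          rw [inner_normalize, real_inner_self_eq_norm_sq]; field_simp
        have h2 : inner ℝ (‖x‖⁻¹ • x) (x - t • k) ≤ 1 := by
          refine (real_inner_le_norm _ _).trans ?_
          rw [norm_smul, norm_inv, norm_norm, inv_mul_cancel₀ hpos.ne', one_mul]; exact hx
        rw [inner_sub_right, h1, inner_smul_right] at h2
        have h3 := mul_le_mul_of_nonneg_left (inner_le_supportFn hK hk (‖x‖⁻¹ • x)) ht.le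
        have : 0 < t ^ 2 := by positivity
        linarith
    have hle := (measure_mono (μ := volume) hsub).trans (measure_union_le _ _)
    rw [measure_singleton, zero_add, hstar] at hle
    have hle' := ENNReal.toReal_mono (by simp) hle
    rw [hG t ht, ENNReal.toReal_ofReal (integral_nonneg fun u => by
      have := abs_le.1 (hb u (mem_sphere_zero_iff_norm.1 u.2))
      have : 0 ≤ 1 + t * supportFn K u + t ^ 2 := by nlinarith
      simp only [Pi.zero_apply]; positivity)] at hle'
    refine hle'.trans ?_
    have := haff t (t ^ 2 * (1 + E ^ 2 + E ^ 3))
    rw [show s / 3 + t * I + t ^ 2 * (s * (1 + E ^ 2 + E ^ 3)) =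
      s / 3 + t * I + t ^ 2 * (1 + E ^ 2 + E ^ 3) * s by ring, ← this]
    refine integral_mono (integrable_sphere (f := fun u => (1 + t * supportFn K u + t ^ 2) ^ 3 / 3)
      (by fun_prop)) (hint2 _ _)
      fun u => ?_
    have hu := abs_le.1 (hb u (mem_sphere_zero_iff_norm.1 u.2))
    simp only []
    set a := t * supportFn K u + t ^ 2 with ha
    have ha1 : |a| ≤ t * E := abs_le.2 ⟨by nlinarith, by nlinarith⟩
    have ha2 : a ^ 2 ≤ t ^ 2 * E ^ 2 := by rw [← sq_abs, ← mul_pow]; gcongr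
    have ha3 : a ^ 3 ≤ t ^ 2 * E ^ 3 := by
      have h1 : a ^ 3 ≤ (t * E) ^ 3 := by
        calc a ^ 3 ≤ |a| ^ 3 := by rw [← abs_pow]; exact le_abs_self _
          _ ≤ _ := by gcongr
      refine h1.trans ?_
      rw [mul_pow]
      have : t ^ 3 ≤ t ^ 2 := pow_le_pow_of_le_one ht.le ht1 (by norm_num)
      gcongr
    have hE3 : 0 ≤ t ^ 2 * E ^ 3 := by positivity
    have : (1 + t * supportFn K u + t ^ 2) ^ 3 / 3 = 1 / 3 + a + a ^ 2 + a ^ 3 / 3 := by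
      rw [ha]; ring
    rw [this]
    linarith
  -- Conversely the star body of 1 + t·h - (tD)² lies in B + tK. If k attains h(u) and x = ‖x‖u,
  -- then ‖x - tk‖² ≤ (‖x‖ - t·h(u))² + (tD)², and (1 - δ)² + δ ≤ 1 for δ = (tD)² ≤ 1.
  have hlower : ∀ t : ℝ, 0 < t → t ≤ 1 → t * D ≤ 1 / 2 →
      s / 3 + t * I - t ^ 2 * (s * (D ^ 2 + E ^ 3)) ≤ c + M * t + A * t ^ 2 + V * t ^ 3 := by
    intro t ht ht1 htD
    have hb : ∀ u : E3, ‖u‖ = 1 → |t * supportFn K u| ≤ t * D := fun u hu => by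
      rw [abs_mul, abs_of_pos ht]
      exact mul_le_mul_of_nonneg_left (abs_supportFn_le hK hne hD hu) ht.le
    have hstar := volume_starBody (g := fun u => 1 + t * supportFn K u - (t * D) ^ 2)
      (by fun_prop) (fun u hu => by have := abs_le.1 (hb u hu); nlinarith)
    have hsub : {x : E3 | 0 < ‖x‖ ∧ ‖x‖ < 1 + t * supportFn K (‖x‖⁻¹ • x) - (t * D) ^ 2} ⊆
        {x : E3 | ∃ k ∈ K, ‖x - t • k‖ ≤ 1} := by
      rintro x ⟨hpos, hx⟩
      have hu1 : ‖‖x‖⁻¹ • x‖ = 1 := by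
        rw [norm_smul, norm_inv, norm_norm, inv_mul_cancel₀ hpos.ne']
      obtain ⟨k, hk, hk1⟩ := exists_inner_eq_supportFn hK hne (‖x‖⁻¹ • x)
      have hbu := abs_le.1 (hb _ hu1)
      refine ⟨k, hk, ?_⟩
      rw [← sq_le_one_iff₀ (norm_nonneg _), norm_sub_sq_real, inner_smul_right, norm_smul,
        Real.norm_of_nonneg ht.le]
      rw [inner_normalize] at hk1
      have h1 : inner ℝ x k = ‖x‖ * supportFn K (‖x‖⁻¹ • x) := by
        rw [← hk1]; field_simp
      rw [h1]
      set H := supportFn K (‖x‖⁻¹ • x)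
      have h2 : (t * ‖k‖) ^ 2 ≤ (t * D) ^ 2 := by
        have := hD k hk
        gcongr
      have h3 : (‖x‖ - t * H) ^ 2 + (t * D) ^ 2 ≤ 1 := by
        rcases le_total 0 (‖x‖ - t * H) with h0 | h0
        · have : (‖x‖ - t * H) ^ 2 ≤ (1 - (t * D) ^ 2) ^ 2 := by
            apply pow_le_pow_left₀ h0; linarith
          have : (t * D) ^ 2 ≤ 1 / 4 := by
            have := pow_le_pow_left₀ (by positivity) htD 2
            linarith
          nlinarith [sq_nonneg (t * D)]
        · have : (‖x‖ - t * H) ^ 2 ≤ (t * D) ^ 2 := by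
            rw [← sq_abs]
            apply pow_le_pow_left₀ (abs_nonneg _)
            rw [abs_of_nonpos h0]; linarith
          have := pow_le_pow_left₀ (by positivity) htD 2
          linarith
      nlinarith [sq_nonneg (t * H)]
    have hle := measure_mono (μ := volume) hsub
    rw [hstar] at hle
    have hfin : volume {x : E3 | ∃ k ∈ K, ‖x - t • k‖ ≤ 1} ≠ ⊤ := by
      refine ((Metric.isBounded_closedBall (x := (0 : E3)) (r := 1 + t * D)).subset
        ?_).measure_lt_top.ne
      rintro x ⟨k, hk, hx⟩
      rw [mem_closedBall_zero_iff]
      calc ‖x‖ = ‖(x - t • k) + t • k‖ := by rw [sub_add_cancel]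
        _ ≤ ‖x - t • k‖ + ‖t • k‖ := norm_add_le _ _
        _ ≤ 1 + t * D := by
          rw [norm_smul, Real.norm_of_nonneg ht.le]
          exact add_le_add hx (mul_le_mul_of_nonneg_left (hD k hk) ht.le)
    have hle' := ENNReal.toReal_mono hfin hle
    rw [hG t ht, ENNReal.toReal_ofReal (integral_nonneg fun u => by
      have := abs_le.1 (hb u (mem_sphere_zero_iff_norm.1 u.2))
      have : 0 ≤ 1 + t * supportFn K u - (t * D) ^ 2 := by nlinarith
      simp only [Pi.zero_apply]; positivity)] at hle'
    refine le_trans ?_ hle'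
    have := haff t (-(t ^ 2 * (D ^ 2 + E ^ 3)))
    rw [show s / 3 + t * I - t ^ 2 * (s * (D ^ 2 + E ^ 3)) =
      s / 3 + t * I + -(t ^ 2 * (D ^ 2 + E ^ 3)) * s by ring, ← this]
    refine integral_mono (hint2 _ _)
      (integrable_sphere (f := fun u => (1 + t * supportFn K u - (t * D) ^ 2) ^ 3 / 3)
      (by fun_prop)) fun u => ?_
    have hu := abs_le.1 (hb u (mem_sphere_zero_iff_norm.1 u.2))
    simp only []
    set a := t * supportFn K u - (t * D) ^ 2 with ha
    have htD2 : (t * D) ^ 2 ≤ t * D ^ 2 := by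
      rw [mul_pow]
      have : t ^ 2 ≤ t := by nlinarith
      gcongr
    have ha1 : |a| ≤ t * E := abs_le.2 ⟨by nlinarith, by nlinarith [sq_nonneg (t * D)]⟩
    have ha3 : -(t ^ 2 * E ^ 3) ≤ a ^ 3 := by
      have h1 : -a ^ 3 ≤ (t * E) ^ 3 := by
        calc -a ^ 3 ≤ |a| ^ 3 := by rw [← abs_pow]; exact neg_le_abs _
          _ ≤ _ := by gcongr
      have h2 : (t * E) ^ 3 ≤ t ^ 2 * E ^ 3 := by
        rw [mul_pow]
        have : t ^ 3 ≤ t ^ 2 := pow_le_pow_of_le_one ht.le ht1 (by norm_num)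
        gcongr
      linarith
    have hE3 : 0 ≤ t ^ 2 * E ^ 3 := by positivity
    have : (1 + t * supportFn K u - (t * D) ^ 2) ^ 3 / 3 = 1 / 3 + a + a ^ 2 + a ^ 3 / 3 := by
      rw [ha]; ring
    rw [this]
    nlinarith [sq_nonneg a]
  set C := s * (1 + E ^ 2 + E ^ 3) + s * (D ^ 2 + E ^ 3) + |A| + |V| with hC
  have hE0 : 0 ≤ E := by positivity
  have := eq_zero_of_abs_add_mul_le (a := c - s / 3) (b := M - I) (C := C)
    (t₀ := min 1 (1 / (2 * D))) (by positivity) (fun t ht ht0 => by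
      have ht1 : t ≤ 1 := ht0.trans (min_le_left _ _)
      have htD : t * D ≤ 1 / 2 := by
        have := ht0.trans (min_le_right _ _)
        rw [le_div_iff₀ (by positivity)] at this
        linarith
      have hu := hupper t ht ht1 htD
      have hl := hlower t ht ht1 htD
      have t3 : t ^ 3 ≤ t ^ 2 := pow_le_pow_of_le_one ht.le ht1 (by norm_num)
      have t30 : 0 ≤ t ^ 3 := by positivity
      have t20 : 0 ≤ t ^ 2 := by positivity
      have hA := abs_le.1 (le_refl |A|)
      have hV := abs_le.1 (le_refl |V|)
      have v1 : V * t ^ 3 ≤ |V| * t ^ 2 := (mul_le_mul_of_nonneg_right hV.2 t30).trans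
        (mul_le_mul_of_nonneg_left t3 (abs_nonneg _))
      have v2 : -(|V| * t ^ 2) ≤ V * t ^ 3 := by
        have := mul_le_mul_of_nonneg_right hV.1 t30
        have := mul_le_mul_of_nonneg_left t3 (abs_nonneg V)
        linarith
      have a1 := mul_le_mul_of_nonneg_right hA.1 t20
      have a2 := mul_le_mul_of_nonneg_right hA.2 t20
      have p1 : 0 ≤ t ^ 2 * (s * (1 + E ^ 2 + E ^ 3)) := by positivity
      have p2 : 0 ≤ t ^ 2 * (s * (D ^ 2 + E ^ 3)) := by positivity
      rw [abs_le, hC]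
      constructor <;> linarith)
  linarith [this.2]

theorem volume_parallelBody_neg (K : Set E3) (r : ℝ) :
    volume (parallelBody (-K) r) = volume (parallelBody K r) := by
  rw [← Measure.measure_neg]
  congr 1
  ext x
  simp only [parallelBody, Set.mem_neg, Set.mem_ofPred_eq]
  constructor
  · rintro ⟨k, hk, h⟩
    exact ⟨-k, hk, by rwa [← norm_neg, neg_sub', neg_neg]⟩
  · rintro ⟨k, hk, h⟩
    exact ⟨-k, by rwa [neg_neg], by rwa [← norm_neg, neg_sub', neg_neg, neg_neg]⟩

/-- The width is h_K + h_{-K}, and the parallel bodies of K and -K have equal volumes, so both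
integrals equal M; the sphere has total measure 4π. -/
theorem meanWidth_eq_of_volume_parallelBody {K : Set E3} (hK : IsCompact K) (hne : K.Nonempty)
    {V A M c : ℝ}
    (hvol : ∀ r, 0 < r → (volume (parallelBody K r)).toReal = V + A * r + M * r ^ 2 + c * r ^ 3) :
    meanWidth K = M / (2 * Real.pi) := by
  have h1 := integral_supportFn hK hne hvol
  have h2 := integral_supportFn hK.neg hne.neg (V := V) (A := A) (M := M) (c := c)
    (fun r hr => by rw [volume_parallelBody_neg, hvol r hr])
  have h3 : (volume : Measure E3).toSphere.real Set.univ = 4 * Real.pi := by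
    rw [Measure.toSphere_real_apply_univ, finrank_euclideanSpace_fin, Measure.real,
      EuclideanSpace.volume_ball_fin_three]
    have := Real.pi_pos
    rw [ENNReal.ofReal_one, one_pow, one_mul, ENNReal.toReal_ofReal (by positivity)]
    norm_num
    ring
  rw [meanWidth, average_eq, h3]
  simp_rw [width_eq_supportFn_add]
  rw [integral_add (integrable_sphere (continuous_supportFn hK))
    (integrable_sphere (continuous_supportFn hK.neg)), h1, h2, smul_eq_mul]
  have := Real.pi_pos
  field_simp
  ring

/-! ### Normal cones and the decomposition of the parallel body -/

/-- `n` is an outward normal of `K` at `x`. -/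
def IsNormalAt (K : Set E3) (x n : E3) : Prop := ∀ k ∈ K, inner ℝ n (k - x) ≤ 0

/-- Adding the two normality inequalities gives ‖x' - x‖² ≤ 0. This uniqueness of the foot point
makes the zones below disjoint. -/
theorem IsNormalAt.eq_of_sub {K : Set E3} {x x' y : E3} (hx : x ∈ K) (hx' : x' ∈ K)
    (h : IsNormalAt K x (y - x)) (h' : IsNormalAt K x' (y - x')) : x = x' := by
  have h1 := h x' hx'
  have h2 := h' x hx
  have h3 : inner ℝ (x' - x) (x' - x) = inner ℝ (y - x) (x' - x) + inner ℝ (y - x') (x - x') := by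
    rw [← neg_sub x' x, inner_neg_right, ← sub_eq_add_neg, ← inner_sub_left]
    congr 1; abel
  have h4 : inner ℝ (x' - x) (x' - x) = (0 : ℝ) := le_antisymm (by linarith) real_inner_self_nonneg
  exact (sub_eq_zero.1 (inner_self_eq_zero.1 h4)).symm

theorem exists_nearest {K : Set E3} (hK : IsCompact K) (hconv : Convex ℝ K) {y k : E3}
    (hk : k ∈ K) : ∃ x ∈ K, ‖y - x‖ ≤ ‖y - k‖ ∧ IsNormalAt K x (y - x) := by
  obtain ⟨x, hx, h⟩ := exists_norm_eq_iInf_of_complete_convex ⟨k, hk⟩ hK.isComplete hconv y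
  refine ⟨x, hx, ?_, (norm_eq_iInf_iff_real_inner_le_zero hconv hx).1 h⟩
  rw [h]
  exact ciInf_le ⟨0, by rintro _ ⟨z, rfl⟩; exact norm_nonneg _⟩ (⟨k, hk⟩ : K)

theorem farkas_of_gram {I : Finset (Fin 3)} {g : Fin 3 → E3}
    (hg : ∀ i ∈ I, ∀ j ∈ I, inner ℝ (g i) (g j) = if i = j then (1 : ℝ) else 1 / 2) {n : E3}
    (h : ∀ w, (∀ i ∈ I, inner ℝ w (g i) ≤ 0) → inner ℝ w n ≤ 0) :
    ∃ c : Fin 3 → ℝ, (∀ i ∈ I, 0 ≤ c i) ∧ n = ∑ i ∈ I, c i • g i := by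
  set m : ℝ := ((I.card : ℕ) : ℝ) with hm
  have hm0 : 0 ≤ m := Nat.cast_nonneg _
  set s := ∑ i ∈ I, g i with hs
  -- The Gram matrix is (1 + J)/2 with J the all-ones matrix, and its inverse 2 - 2J/(m + 1) yields
  -- the dual basis `w`. Testing with -w i shows that the coefficients are nonnegative; testing with
  -- the part of `n` orthogonal to all `g i` shows that this part vanishes.
  set w : Fin 3 → E3 := fun i => (2 : ℝ) • g i - (2 / (m + 1)) • s with hw
  have hgs : ∀ j ∈ I, inner ℝ s (g j) = (m + 1) / 2 := by
    intro j hj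
    rw [hs, sum_inner, Finset.sum_congr rfl fun i hi => hg i hi j hj]
    have : ∀ i, (if i = j then (1 : ℝ) else 1 / 2) = 1 / 2 + if i = j then 1 / 2 else 0 := by
      intro i; split_ifs <;> norm_num
    simp_rw [this]
    rw [Finset.sum_add_distrib, Finset.sum_const, Finset.sum_ite_eq' I j, if_pos hj, nsmul_eq_mul]
    ring
  have hwg : ∀ i ∈ I, ∀ j ∈ I, inner ℝ (w i) (g j) = if i = j then (1 : ℝ) else 0 := by
    intro i hi j hj
    simp only [hw]
    rw [inner_sub_left, inner_smul_left, inner_smul_left, hg i hi j hj, hgs j hj]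
    have : m + 1 ≠ 0 := by positivity
    simp only [conj_trivial]
    split_ifs <;> field_simp <;> ring
  refine ⟨fun i => inner ℝ (w i) n, ?_, ?_⟩
  · intro i hi
    have := h (-w i) fun j hj => by
      rw [inner_neg_left, hwg i hi j hj]; split_ifs <;> norm_num
    rw [inner_neg_left] at this
    linarith
  · set q := n - ∑ i ∈ I, (inner ℝ (w i) n : ℝ) • g i with hq
    have hqg : ∀ j ∈ I, inner ℝ q (g j) = (0 : ℝ) := by
      intro j hj
      rw [hq, inner_sub_left, sum_inner]
      have e1 : ∀ i ∈ I, inner ℝ ((inner ℝ (w i) n : ℝ) • g i) (g j) =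
          inner ℝ (w i) n / 2 + if i = j then inner ℝ (w i) n / 2 else 0 := by
        intro i hi
        rw [inner_smul_left, hg i hi j hj, conj_trivial]
        split_ifs <;> ring
      have e2 : ∑ i ∈ I, inner ℝ (w i) n / 2 = inner ℝ s n / (m + 1) := by
        rw [← Finset.sum_div, ← sum_inner]
        have : ∑ i ∈ I, w i = (2 / (m + 1)) • s := by
          simp only [hw]
          rw [Finset.sum_sub_distrib, ← Finset.smul_sum, ← hs, Finset.sum_const,
            ← Nat.cast_smul_eq_nsmul ℝ, ← hm, smul_smul, ← sub_smul]
          congr 1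
          field_simp; ring
        rw [this, inner_smul_left, conj_trivial]
        field_simp
      rw [Finset.sum_congr rfl e1, Finset.sum_add_distrib, e2, Finset.sum_ite_eq' I j, if_pos hj]
      simp only [hw]
      rw [inner_sub_left, inner_smul_left, inner_smul_left, conj_trivial, conj_trivial,
        real_inner_comm]
      field_simp
      ring
    have hqn : inner ℝ q n ≤ (0 : ℝ) := h q fun i hi => (hqg i hi).le
    have hqq : inner ℝ q q = (0 : ℝ) := by
      refine le_antisymm ?_ real_inner_self_nonneg
      nth_rw 2 [hq]
      rw [inner_sub_right, inner_sum, Finset.sum_eq_zero fun i hi => by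
        rw [inner_smul_right, hqg i hi, mul_zero], sub_zero]
      exact hqn
    exact sub_eq_zero.1 (inner_self_eq_zero.1 hqq)

/-- The balls on whose boundary `x` lies. -/
noncomputable def activeSet (p : Fin 3 → E3) (x : E3) : Finset (Fin 3) :=
  Finset.univ.filter fun i => ‖x - p i‖ = 1

theorem mem_activeSet {p : Fin 3 → E3} {x : E3} {i : Fin 3} :
    i ∈ activeSet p x ↔ ‖x - p i‖ = 1 := by
  simp [activeSet]

theorem isCompact_trihedron (p : Fin 3 → E3) : IsCompact (trihedron p) :=
  (isCompact_closedBall (p 0) 1).of_isClosed_subset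
    (isClosed_iInter fun _ => Metric.isClosed_closedBall) (Set.iInter_subset _ 0)

theorem convex_trihedron (p : Fin 3 → E3) : Convex ℝ (trihedron p) :=
  convex_iInter fun i => convex_closedBall (p i) 1

theorem exists_interior_point {p : Fin 3 → E3} (hp : ∀ i j : Fin 3, i ≠ j → dist (p i) (p j) = 1) :
    ∃ c : E3, ∀ i, ‖c - p i‖ < 1 := by
  obtain ⟨B, h0, h1, h2⟩ := exists_edge_frame hp (i := 0) (j := 1) (k := 2) (by decide) (by decide)
    (by decide)
  set m := midpoint ℝ (p 0) (p 1)
  have h3 : Real.sqrt 3 ^ 2 = 3 := Real.sq_sqrt (by norm_num)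
  have hm : m = m + ofCoords B (0, 0, 0) := by simp [ofCoords]
  refine ⟨m, fun i => ?_⟩
  rw [← sq_lt_one_iff₀ (norm_nonneg _)]
  fin_cases i
  · change ‖m - p 0‖ ^ 2 < 1
    rw [h0, hm, add_assoc, show ofCoords B (0, 0, 0) + ofCoords B (-(1 / 2), 0, 0) =
      ofCoords B (-(1 / 2), 0, 0) by simp [ofCoords], norm_sq_frame]; norm_num
  · change ‖m - p 1‖ ^ 2 < 1
    rw [h1, hm, add_assoc, show ofCoords B (0, 0, 0) + ofCoords B (1 / 2, 0, 0) =
      ofCoords B (1 / 2, 0, 0) by simp [ofCoords], norm_sq_frame]; norm_num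
  · change ‖m - p 2‖ ^ 2 < 1
    rw [h2, hm, add_assoc, show ofCoords B (0, 0, 0) + ofCoords B (0, Real.sqrt 3 / 2, 0) =
      ofCoords B (0, Real.sqrt 3 / 2, 0) by simp [ofCoords], norm_sq_frame]; nlinarith

/-- Feasible directions: moving strictly into all active balls keeps one inside the solid. -/
theorem inner_nonpos_of_feasible {p : Fin 3 → E3} {x n w : E3} (hx : x ∈ trihedron p)
    (hn : IsNormalAt (trihedron p) x n) (hw : ∀ i ∈ activeSet p x, inner ℝ w (x - p i) < 0) :
    inner ℝ w n ≤ 0 := by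
  have hev : ∀ᶠ t : ℝ in 𝓝[>] 0, x + t • w ∈ trihedron p := by
    simp_rw [mem_trihedron]
    refine Filter.eventually_all.2 fun i => ?_
    by_cases hi : i ∈ activeSet p x
    · have h1 : Filter.Tendsto (fun t : ℝ => 2 * inner ℝ w (x - p i) + t * ‖w‖ ^ 2) (𝓝[>] 0)
          (𝓝 (2 * inner ℝ w (x - p i) + 0 * ‖w‖ ^ 2)) :=
        tendsto_nhdsWithin_of_tendsto_nhds (Continuous.tendsto (by fun_prop) 0)
      have h2 := h1.eventually_lt_const (u := 0) (by have := hw i hi; linarith)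
      filter_upwards [h2, self_mem_nhdsWithin] with t ht ht0
      have ht0 : 0 < t := ht0
      rw [show x + t • w - p i = (x - p i) + t • w by abel, ← sq_le_one_iff₀ (norm_nonneg _),
        norm_add_sq_real, mem_activeSet.1 hi, inner_smul_right, norm_smul, Real.norm_of_nonneg ht0.le,
        real_inner_comm]
      nlinarith
    · have hlt : ‖x - p i‖ < 1 :=
        lt_of_le_of_ne (mem_trihedron.1 hx i) fun h => hi (mem_activeSet.2 h)
      have h1 : Filter.Tendsto (fun t : ℝ => ‖x + t • w - p i‖) (𝓝[>] 0)
          (𝓝 ‖x + (0 : ℝ) • w - p i‖) :=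
        tendsto_nhdsWithin_of_tendsto_nhds (Continuous.tendsto (by fun_prop) 0)
      rw [zero_smul, add_zero] at h1
      exact (h1.eventually_lt_const hlt).mono fun _ h => h.le
  obtain ⟨t, ht, ht0⟩ := (hev.and self_mem_nhdsWithin).exists
  have ht0 : 0 < t := ht0
  have := hn _ ht
  rw [add_sub_cancel_left, inner_smul_right, real_inner_comm] at this
  exact nonpos_of_mul_nonpos_right this ht0

theorem isNormalAt_iff {p : Fin 3 → E3} (hp : ∀ i j : Fin 3, i ≠ j → dist (p i) (p j) = 1)
    {x n : E3} (hx : x ∈ trihedron p) :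
    IsNormalAt (trihedron p) x n ↔ ∃ c : Fin 3 → ℝ, (∀ i ∈ activeSet p x, 0 ≤ c i) ∧
      n = ∑ i ∈ activeSet p x, c i • (x - p i) := by
  constructor
  · intro hn
    refine farkas_of_gram (g := fun i => x - p i) ?_ ?_
    · intro i hi j hj
      rw [mem_activeSet] at hi hj
      split_ifs with h
      · rw [h, real_inner_self_eq_norm_sq, hj, one_pow]
      · refine inner_eq_half hi hj ?_
        rw [sub_sub_sub_cancel_left]; exact norm_sub_of_dist hp h
    · intro w hw
      obtain ⟨c, hc⟩ := exists_interior_point hp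
      have hd : ∀ i ∈ activeSet p x, inner ℝ (c - x) (x - p i) < 0 := by
        intro i hi
        rw [mem_activeSet] at hi
        have h1 := real_inner_le_norm (c - p i) (x - p i)
        rw [hi, mul_one] at h1
        rw [← sub_sub_sub_cancel_right c x (p i), inner_sub_left, real_inner_self_eq_norm_sq, hi]
        have := hc i
        linarith
      -- A Slater argument: adding a little of the direction to an interior point makes the weak
      -- constraints on `w` strict, and then t → 0.
      have hev : ∀ᶠ t : ℝ in 𝓝[>] 0, inner ℝ (w + t • (c - x)) n ≤ 0 := by
        filter_upwards [self_mem_nhdsWithin] with t ht0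
        have ht0 : 0 < t := ht0
        refine inner_nonpos_of_feasible hx hn fun i hi => ?_
        rw [inner_add_left, inner_smul_left, conj_trivial]
        have := hw i hi
        have := mul_neg_of_pos_of_neg ht0 (hd i hi)
        linarith
      have h1 : Filter.Tendsto (fun t : ℝ => inner ℝ (w + t • (c - x)) n) (𝓝[>] 0)
          (𝓝 (inner ℝ (w + (0 : ℝ) • (c - x)) n)) :=
        tendsto_nhdsWithin_of_tendsto_nhds (Continuous.tendsto (by fun_prop) 0)
      rw [zero_smul, add_zero] at h1
      exact le_of_tendsto h1 hev
  · rintro ⟨c, hc, rfl⟩ k hk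
    rw [sum_inner]
    refine Finset.sum_nonpos fun i hi => ?_
    have h1 := real_inner_le_norm (x - p i) (k - p i)
    have h2 := mem_activeSet.1 hi
    rw [h2, one_mul] at h1
    rw [inner_smul_left, conj_trivial, ← sub_sub_sub_cancel_right k x (p i), inner_sub_right,
      real_inner_self_eq_norm_sq, h2]
    have := mem_trihedron.1 hk i
    exact mul_nonpos_of_nonneg_of_nonpos (hc i hi) (by linarith)

/-- The points outside the solid, at distance at most `r`, whose nearest point lies on exactly the
spheres indexed by `I`. -/
def zone (p : Fin 3 → E3) (I : Finset (Fin 3)) (r : ℝ) : Set E3 :=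
  {y | ∃ x ∈ trihedron p, activeSet p x = I ∧ IsNormalAt (trihedron p) x (y - x) ∧
    0 < ‖y - x‖ ∧ ‖y - x‖ ≤ r}

theorem parallelBody_trihedron {p : Fin 3 → E3} {r : ℝ} (hr : 0 < r) :
    parallelBody (trihedron p) r = trihedron p ∪ ⋃ I, zone p I r := by
  ext y
  rw [Set.mem_union, Set.mem_iUnion]
  constructor
  · rintro ⟨k, hk, h⟩
    obtain ⟨x, hx, h1, h2⟩ := exists_nearest (isCompact_trihedron p) (convex_trihedron p) hk (y := y)
    by_cases hyx : y = x
    · exact .inl (hyx ▸ hx)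
    · exact .inr ⟨_, x, hx, rfl, h2, norm_pos_iff.2 (sub_ne_zero.2 hyx), h1.trans h⟩
  · rintro (h | ⟨I, x, hx, -, -, -, h⟩)
    · exact ⟨y, h, by rw [sub_self, norm_zero]; exact hr.le⟩
    · exact ⟨x, hx, h⟩

theorem disjoint_zone (p : Fin 3 → E3) (r : ℝ) : Pairwise (Function.onFun Disjoint
    fun I => zone p I r) := by
  intro I J hIJ
  refine Set.disjoint_left.2 ?_
  rintro y ⟨x, hx, rfl, hn, -⟩ ⟨x', hx', rfl, hn', -⟩
  exact hIJ (by rw [hn.eq_of_sub hx hx' hn'])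

theorem disjoint_trihedron_zone (p : Fin 3 → E3) (r : ℝ) :
    Disjoint (trihedron p) (⋃ I, zone p I r) := by
  refine Set.disjoint_left.2 fun y hy hy' => ?_
  obtain ⟨I, x, hx, -, hn, h, -⟩ := Set.mem_iUnion.1 hy'
  have := hn y hy
  rw [real_inner_self_eq_norm_sq] at this
  nlinarith

theorem zone_empty {p : Fin 3 → E3} (hp : ∀ i j : Fin 3, i ≠ j → dist (p i) (p j) = 1) (r : ℝ) :
    zone p ∅ r = ∅ := by
  refine Set.eq_empty_of_forall_notMem ?_
  rintro y ⟨x, hx, hI, hn, h, -⟩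
  obtain ⟨c, -, hc⟩ := (isNormalAt_iff hp hx).1 hn
  rw [hI, Finset.sum_empty] at hc
  rw [hc, norm_zero] at h
  exact lt_irrefl _ h

/-! ### Zones over the faces -/

/-- The directions pointing from `p i` into the relative interior of the `i`-th face. -/
def openLens (p : Fin 3 → E3) (i : Fin 3) : Set E3 :=
  {u | p i + u ∈ trihedron p ∧ activeSet p (p i + u) = {i}}

theorem openLens_eq (p : Fin 3 → E3) (i : Fin 3) :
    openLens p i = (fun u => p i + u) ⁻¹' (face p i \ ⋃ j ∈ ({i}ᶜ : Set (Fin 3)), edge p i j) := by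
  ext u
  simp only [openLens, Set.mem_ofPred_eq, Set.mem_preimage, Set.mem_sdiff, face, Set.mem_inter_iff,
    mem_sphere_iff_norm, Set.mem_iUnion, Set.mem_compl_iff, Set.mem_singleton_iff, not_exists,
    mem_edge, Finset.ext_iff, mem_activeSet, Finset.mem_singleton]
  constructor
  · rintro ⟨h1, h2⟩
    exact ⟨⟨h1, (h2 i).2 rfl⟩, fun j hj h3 => hj ((h2 j).1 h3.2.2)⟩
  · rintro ⟨⟨h1, h2⟩, h3⟩
    refine ⟨h1, fun j => ⟨fun hj => ?_, fun hj => hj ▸ h2⟩⟩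
    by_contra hji
    exact h3 j hji ⟨mem_trihedron.1 h1, h2, hj⟩

theorem measurableSet_face (p : Fin 3 → E3) (i : Fin 3) : MeasurableSet (face p i) :=
  (measurableSet_trihedron p).inter Metric.isClosed_sphere.measurableSet

theorem measurableSet_openLens (p : Fin 3 → E3) (i : Fin 3) : MeasurableSet (openLens p i) := by
  rw [openLens_eq]
  refine ((measurableSet_face p i).diff (MeasurableSet.biUnion (Set.to_countable _) fun j _ =>
    (measurableSet_face p i).inter (measurableSet_face p j))).preimage (by fun_prop)

theorem norm_of_mem_openLens {p : Fin 3 → E3} {i : Fin 3} {u : E3} (hu : u ∈ openLens p i) :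
    ‖u‖ = 1 := by
  have : i ∈ activeSet p (p i + u) := by rw [hu.2]; exact Finset.mem_singleton_self i
  rwa [mem_activeSet, add_sub_cancel_left] at this

theorem volume_solidCone_openLens {p : Fin 3 → E3}
    (hp : ∀ i j : Fin 3, i ≠ j → dist (p i) (p j) = 1) (i : Fin 3) :
    volume (solidCone (openLens p i)) = ENNReal.ofReal (2 * (Real.pi - 2 * arcsec 3) / 3) := by
  have h1 : (Measure.euclideanHausdorffMeasure 2 : Measure E3) (openLens p i) =
      ENNReal.ofReal (2 * (Real.pi - 2 * arcsec 3)) := by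
    rw [openLens_eq, (isometry_add_left (p i)).euclideanHausdorffMeasure_preimage,
      (add_left_surjective (p i)).range_eq, Set.inter_univ, measure_sdiff_null, hausdorff_face hp]
    refine (measure_biUnion_null_iff (Set.to_countable _)).2 fun j hj => ?_
    exact hausdorff_circularArc (isCircularArc_edge hp (Ne.symm hj))
  rw [euclideanHausdorffMeasure_eq_solidCone (measurableSet_openLens p i)
    fun x hx => norm_of_mem_openLens hx] at h1
  have h3 : (3 : ℝ≥0∞) ≠ 0 := by norm_num
  rw [ENNReal.ofReal_div_of_pos (by norm_num), ← h1, ENNReal.ofReal_ofNat, mul_comm,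
    ENNReal.mul_div_cancel_right h3 (by norm_num)]

/-- Inside a face the only normals are the nonnegative multiples of x - p i, so the zone is radial
about `p i`, at distances between 1 and 1 + r. -/
theorem zone_singleton {p : Fin 3 → E3} (hp : ∀ i j : Fin 3, i ≠ j → dist (p i) (p j) = 1)
    (i : Fin 3) (r : ℝ) : zone p {i} r = (fun y => y + -p i) ⁻¹'
      {z | (1 < ‖z‖ ∧ ‖z‖ ≤ 1 + r) ∧ ‖z‖⁻¹ • z ∈ openLens p i} := by
  ext y
  simp only [Set.mem_preimage, Set.mem_ofPred_eq, ← sub_eq_add_neg]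
  constructor
  · rintro ⟨x, hx, hI, hn, h0, h1⟩
    obtain ⟨c, hc, hyx⟩ := (isNormalAt_iff hp hx).1 hn
    have hi : i ∈ activeSet p x := by rw [hI]; exact Finset.mem_singleton_self i
    have hci := hc i hi
    rw [hI, Finset.sum_singleton] at hyx
    rw [mem_activeSet] at hi
    rw [hyx, norm_smul, hi, mul_one, Real.norm_of_nonneg hci] at h0 h1
    have e : y - p i = (1 + c i) • (x - p i) := by
      rw [← sub_add_sub_cancel y x (p i), hyx]; module
    have hz : ‖y - p i‖ = 1 + c i := by
      rw [e, norm_smul, hi, mul_one, Real.norm_of_nonneg (by linarith)]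
    refine ⟨⟨by linarith, by linarith⟩, ?_⟩
    rw [e, normalize_smul (by linarith), hi, inv_one, one_smul, openLens, Set.mem_ofPred_eq,
      add_sub_cancel]
    exact ⟨hx, hI⟩
  · rintro ⟨⟨h1, h2⟩, h3⟩
    set u := ‖y - p i‖⁻¹ • (y - p i) with hu
    have hu1 := norm_of_mem_openLens h3
    have e : y - p i = ‖y - p i‖ • u := by
      rw [hu, smul_smul, mul_inv_cancel₀ (by linarith), one_smul]
    have e2 : y - (p i + u) = (‖y - p i‖ - 1) • u := by
      rw [sub_smul, ← e]; module
    refine ⟨p i + u, h3.1, h3.2, (isNormalAt_iff hp h3.1).2 ⟨fun _ => ‖y - p i‖ - 1,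
      fun _ _ => by linarith, ?_⟩, ?_⟩
    · rw [h3.2, Finset.sum_singleton, add_sub_cancel_left, e2]
    · rw [e2, norm_smul, hu1, mul_one, Real.norm_of_nonneg (by linarith)]
      exact ⟨by linarith, by linarith⟩

theorem shell_eq {S : Set E3} {r : ℝ} (hr : 0 < r) :
    {z : E3 | (1 < ‖z‖ ∧ ‖z‖ ≤ 1 + r) ∧ ‖z‖⁻¹ • z ∈ S} =
      ((1 + r) • solidCone S) \ solidCone S := by
  have hr1 : 0 < 1 + r := by linarith
  ext z
  simp only [Set.mem_sdiff, Set.mem_smul_set_iff_inv_smul_mem₀ hr1.ne', solidCone, Set.mem_ofPred_eq,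
    normalize_smul (inv_pos.2 hr1)]
  simp only [norm_smul (1 + r)⁻¹ z, norm_inv, Real.norm_of_nonneg hr1.le]
  have e : (1 + r)⁻¹ * ‖z‖ ≤ 1 ↔ ‖z‖ ≤ 1 + r := by
    rw [inv_mul_le_iff₀ hr1, mul_one]
  rw [e]
  constructor
  · rintro ⟨⟨h1, h2⟩, h3⟩
    exact ⟨⟨⟨by positivity, h2⟩, h3⟩, fun h => absurd h.1.2 (not_le.2 h1)⟩
  · rintro ⟨⟨⟨h1, h2⟩, h3⟩, h4⟩
    have h0 : 0 < ‖z‖ := by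
      have := mul_pos hr1 h1
      rwa [← mul_assoc, mul_inv_cancel₀ hr1.ne', one_mul] at this
    exact ⟨⟨not_le.1 fun h => h4 ⟨⟨h0, h⟩, h3⟩, h2⟩, h3⟩

theorem measurableSet_zone_singleton {p : Fin 3 → E3}
    (hp : ∀ i j : Fin 3, i ≠ j → dist (p i) (p j) = 1) (i : Fin 3) {r : ℝ} (hr : 0 < r) :
    MeasurableSet (zone p {i} r) := by
  rw [zone_singleton hp, shell_eq hr]
  have h := measurableSet_solidCone (measurableSet_openLens p i)
  exact ((h.const_smul₀ (1 + r)).diff h).preimage (by fun_prop)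

theorem volume_zone_singleton {p : Fin 3 → E3}
    (hp : ∀ i j : Fin 3, i ≠ j → dist (p i) (p j) = 1) (i : Fin 3) {r : ℝ} (hr : 0 < r) :
    volume (zone p {i} r) =
      ENNReal.ofReal (2 * (Real.pi - 2 * arcsec 3) / 3 * ((1 + r) ^ 3 - 1)) := by
  have h := measurableSet_solidCone (measurableSet_openLens p i)
  have hsub : solidCone (openLens p i) ⊆ (1 + r) • solidCone (openLens p i) := by
    intro z hz
    have hr1 : 0 < 1 + r := by linarith
    rw [Set.mem_smul_set_iff_inv_smul_mem₀ hr1.ne']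
    refine ⟨?_, ?_⟩
    · rw [norm_smul, norm_inv, Real.norm_of_nonneg hr1.le, inv_mul_le_iff₀ hr1]
      exact ⟨mul_pos (inv_pos.2 hr1) hz.1.1, by linarith [hz.1.2]⟩
    · rw [normalize_smul (inv_pos.2 hr1)]; exact hz.2
  have hα := arcsec_three_bounds
  have hπ := Real.pi_gt_d2
  norm_num at hα hπ
  rw [zone_singleton hp, measure_preimage_add_right, shell_eq hr,
    measure_sdiff hsub h.nullMeasurableSet (by rw [volume_solidCone_openLens hp]; simp),
    Measure.addHaar_smul, finrank_euclideanSpace_fin, abs_of_pos (by positivity),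
    volume_solidCone_openLens hp, ← ENNReal.ofReal_mul (by positivity), ← ENNReal.ofReal_sub]
  · congr 1; ring
  · linarith

/-! ### Zones over the vertices -/

theorem isClosed_isNormalAt (K : Set E3) (x : E3) : IsClosed {n | IsNormalAt K x n} := by
  simp only [IsNormalAt, Set.ofPred_forall]
  exact isClosed_biInter fun k _ => isClosed_le (by fun_prop) continuous_const

/-- The part of the normal cone at `x` of norm at most one. -/
def normalCone (K : Set E3) (x : E3) : Set E3 := {n | IsNormalAt K x n ∧ 0 < ‖n‖ ∧ ‖n‖ ≤ 1}

theorem measurableSet_normalCone (K : Set E3) (x : E3) : MeasurableSet (normalCone K x) := by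
  refine (isClosed_isNormalAt K x).measurableSet.inter ?_
  exact (measurableSet_lt measurable_const measurable_norm).inter
    (measurableSet_le measurable_norm measurable_const)

/-- The vertices of the solid: the points lying on all three spheres. -/
def vertices (p : Fin 3 → E3) : Set E3 := {x | x ∈ trihedron p ∧ activeSet p x = Finset.univ}

theorem finite_vertices {p : Fin 3 → E3} (hp : ∀ i j : Fin 3, i ≠ j → dist (p i) (p j) = 1) :
    (vertices p).Finite := by
  obtain ⟨B, h0, h1, h2⟩ := exists_edge_frame hp (i := 0) (j := 1) (k := 2) (by decide) (by decide)
    (by decide)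
  set m := midpoint ℝ (p 0) (p 1)
  have h3 : Real.sqrt 3 ^ 2 = 3 := Real.sq_sqrt (by norm_num)
  refine Set.Finite.subset (Set.toFinite {m + ofCoords B (0, Real.sqrt 3 / 6, Real.sqrt (2 / 3)),
    m + ofCoords B (0, Real.sqrt 3 / 6, -Real.sqrt (2 / 3))}) ?_
  rintro x ⟨-, hx⟩
  obtain ⟨s, a, b, hxc⟩ := exists_frame_coords B m x
  have hact : ∀ i, ‖x - p i‖ ^ 2 = 1 := fun i => by
    have : i ∈ activeSet p x := by rw [hx]; exact Finset.mem_univ i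
    rw [mem_activeSet.1 this, one_pow]
  have e0 := hact 0
  have e1 := hact 1
  have e2 := hact 2
  rw [h0, hxc, norm_sq_frame] at e0
  rw [h1, hxc, norm_sq_frame] at e1
  rw [h2, hxc, norm_sq_frame] at e2
  have hs : s = 0 := by linarith
  subst hs
  have ha : a = Real.sqrt 3 / 6 := by
    have : Real.sqrt 3 * a = 1 / 2 := by nlinarith
    have h5 : Real.sqrt 3 * (Real.sqrt 3 * a) = 3 * a := by rw [← mul_assoc, ← sq, h3]
    rw [this] at h5
    linarith
  have hb : b ^ 2 = Real.sqrt (2 / 3) ^ 2 := by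
    rw [Real.sq_sqrt (by norm_num)]
    have : a ^ 2 = 3 / 36 := by rw [ha, div_pow, h3]; norm_num
    linarith
  rcases sq_eq_sq_iff_eq_or_eq_neg.1 hb with h | h
  · exact .inl (by rw [hxc, ha, h])
  · exact .inr (by rw [Set.mem_singleton_iff, hxc, ha, h])

theorem zone_univ {p : Fin 3 → E3} {r : ℝ} (hr : 0 < r) :
    zone p Finset.univ r =
      ⋃ x ∈ vertices p, (fun y => y + -x) ⁻¹' (r • normalCone (trihedron p) x) := by
  ext y
  simp only [zone, vertices, Set.mem_ofPred_eq, Set.mem_iUnion, Set.mem_preimage, ← sub_eq_add_neg,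
    Set.mem_smul_set_iff_inv_smul_mem₀ hr.ne', normalCone, exists_prop]
  refine exists_congr fun x => ?_
  rw [← and_assoc]
  refine and_congr_right fun hx => and_congr ?_ ?_
  · simp only [IsNormalAt, inner_smul_left, conj_trivial]
    refine forall₂_congr fun k hk => ?_
    constructor
    · intro h
      exact mul_nonpos_of_nonneg_of_nonpos (inv_nonneg.2 hr.le) h
    · intro h
      exact nonpos_of_mul_nonpos_right h (inv_pos.2 hr)
  · rw [norm_smul, norm_inv, Real.norm_of_nonneg hr.le, inv_mul_le_iff₀ hr, mul_one]
    refine and_congr_left fun _ => ?_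
    constructor
    · intro h; exact mul_pos (inv_pos.2 hr) h
    · intro h; exact pos_of_mul_pos_right h (inv_nonneg.2 hr.le)

theorem measurableSet_zone_univ {p : Fin 3 → E3}
    (hp : ∀ i j : Fin 3, i ≠ j → dist (p i) (p j) = 1) {r : ℝ} (hr : 0 < r) :
    MeasurableSet (zone p Finset.univ r) := by
  rw [zone_univ hr]
  exact MeasurableSet.biUnion (finite_vertices hp).countable fun x _ =>
    ((measurableSet_normalCone _ x).const_smul₀ r).preimage (by fun_prop)

/-- The zone is a finite disjoint union of translates of truncated normal cones scaled by r. Its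
coefficient can stay unspecified, because the mean width depends on the r² term alone. -/
theorem exists_volume_zone_univ {p : Fin 3 → E3}
    (hp : ∀ i j : Fin 3, i ≠ j → dist (p i) (p j) = 1) :
    ∃ c : ℝ, 0 ≤ c ∧ ∀ r, 0 < r → volume (zone p Finset.univ r) = ENNReal.ofReal (c * r ^ 3) := by
  set C : ℝ≥0∞ := ∑ x ∈ (finite_vertices hp).toFinset, volume (normalCone (trihedron p) x) with hC
  have hCtop : C ≠ ⊤ := by
    refine ENNReal.sum_ne_top.2 fun x _ => ?_
    refine ((Metric.isBounded_closedBall (x := (0 : E3)) (r := 1)).subset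
      fun n hn => ?_).measure_lt_top.ne
    exact mem_closedBall_zero_iff.2 hn.2.2
  refine ⟨C.toReal, ENNReal.toReal_nonneg, fun r hr => ?_⟩
  have hd : (vertices p).PairwiseDisjoint
      fun x => (fun y => y + -x) ⁻¹' (r • normalCone (trihedron p) x) := by
    intro x hx x' hx' hne
    refine Set.disjoint_left.2 fun y hy hy' => hne ?_
    have hnormal : ∀ z, y + -z ∈ r • normalCone (trihedron p) z →
        IsNormalAt (trihedron p) z (y - z) := by
      rintro z ⟨n, hn, hnz⟩ k hk
      rw [sub_eq_add_neg, ← hnz]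
      simp only [inner_smul_left, conj_trivial]
      exact mul_nonpos_of_nonneg_of_nonpos hr.le (hn.1 k hk)
    exact (hnormal x hy).eq_of_sub hx.1 hx'.1 (hnormal x' hy')
  have hU : (⋃ x ∈ vertices p, (fun y => y + -x) ⁻¹' (r • normalCone (trihedron p) x)) =
      ⋃ x ∈ (finite_vertices hp).toFinset,
        (fun y => y + -x) ⁻¹' (r • normalCone (trihedron p) x) := by simp
  rw [zone_univ hr, hU, measure_biUnion_finset (by simpa using hd) fun x _ =>
    ((measurableSet_normalCone _ x).const_smul₀ r).preimage (by fun_prop)]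
  simp_rw [measure_preimage_add_right, Measure.addHaar_smul, finrank_euclideanSpace_fin]
  rw [← Finset.mul_sum, ← hC, abs_of_pos (by positivity), mul_comm C.toReal,
    ENNReal.ofReal_mul (by positivity), ENNReal.ofReal_toReal hCtop]

/-! ### Zones over the edges -/

theorem ofCoords_injective (B : OrthonormalBasis (Fin 3) ℝ E3) :
    Function.Injective (ofCoords B) := by
  rintro ⟨s, a, b⟩ ⟨s', a', b'⟩ h
  have h0 := congrArg (fun y => inner ℝ y (B 0)) h
  have h1 := congrArg (fun y => inner ℝ y (B 1)) h
  have h2 := congrArg (fun y => inner ℝ y (B 2)) h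
  simp only [inner_ofCoords_zero, inner_ofCoords_one, inner_ofCoords_two] at h0 h1 h2
  rw [h0, h1, h2]

/-- The cross section of the zone over an edge by a half-plane orthogonal to that edge: a circular
sector of radius `r` and angle `π / 3`. -/
def edgeSector (r : ℝ) : Set (ℝ × ℝ) :=
  {q | |q.2| * Real.sqrt 3 ≤ q.1 ∧ 0 < q.1 ^ 2 + q.2 ^ 2 ∧ q.1 ^ 2 + q.2 ^ 2 ≤ r ^ 2}

theorem measurableSet_edgeSector (r : ℝ) : MeasurableSet (edgeSector r) := by
  have h1 : Measurable fun q : ℝ × ℝ => q.1 ^ 2 + q.2 ^ 2 := by fun_prop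
  have h2 : Measurable fun q : ℝ × ℝ => |q.2| * Real.sqrt 3 :=
    (by fun_prop : Continuous fun q : ℝ × ℝ => |q.2| * Real.sqrt 3).measurable
  exact (measurableSet_le h2 measurable_fst).inter
    ((measurableSet_lt measurable_const h1).inter (measurableSet_le h1 measurable_const))

/-- The foot of (s, a, b) is (0, a', b') on the edge circle, with (a', b') on the ray of (a, b).
Normals there are combinations of the two active ones; nonnegativity of both weights is the
condition |s|√3 ≤ √(a² + b²) - √3/2. The strict bound on `a` keeps the foot in the interior of the
third ball, hence away from the vertices. -/
theorem mem_zone_pair {p : Fin 3 → E3} (hp : ∀ i j : Fin 3, i ≠ j → dist (p i) (p j) = 1)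
    {i j k : Fin 3} (hij : i ≠ j) (hik : i ≠ k) (hjk : j ≠ k)
    (hall : ∀ l, l = i ∨ l = j ∨ l = k) {B : OrthonormalBasis (Fin 3) ℝ E3} {m : E3}
    (hi : p i = m + ofCoords B (-(1 / 2), 0, 0)) (hj : p j = m + ofCoords B (1 / 2, 0, 0))
    (hk : p k = m + ofCoords B (0, Real.sqrt 3 / 2, 0)) {r : ℝ} (hr : 0 < r) (s a b : ℝ) :
    m + ofCoords B (s, a, b) ∈ zone p {i, j} r ↔
      (Real.sqrt (a ^ 2 + b ^ 2) - Real.sqrt 3 / 2, s) ∈ edgeSector r ∧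
        Real.sqrt (a ^ 2 + b ^ 2) / 3 < a := by
  have h3 : Real.sqrt 3 ^ 2 = 3 := Real.sq_sqrt (by norm_num)
  have h3p : 0 < Real.sqrt 3 := by positivity
  have hsq : ∀ z : E3, ‖z‖ = 1 ↔ ‖z‖ ^ 2 = 1 := fun z =>
    (pow_eq_one_iff_of_nonneg (norm_nonneg z) two_ne_zero).symm
  have hdiff : ∀ x : E3, ∀ c : Fin 3 → ℝ, ∑ l ∈ ({i, j} : Finset (Fin 3)), c l • (x - p l) =
      c i • (x - p i) + c j • (x - p j) := fun x c => Finset.sum_pair hij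
  have hcomb : ∀ a' b' ci cj : ℝ, m + ofCoords B (0, a', b') +
      (ci • (m + ofCoords B (0, a', b') - p i) + cj • (m + ofCoords B (0, a', b') - p j)) =
      m + ofCoords B ((ci - cj) / 2, (1 + ci + cj) * a', (1 + ci + cj) * b') := by
    intro a' b' ci cj
    rw [hi, hj, add_sub_add_left_eq_sub, add_sub_add_left_eq_sub]
    simp only [ofCoords]; module
  simp only [edgeSector, Set.mem_ofPred_eq]
  constructor
  · rintro ⟨x, hx, hI, hn, h0, h1⟩
    obtain ⟨c, hc, hyx⟩ := (isNormalAt_iff hp hx).1 hn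
    rw [hI] at hc hyx
    rw [hdiff] at hyx
    have hci := hc i (by simp)
    have hcj := hc j (by simp)
    have hi1 : i ∈ activeSet p x := by rw [hI]; simp
    have hj1 : j ∈ activeSet p x := by rw [hI]; simp
    have hk1 : k ∉ activeSet p x := by rw [hI]; simp [hik.symm, hjk.symm]
    rw [mem_activeSet] at hi1 hj1 hk1
    have hk2 : ‖x - p k‖ ^ 2 < 1 := by
      rw [sq_lt_one_iff₀ (norm_nonneg _)]
      exact lt_of_le_of_ne (mem_trihedron.1 hx k) hk1
    obtain ⟨s', a', b', hxc⟩ := exists_frame_coords B m x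
    rw [hi, hxc, hsq, norm_sq_frame] at hi1
    rw [hj, hxc, hsq, norm_sq_frame] at hj1
    rw [hk, hxc, norm_sq_frame] at hk2
    have hs : s' = 0 := by linarith
    subst hs
    have hy := hcomb a' b' (c i) (c j)
    rw [← hxc, ← hyx, add_sub_cancel] at hy
    have hy2 := ofCoords_injective B (add_left_cancel hy)
    simp only [Prod.mk.injEq] at hy2
    obtain ⟨rfl, rfl, rfl⟩ := hy2
    set d := c i + c j with hd
    have hd0 : 0 ≤ d := add_nonneg hci hcj
    have hρ : Real.sqrt (((1 + c i + c j) * a') ^ 2 + ((1 + c i + c j) * b') ^ 2) =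
        (1 + d) * (Real.sqrt 3 / 2) := by
      rw [Real.sqrt_eq_iff_mul_self_eq (by positivity) (by positivity)]
      have : (Real.sqrt 3 / 2) * (Real.sqrt 3 / 2) = a' ^ 2 + b' ^ 2 := by nlinarith
      rw [hd]
      linear_combination -(1 + c i + c j) ^ 2 * this
    have hnorm : ‖m + ofCoords B ((c i - c j) / 2, (1 + c i + c j) * a', (1 + c i + c j) * b') - x‖
        ^ 2 = ((1 + d) * (Real.sqrt 3 / 2) - Real.sqrt 3 / 2) ^ 2 + ((c i - c j) / 2) ^ 2 := by
      rw [hxc, norm_sq_frame, hd]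
      linear_combination (c i + c j) ^ 2 * (hi1 - h3 / 4)
    rw [hρ, ← hnorm]
    refine ⟨⟨?_, by positivity, by gcongr⟩, ?_⟩
    · rw [abs_div, abs_two]
      have : |c i - c j| ≤ d := abs_le.2 ⟨by linarith, by linarith⟩
      nlinarith
    · have h5 : Real.sqrt 3 / 6 < a' := by
        have h6 : 1 / 2 < Real.sqrt 3 * a' := by nlinarith
        by_contra h7
        have := mul_le_mul_of_nonneg_left (not_lt.1 h7) h3p.le
        nlinarith
      have := mul_lt_mul_of_pos_left h5 (by linarith : 0 < 1 + c i + c j)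
      rw [hd]
      linarith
  · set ρ := Real.sqrt (a ^ 2 + b ^ 2) with hρ
    rintro ⟨⟨h1, h2, h4⟩, h5⟩
    have hw : Real.sqrt 3 / 2 ≤ ρ := by
      have : 0 ≤ |s| * Real.sqrt 3 := by positivity
      linarith
    have hρ0 : 0 < ρ := by linarith
    have hab : a ^ 2 + b ^ 2 = ρ ^ 2 := (Real.sq_sqrt (by positivity)).symm
    set a' := Real.sqrt 3 / 2 * (a / ρ) with ha'
    set b' := Real.sqrt 3 / 2 * (b / ρ) with hb'
    have hab' : a' ^ 2 + b' ^ 2 = 3 / 4 := by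
      have : (a / ρ) ^ 2 + (b / ρ) ^ 2 = 1 := by
        rw [div_pow, div_pow, ← add_div, hab, div_self (by positivity)]
      rw [ha', hb']
      linear_combination 3 / 4 * this + h3 / 4 * ((a / ρ) ^ 2 + (b / ρ) ^ 2)
    have ha6 : Real.sqrt 3 / 6 < a' := by
      have : 1 / 3 < a / ρ := by rw [lt_div_iff₀ hρ0]; linarith
      have := mul_lt_mul_of_pos_left this h3p
      rw [ha']; linarith
    have hi1 : ‖m + ofCoords B (0, a', b') - p i‖ = 1 := by
      rw [hi, hsq, norm_sq_frame]; linarith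
    have hj1 : ‖m + ofCoords B (0, a', b') - p j‖ = 1 := by
      rw [hj, hsq, norm_sq_frame]; linarith
    have hk1 : ‖m + ofCoords B (0, a', b') - p k‖ < 1 := by
      rw [hk, ← sq_lt_one_iff₀ (norm_nonneg _), norm_sq_frame]
      nlinarith [mul_lt_mul_of_pos_left ha6 h3p]
    have hx : m + ofCoords B (0, a', b') ∈ trihedron p := by
      refine mem_trihedron.2 fun l => ?_
      rcases hall l with rfl | rfl | rfl
      exacts [hi1.le, hj1.le, hk1.le]
    have hI : activeSet p (m + ofCoords B (0, a', b')) = {i, j} := by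
      ext l
      rw [mem_activeSet, Finset.mem_insert, Finset.mem_singleton]
      constructor
      · intro hl
        rcases hall l with h | h | h
        · exact .inl h
        · exact .inr h
        · rw [h] at hl; exact absurd hl hk1.ne
      · rintro (rfl | rfl)
        exacts [hi1, hj1]
    obtain ⟨h6, h7⟩ := abs_le.1 ((le_div_iff₀ h3p).2 h1)
    -- `e` is the mean of the two weights, read off from the radial displacement; the axial
    -- displacement `s` is half their difference, so the weights are e + s and e - s.
    set e := (ρ - Real.sqrt 3 / 2) / Real.sqrt 3 with he
    have hfac : (1 + 2 * e) * (Real.sqrt 3 / 2) = ρ := by rw [he]; field_simp; ring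
    have hea : (1 + 2 * e) * a' = a := by
      rw [ha', ← mul_assoc, hfac]; field_simp
    have heb : (1 + 2 * e) * b' = b := by
      rw [hb', ← mul_assoc, hfac]; field_simp
    set c : Fin 3 → ℝ := fun l => if l = i then e + s else e - s with hc
    have hcc : c i = e + s := by simp [hc]
    have hcj : c j = e - s := by simp [hc, hij.symm]
    have hy := hcomb a' b' (e + s) (e - s)
    rw [show (e + s - (e - s)) / 2 = s by ring, show 1 + (e + s) + (e - s) = 1 + 2 * e by ring, hea,
      heb] at hy
    have hnorm : ‖m + ofCoords B (s, a, b) - (m + ofCoords B (0, a', b'))‖ ^ 2 =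
        (ρ - Real.sqrt 3 / 2) ^ 2 + s ^ 2 := by
      rw [norm_sq_frame, ← hea, ← heb, ← hfac]
      linear_combination 4 * e ^ 2 * hab' - e ^ 2 * h3
    refine ⟨_, hx, hI, (isNormalAt_iff hp hx).2 ⟨c, ?_, ?_⟩, ?_, ?_⟩
    · intro l hl
      rw [hI, Finset.mem_insert, Finset.mem_singleton] at hl
      rcases hl with rfl | rfl
      · rw [hcc]; linarith
      · rw [hcj]; linarith
    · rw [hI, hdiff, hcc, hcj, ← hy, add_sub_cancel_left]
    · rw [← hnorm] at h2
      exact (norm_nonneg _).lt_of_ne' fun h => by rw [h] at h2; norm_num at h2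
    · rw [← hnorm] at h4
      exact (pow_le_pow_iff_left₀ (norm_nonneg _) hr.le two_ne_zero).1 h4

/-- Membership in `Q` is tested only for angles in the open interval (-π, π), since the slit omitted
by `polarCoord` is null. -/
theorem setLIntegral_polar {Q : Set (ℝ × ℝ)} {A Θ : Set ℝ} {f : ℝ × ℝ → ℝ≥0∞} (hf : Measurable f)
    (hQ : MeasurableSet Q) (hA : MeasurableSet A) (hΘ : MeasurableSet Θ) (hA0 : A ⊆ Set.Ioi 0)
    (hΘπ : Θ ⊆ Set.Ioo (-Real.pi) Real.pi)
    (h : ∀ ρ > 0, ∀ t ∈ Set.Ioo (-Real.pi) Real.pi,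
      (ρ * Real.cos t, ρ * Real.sin t) ∈ Q ↔ ρ ∈ A ∧ t ∈ Θ) :
    ∫⁻ q in Q, f q = ∫⁻ ρ in A, ∫⁻ t in Θ,
      ENNReal.ofReal ρ * f (ρ * Real.cos t, ρ * Real.sin t) := by
  have hm : Measurable fun q : ℝ × ℝ =>
      ENNReal.ofReal q.1 * f (q.1 * Real.cos q.2, q.1 * Real.sin q.2) :=
    (by fun_prop : Measurable fun q : ℝ × ℝ => ENNReal.ofReal q.1).mul
      (hf.comp (by fun_prop : Measurable fun q : ℝ × ℝ =>
        (q.1 * Real.cos q.2, q.1 * Real.sin q.2)))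
  have htarget : MeasurableSet polarCoord.target := polarCoord.open_target.measurableSet
  have hsub : A ×ˢ Θ ⊆ polarCoord.target := Set.prod_mono hA0 hΘπ
  rw [← lintegral_indicator hQ, ← lintegral_comp_polarCoord_symm, ← lintegral_indicator htarget]
  have e : polarCoord.target.indicator (fun q : ℝ × ℝ => ENNReal.ofReal q.1 •
      Q.indicator f (polarCoord.symm q)) = (A ×ˢ Θ).indicator fun q : ℝ × ℝ =>
      ENNReal.ofReal q.1 * f (q.1 * Real.cos q.2, q.1 * Real.sin q.2) := by
    ext ⟨ρ, t⟩
    by_cases hq : (ρ, t) ∈ polarCoord.target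
    · rw [Set.indicator_of_mem hq]
      have hiff := h ρ hq.1 t hq.2
      rw [show polarCoord.symm (ρ, t) = (ρ * Real.cos t, ρ * Real.sin t) from rfl]
      by_cases hq2 : (ρ, t) ∈ A ×ˢ Θ
      · rw [Set.indicator_of_mem hq2, Set.indicator_of_mem (hiff.2 hq2)]
        rfl
      · rw [Set.indicator_of_notMem hq2, Set.indicator_of_notMem fun h' => hq2 (hiff.1 h'),
          smul_zero]
    · rw [Set.indicator_of_notMem hq, Set.indicator_of_notMem fun h' => hq (hsub h')]
  rw [e, lintegral_indicator (hA.prod hΘ), Measure.volume_eq_prod, ← Measure.prod_restrict,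
    lintegral_prod _ hm.aemeasurable]

theorem lintegral_edgeSector {r : ℝ} (hr : 0 < r) {h : ℝ} (hh : 0 ≤ h) :
    ∫⁻ q in edgeSector r, ENNReal.ofReal (q.1 + h) =
      ENNReal.ofReal (r ^ 3 / 3 + h * Real.pi / 6 * r ^ 2) := by
  have h3 : Real.sqrt 3 ^ 2 = 3 := Real.sq_sqrt (by norm_num)
  have h3p : 0 < Real.sqrt 3 := by positivity
  have hπ := Real.pi_pos
  rw [setLIntegral_polar (A := Set.Ioc 0 r) (Θ := Set.Icc (-(Real.pi / 6)) (Real.pi / 6))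
    (by fun_prop) (measurableSet_edgeSector r) measurableSet_Ioc measurableSet_Icc
    (fun _ h => h.1) (fun _ h => ⟨by linarith [h.1], by linarith [h.2]⟩)]
  · have hinner : ∀ ρ ∈ Set.Ioc 0 r, ∫⁻ t in Set.Icc (-(Real.pi / 6)) (Real.pi / 6),
        ENNReal.ofReal ρ * ENNReal.ofReal (ρ * Real.cos t + h) =
        ENNReal.ofReal (ρ ^ 2 + h * Real.pi / 3 * ρ) := by
      intro ρ hρ
      have hρ0 : 0 < ρ := hρ.1
      simp_rw [← ENNReal.ofReal_mul hρ0.le]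
      rw [lintegral_Icc_ofReal_eq_sub (F := fun t => ρ * (ρ * Real.sin t + h * t)) (by linarith)
        (by fun_prop) ?_ (by fun_prop) ?_]
      · congr 1
        rw [Real.sin_neg, Real.sin_pi_div_six]; ring
      · intro t ht
        have := Real.cos_nonneg_of_mem_Icc (x := t) ⟨by linarith [ht.1], by linarith [ht.2]⟩
        positivity
      · intro t _
        have := (((Real.hasDerivAt_sin t).const_mul ρ).add ((hasDerivAt_id t).const_mul h)).const_mul ρ
        simpa using this
    rw [setLIntegral_congr_fun measurableSet_Ioc hinner, setLIntegral_congr Ioc_ae_eq_Icc,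
      lintegral_Icc_ofReal_eq_sub (F := fun ρ => ρ ^ 3 / 3 + h * Real.pi / 6 * ρ ^ 2) hr.le
        (by fun_prop) ?_ (by fun_prop) ?_]
    · congr 1; ring
    · intro ρ hρ
      have := hρ.1
      positivity
    · intro ρ _
      have := ((hasDerivAt_pow 3 ρ).div_const 3).add
        ((hasDerivAt_pow 2 ρ).const_mul (h * Real.pi / 6))
      refine this.congr_deriv ?_
      norm_num
      ring
  · intro ρ hρ t ht
    have hcs := Real.sin_sq_add_cos_sq t
    have hsq : (ρ * Real.cos t) ^ 2 + (ρ * Real.sin t) ^ 2 = ρ ^ 2 := by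
      linear_combination ρ ^ 2 * hcs
    have habs : |Real.sin t| ^ 2 = Real.sin t ^ 2 := sq_abs _
    have hcos : |ρ * Real.sin t| * Real.sqrt 3 ≤ ρ * Real.cos t ↔
        t ∈ Set.Icc (-(Real.pi / 6)) (Real.pi / 6) := by
      rw [abs_mul, abs_of_pos hρ, mul_assoc, mul_le_mul_iff_right₀ hρ, Set.mem_Icc, ← abs_le]
      have h1 : |Real.sin t| * Real.sqrt 3 ≤ Real.cos t ↔ Real.sqrt 3 / 2 ≤ Real.cos t := by
        constructor
        · intro h1
          have h0 : 0 ≤ |Real.sin t| * Real.sqrt 3 := by positivity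
          have h2 := pow_le_pow_left₀ h0 h1 2
          rw [mul_pow, habs, h3] at h2
          refine abs_le_of_sq_le_sq' ?_ (h0.trans h1) |>.2
          rw [div_pow, h3]; linarith
        · intro h1
          have h2 := pow_le_pow_left₀ (by positivity) h1 2
          rw [div_pow, h3] at h2
          refine abs_le_of_sq_le_sq' ?_ (le_trans (by positivity) h1) |>.2
          rw [mul_pow, habs, h3]; linarith
      rw [h1, ← Real.cos_pi_div_six, ← Real.cos_abs t]
      exact Real.strictAntiOn_cos.le_iff_ge ⟨by linarith, by linarith⟩
        ⟨abs_nonneg _, (abs_lt.2 ht).le⟩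
    simp only [edgeSector, Set.mem_ofPred_eq, hsq, hcos, pow_le_pow_iff_left₀ hρ.le hr.le two_ne_zero,
      (iff_of_true (pow_pos hρ 2) hρ : 0 < ρ ^ 2 ↔ 0 < ρ), Set.mem_Ioc]
    tauto

theorem volume_angular_sector {A : Set ℝ} (hA : MeasurableSet A) (hA0 : A ⊆ Set.Ioi 0) :
    volume {w : ℝ × ℝ | Real.sqrt (w.1 ^ 2 + w.2 ^ 2) ∈ A ∧ Real.sqrt (w.1 ^ 2 + w.2 ^ 2) / 3 < w.1} =
      ENNReal.ofReal (2 * arcsec 3) * ∫⁻ ρ in A, ENNReal.ofReal ρ := by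
  have hm : Measurable fun w : ℝ × ℝ => Real.sqrt (w.1 ^ 2 + w.2 ^ 2) := by fun_prop
  have hα := arcsec_three_lt_pi
  have hS : MeasurableSet {w : ℝ × ℝ | Real.sqrt (w.1 ^ 2 + w.2 ^ 2) ∈ A ∧
      Real.sqrt (w.1 ^ 2 + w.2 ^ 2) / 3 < w.1} :=
    (hm hA).inter (measurableSet_lt (hm.div_const 3) measurable_fst)
  rw [← setLIntegral_one, setLIntegral_polar (A := A) (Θ := Set.Ioo (-arcsec 3) (arcsec 3))
    measurable_const hS hA
    measurableSet_Ioo hA0 (Set.Ioo_subset_Ioo (by linarith) hα.le)]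
  · simp_rw [mul_one, setLIntegral_const, Real.volume_Ioo]
    rw [lintegral_mul_const _ (by fun_prop), mul_comm]
    congr 2; ring
  · intro ρ hρ t ht
    have hs : Real.sqrt ((ρ * Real.cos t) ^ 2 + (ρ * Real.sin t) ^ 2) = ρ := by
      rw [show (ρ * Real.cos t) ^ 2 + (ρ * Real.sin t) ^ 2 = ρ ^ 2 by
        linear_combination ρ ^ 2 * Real.sin_sq_add_cos_sq t, Real.sqrt_sq hρ.le]
    simp only [Set.mem_ofPred_eq, hs]
    refine and_congr_right fun _ => ?_
    rw [div_eq_mul_one_div, mul_lt_mul_iff_right₀ hρ, ← cos_arcsec_three, ← Real.cos_abs t,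
      Set.mem_Ioo, ← abs_lt]
    exact Real.strictAntiOn_cos.lt_iff_gt ⟨arcsec_three_pos.le, hα.le⟩
      ⟨abs_nonneg _, (abs_lt.2 ht).le⟩

theorem zone_pair_eq {p : Fin 3 → E3} (hp : ∀ i j : Fin 3, i ≠ j → dist (p i) (p j) = 1)
    {i j : Fin 3} (hij : i ≠ j) : ∃ (B : OrthonormalBasis (Fin 3) ℝ E3) (m : E3), ∀ r, 0 < r →
      ∀ s a b : ℝ, m + ofCoords B (s, a, b) ∈ zone p {i, j} r ↔
      (Real.sqrt (a ^ 2 + b ^ 2) - Real.sqrt 3 / 2, s) ∈ edgeSector r ∧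
        Real.sqrt (a ^ 2 + b ^ 2) / 3 < a := by
  obtain ⟨k, hik, hjk, hall⟩ := exists_third hij
  obtain ⟨B, hi, hj, hk⟩ := exists_edge_frame hp hij hik hjk
  exact ⟨B, _, fun r hr => mem_zone_pair hp hij hik hjk hall hi hj hk hr⟩

theorem measurableSet_zone_pair {p : Fin 3 → E3}
    (hp : ∀ i j : Fin 3, i ≠ j → dist (p i) (p j) = 1) {i j : Fin 3} (hij : i ≠ j) {r : ℝ}
    (hr : 0 < r) : MeasurableSet (zone p {i, j} r) := by
  obtain ⟨B, m, h⟩ := zone_pair_eq hp hij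
  have e : zone p {i, j} r = (fun y => (inner ℝ (y - m) (B 0), inner ℝ (y - m) (B 1),
      inner ℝ (y - m) (B 2))) ⁻¹' {q : ℝ × ℝ × ℝ |
      (Real.sqrt (q.2.1 ^ 2 + q.2.2 ^ 2) - Real.sqrt 3 / 2, q.1) ∈ edgeSector r ∧
        Real.sqrt (q.2.1 ^ 2 + q.2.2 ^ 2) / 3 < q.2.1} := by
    ext y
    have := h r hr (inner ℝ (y - m) (B 0)) (inner ℝ (y - m) (B 1)) (inner ℝ (y - m) (B 2))
    rwa [ofCoords_inner, add_sub_cancel] at this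
  rw [e]
  have hm : Measurable fun q : ℝ × ℝ × ℝ => Real.sqrt (q.2.1 ^ 2 + q.2.2 ^ 2) := by fun_prop
  exact (((measurableSet_edgeSector r).preimage ((hm.sub_const _).prodMk measurable_fst)).inter
    (measurableSet_lt (hm.div_const 3) (by fun_prop))).preimage (by fun_prop)

/-- Pappus: the sector is swept through the angle 2 arccos(1/3) about the line through the two
centres, so the volume is that angle times the integral over the sector of the distance q.1 + √3/2
to this axis. -/
theorem volume_zone_pair {p : Fin 3 → E3}
    (hp : ∀ i j : Fin 3, i ≠ j → dist (p i) (p j) = 1) {i j : Fin 3} (hij : i ≠ j) {r : ℝ}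
    (hr : 0 < r) : volume (zone p {i, j} r) = ENNReal.ofReal
      (2 * arcsec 3 * (r ^ 3 / 3 + Real.sqrt 3 / 2 * Real.pi / 6 * r ^ 2)) := by
  obtain ⟨B, m, h⟩ := zone_pair_eq hp hij
  have hmeas := (measurableSet_zone_pair hp hij hr).preimage (measurable_const_add m)
  have hW := measurableSet_edgeSector r
  have h3p : 0 < Real.sqrt 3 := by positivity
  have hslice : ∀ s : ℝ, volume {w : ℝ × ℝ | ofCoords B (s, w) ∈ (fun y => m + y) ⁻¹' zone p {i, j} r}
      = ENNReal.ofReal (2 * arcsec 3) * ∫⁻ w, (edgeSector r).indicator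
        (fun q => ENNReal.ofReal (q.1 + Real.sqrt 3 / 2)) (w, s) := by
    intro s
    have hA : MeasurableSet {ρ : ℝ | (ρ - Real.sqrt 3 / 2, s) ∈ edgeSector r} :=
      hW.preimage (by fun_prop)
    rw [← lintegral_sub_right_eq_self _ (Real.sqrt 3 / 2), ← show
      _ = ∫⁻ w, (edgeSector r).indicator (fun q => ENNReal.ofReal (q.1 + Real.sqrt 3 / 2))
        (w - Real.sqrt 3 / 2, s) from (lintegral_indicator hA ENNReal.ofReal).symm.trans ?_,
      ← volume_angular_sector hA]
    · congr 1
      ext ⟨a, b⟩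
      exact h r hr s a b
    · intro ρ hρ
      have : 0 ≤ |s| * Real.sqrt 3 := by positivity
      have := hρ.1
      simp only at this
      exact Set.mem_Ioi.2 (by linarith)
    · refine lintegral_congr fun ρ => ?_
      simp only [Set.indicator, Set.mem_ofPred_eq, sub_add_cancel]
  rw [← measure_preimage_add volume m, volume_eq_coords B hmeas]
  simp_rw [hslice]
  have hf : Measurable ((edgeSector r).indicator
      fun q : ℝ × ℝ => ENNReal.ofReal (q.1 + Real.sqrt 3 / 2)) :=
    Measurable.indicator (by fun_prop) hW
  rw [lintegral_const_mul _ hf.lintegral_prod_left', ← lintegral_prod_symm' _ hf,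
    ← Measure.volume_eq_prod, lintegral_indicator hW, lintegral_edgeSector hr (by positivity),
    ← ENNReal.ofReal_mul (by linarith [arcsec_three_pos])]

/-! ### The Steiner polynomial and the mean width -/

theorem card_cases (I : Finset (Fin 3)) :
    I = ∅ ∨ (∃ i, I = {i}) ∨ (∃ i j, i ≠ j ∧ I = {i, j}) ∨ I = Finset.univ := by
  revert I; decide

/-- The volume added to the outer parallel body by the zones over the faces, the edges and the
vertices. -/
theorem exists_volume_parallelBody {p : Fin 3 → E3}
    (hp : ∀ i j : Fin 3, i ≠ j → dist (p i) (p j) = 1) :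
    ∃ c : ℝ, ∀ r, 0 < r → (volume (parallelBody (trihedron p) r)).toReal =
      (volume (trihedron p)).toReal + (3 * (2 * (Real.pi - 2 * arcsec 3) / 3 * ((1 + r) ^ 3 - 1)) +
        3 * (2 * arcsec 3 * (r ^ 3 / 3 + Real.sqrt 3 / 2 * Real.pi / 6 * r ^ 2)) + c * r ^ 3) := by
  obtain ⟨c, hc, hvertex⟩ := exists_volume_zone_univ hp
  refine ⟨c, fun r hr => ?_⟩
  set v : ℕ → ℝ := fun n => if n = 0 then 0 else
    if n = 1 then 2 * (Real.pi - 2 * arcsec 3) / 3 * ((1 + r) ^ 3 - 1) else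
    if n = 2 then 2 * arcsec 3 * (r ^ 3 / 3 + Real.sqrt 3 / 2 * Real.pi / 6 * r ^ 2) else
    c * r ^ 3 with hv
  have hzone : ∀ I, MeasurableSet (zone p I r) ∧
      volume (zone p I r) = ENNReal.ofReal (v I.card) := by
    intro I
    rcases card_cases I with rfl | ⟨i, rfl⟩ | ⟨i, j, hij, rfl⟩ | rfl
    · rw [zone_empty hp]; simp [hv]
    · refine ⟨measurableSet_zone_singleton hp i hr, ?_⟩
      rw [volume_zone_singleton hp i hr]; simp [hv]
    · refine ⟨measurableSet_zone_pair hp hij hr, ?_⟩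
      rw [volume_zone_pair hp hij hr, Finset.card_pair hij]; simp [hv]
    · refine ⟨measurableSet_zone_univ hp hr, ?_⟩
      rw [hvertex r hr]; simp [hv]
  have hα := arcsec_three_bounds
  have hπ := Real.pi_gt_d2
  norm_num at hα hπ
  have hr3 : 0 ≤ (1 + r) ^ 3 - 1 := by
    have : 1 ≤ (1 + r) ^ 3 := one_le_pow₀ (by linarith)
    linarith
  have hv0 : ∀ n, 0 ≤ v n := by
    intro n
    simp only [hv]
    have h1 : 0 ≤ Real.pi - 2 * arcsec 3 := by linarith
    have h2 := arcsec_three_pos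
    split_ifs <;> positivity
  have hmeas : MeasurableSet (⋃ I, zone p I r) := MeasurableSet.iUnion fun I => (hzone I).1
  -- Zone volumes depend only on the number of active spheres, so the multiplicities are binomial
  -- coefficients.
  have hsum : ∑ I : Finset (Fin 3), v I.card = v 0 + 3 * v 1 + 3 * v 2 + v 3 := by
    have := Finset.sum_powerset_apply_card v (x := (Finset.univ : Finset (Fin 3)))
    rw [Finset.powerset_univ] at this
    rw [this]
    simp [Finset.sum_range_succ, Nat.choose]
  rw [parallelBody_trihedron hr, measure_union (disjoint_trihedron_zone p r) hmeas,
    measure_iUnion (disjoint_zone p r) fun I => (hzone I).1, tsum_fintype,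
    Finset.sum_congr rfl fun I _ => (hzone I).2, ← ENNReal.ofReal_sum_of_nonneg fun I _ => hv0 _,
    ENNReal.toReal_add (isCompact_trihedron p).measure_lt_top.ne ENNReal.ofReal_ne_top,
    ENNReal.toReal_ofReal (Finset.sum_nonneg fun I _ => hv0 _), hsum]
  simp [hv]

theorem meanWidth_trihedron {p : Fin 3 → E3}
    (hp : ∀ i j : Fin 3, i ≠ j → dist (p i) (p j) = 1) :
    meanWidth (trihedron p) =
      (12 * Real.pi - (24 - Real.sqrt 3 * Real.pi) * arcsec 3) / (4 * Real.pi) := by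
  obtain ⟨c, hc⟩ := exists_volume_parallelBody hp
  obtain ⟨x, hx⟩ := exists_interior_point hp
  -- In M the first term collects the r² terms of the three shells, and the second is 3 · 2 arcsec 3
  -- · (√3/2) · π/6 from the three edges.
  rw [meanWidth_eq_of_volume_parallelBody (V := (volume (trihedron p)).toReal)
    (A := 6 * (Real.pi - 2 * arcsec 3))
    (M := 6 * (Real.pi - 2 * arcsec 3) + Real.sqrt 3 * Real.pi / 2 * arcsec 3)
    (c := 2 * (Real.pi - 2 * arcsec 3) + 2 * arcsec 3 + c) (isCompact_trihedron p)
    ⟨x, mem_trihedron.2 fun i => (hx i).le⟩ fun r hr => by rw [hc r hr]; ring]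
  have := Real.pi_ne_zero
  field_simp
  ring

end Trihedron

theorem mainTheorem2 (p : Fin 3 → Trihedron.E3)
    (hp : ∀ i j : Fin 3, i ≠ j → dist (p i) (p j) = 1) :
    Trihedron.vol (Trihedron.trihedron p) =
        (2 * Real.sqrt 2 + 24 * Real.pi - 57 * Trihedron.arcsec 3) / 12 ∧
    Trihedron.surfaceArea (Trihedron.trihedron p) = 6 * (Real.pi - 2 * Trihedron.arcsec 3) ∧
    (∀ i j : Fin 3, i ≠ j →
      Trihedron.IsCircularArc (Trihedron.edge p i j) (midpoint ℝ (p i) (p j))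
        (Real.sqrt 3 / 2) (2 * Trihedron.arcsec 3) ∧
      ∀ x ∈ Trihedron.edge p i j, Trihedron.dihedralAngle (p i) (p j) x = Real.pi / 3) ∧
    Trihedron.meanWidth (Trihedron.trihedron p) =
        1 / (2 * Real.pi) * Trihedron.surfaceArea (Trihedron.trihedron p) +
          3 / (4 * Real.pi) * (Real.pi / 3) * (2 * Trihedron.arcsec 3) * (Real.sqrt 3 / 2) ∧
    Trihedron.meanWidth (Trihedron.trihedron p) =
        (12 * Real.pi - (24 - Real.sqrt 3 * Real.pi) * Trihedron.arcsec 3) / (4 * Real.pi) ∧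
    1.182061751038757 ≤ Trihedron.meanWidth (Trihedron.trihedron p) ∧
    Trihedron.meanWidth (Trihedron.trihedron p) < 1.182061751038758 := by
  have hMW : Trihedron.meanWidth (Trihedron.trihedron p) =
      (12 * Real.pi - (24 - Real.sqrt 3 * Real.pi) * Trihedron.arcsec 3) / (4 * Real.pi) :=
    Trihedron.meanWidth_trihedron hp
  refine ⟨Trihedron.vol_trihedron hp, Trihedron.surfaceArea_trihedron hp, fun i j hij =>
    ⟨Trihedron.isCircularArc_edge hp hij, fun x hx => Trihedron.dihedralAngle_edge hp hij hx⟩,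
    ?_, hMW, ?_, ?_⟩
  · rw [hMW, Trihedron.surfaceArea_trihedron hp]
    have := Real.pi_pos
    field_simp
    ring
  · rw [hMW]; exact Trihedron.meanWidth_formula_bounds.1
  · rw [hMW]; exact Trihedron.meanWidth_formula_bounds.2
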